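/- **Setting.** Let $N\ge 3$ and let $G_N$ be the connected, simply connected Lie group of the Lie algebra with basis $X_1,\dots,X_N$ and non-trivial brackets $[X_N,X_j]=X_{j-1}$, $2\le j\le N-1$. Let $\mathfrak b=\mathrm{span}(X_1,\dots,X_{N-1})$, identify $V=\mathfrak b^*$ with $\{\xi\in\mathfrak g_N^*:\xi(X_N)=0\}$, let $t\cdot\xi=\mathrm{Ad}^*(\exp tX_N)\xi$, i.e. $(t\cdot\xi)_j=\sum_{k=0}^{j-1}\frac{(-t)^k}{k!}\xi_{j-k}$, and $\hat\xi(t)=(t\cdot\xi)_{N-1}$, a real polynomial in $t$. Call $\xi\in V$ a character if $\xi_j=0$ for $j\le N-2$. Let $S_N^{gen}$ be the set of $\ell\in V$ for which there is $1\le j\le N-2$ with $\ell_j\neq0$, $\ell_{j+1}=0$ and $\ell_k=0$ for $k<j$. For a non-character $\ell\in V$ let $\pi_\ell$ be the irreducible representation of $G_N$ on $L^2(\mathbb R)$, $\pi_\ell(\exp(tX_N)\exp u)\xi(s)=e^{-2\pi i\langle (s-t)\cdot\ell,u\rangle}\xi(s-t)$, $u\in\mathfrak b$; let $\chi_{a,b}(\exp(tX_N)\exp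 u)=e^{-2\pi i(at+bu_{N-1})}$ for $(a,b)\in\mathbb R^2$. $C^*(G_N)$ is the completion of $L^1(G_N)$ for the norm $\sup\|\pi(f)\|$, $\pi$ running through the $\pi_\ell$ ($\ell\in S_N^{gen}$) and the $\chi_{a,b}$. $\rho:C^*(G_N)\to C^*(\mathbb R^2)\cong C_0(\mathbb R^2)$ is the representation with $\widehat{\rho(x)}(a,b)=\chi_{a,b}(x)$. For $x\in C^*(G_N)$ the Fourier transform is the field $F(x)=A$ with $A(\ell)=\pi_\ell(x)$, $\ell\in S_N^{gen}$, and $A(0)=\rho(x)$. The dual $\widehat{G_N}$ carries the hull-kernel topology; a sequence in it is properly convergent if it converges and all its cluster points are limits. A field $A$ on $S_N^{gen}$ is evaluated at an arbitrary non-character $\ell=r\cdot\ell_0$, $\ell_0\in S_N^{gen}$, by $A(\ell)=U(r)A(\ell_0)U(-r)$ where $U(r)\xi(s)=\xi(s+r)$. For measurable $T\subset\mathbb R$ let $M_T$ be the multiplication by $1_T$ on $L^2(\mathbb R)$, and $M_s=M_{(-s,s)}$. **Perfect data.** A sequence $(\ell_k)$ in $S_N^{gen}$ for which $(\pi_{\ell_k})$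 is properly convergent is said to have perfect data if all the polynomials $p_k=\hat\ell_k$ have the same degree $d$, $p_k(t)=c_k\prod_{j=1}^d(t-a_j^k)$ ($a_j^k\in\mathbb C$), and there are $0<m\le 2d$, real sequences $(t_i^k)_k$ and $\ell^i\in V$ ($1\le i\le m$) such that 1. $t_i^k\cdot\ell_k\to\ell^i$ as $k\to\infty$, for all $i$; 2. $|t_i^k-t_{i'}^k|\to\infty$ for $i\ne i'$; 3. with $C=\{i:\ell^i\text{ is a character}\}$, for every $i\in C$: (a) $|t_i^k-a_j^k|\to\infty$ for all $j$; (b) there is $j(i)$ such that $\rho_i^k:=|t_i^k-a_{j(i)}^k|\le|t_i^k-a_j^k|$ for all $j$ and $k$; (c) there is $L(i)\subset\{1,\dots,d\}$ such that $|t_i^k-a_j^k|/\rho_i^k$ has a limit in $\mathbb R$ for $j\in L(i)$ and tends to $+\infty$ for $j\notin L(i)$; (d) there is a real polynomial $p^i$ of degree $\#L(i)$ such that for all $s\in\mathbb R$ the functions $t\mapsto p_k(t+t_i^k+s\rho_i^k)$ converge to the constant $p^i(s)$, uniformly on compacta; (e) $L(i)\cap L(i')=\emptyset$ for $i\ne i'$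 in $C$; 4. with $D=\{1,\dots,m\}\setminus C$, $\rho_i^k:=1$ and $J(i)=\{j:|t_i^k-a_j^k|\to\infty\}$ for $i\in D$: the sequence $(|t_i^k-a_j^k|)_k$ is bounded for $i\in D$, $j\notin J(i)$. Moreover, if along a subsequence $r_k\cdot\ell_k\to\ell\in V$, then after passing to a further subsequence: (a) if $\ell$ is a non-character, $(|r_k-t_i^k|)$ is bounded for some $i\in D$; (b) if $\ell$ is a character, there are $i\in C$ and $j\in L(i)$ such that $\left|\frac{r_k-a_j^k}{t_i^k-a_j^k}\right|$ converges, and $s\in\mathbb R$ with $\ell=p^i(s)X_{N-1}^*$. A real sequence $(s_k)$ is adapted if $s_k\to+\infty$, $s_k/|t_i^k-a_j^k|\to0$ for $i\in D$, $j\in J(i)$, and, for $i\in C$, $s_k/\rho_i^k\to0$ and $s_k\rho_i^k/|t_i^k-a_j^k|\to0$ for $j\notin L(i)$. Fix $\eta\in\mathcal D(\mathbb R)$ (complex-valued) with $\|\eta\|_2=1$. For $i\in C$, $u=(a,b)\in\mathbb R^2$ let $\eta(i,k,u)(s)=\eta\big(s_kp^i(s/\rho_i^k)+s_kb\big)e^{2\pi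 ias}$, let $P_{i,k,u}\xi=\langle\xi,\eta(i,k,u)\rangle\,\eta(i,k,u)$, and for $\varphi\in C^*(\mathbb R^2)$ let $\nu(\varphi)(i,k)=s_k\int_{\mathbb R^2}\hat\varphi(a,-b)P_{i,k,u}\,da\,db$ (a weak integral, which defines a bounded operator on $L^2(\mathbb R)$ for all large $k$). **Theorem.** Let $x\in C^*(G_N)$ and $A=F(x)$. Then each $A(\ell)$, $\ell\in S_N^{gen}$, is compact, and $A$ satisfies the following three conditions, for all sequences $(\ell_k)\subset S_N^{gen}$ with $(\pi_{\ell_k})$ properly convergent, all perfect data and all adapted $(s_k)$. * (Generic condition) For every $i\in D$: $\ \lim_{k\to\infty}\|U(t_i^k)A(\ell_k)U(-t_i^k)M_{s_k}-A(\ell^i)M_{s_k}\|_{op}=0$. * (Character condition) For every $i\in C$: $\ \lim_{k\to\infty}\|U(t_i^k)A(\ell_k)U(-t_i^k)M_{s_k\rho_i^k}-\nu(A(0))(i,k)M_{s_k\rho_i^k}\|_{op}=0$. * (Infinity condition) $\lim_{k\to\infty}\|A(\ell_k)M_{T_k}\|_{op}=0$, where $T_k=\mathbb R\setminus\bigcup_{i=1}^m[t_i^k-s_k\rho_i^k,t_i^k+s_k\rho_i^k]$;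 and $\lim_{k\to\infty}\|A(\ell_k)\|_{op}=0$ for every sequence $(\ell_k)\subset S_N^{gen}$ whose coadjoint orbits $G_N\cdot\ell_k$ go to infinity, i.e. are eventually disjoint from every given compact subset of $\mathfrak g_N^*$. -/

import Mathlib

open MeasureTheory Filter Topology
open scoped ENNReal ContDiff ZeroAtInfty

noncomputable section

namespace ThreadLike

/-! ### The thread-like group and the coadjoint action -/

/-- Coordinates on the abelian ideal `𝔟 = span {X₁, …, X_{N-1}}` of the thread-like Lie algebra
`𝔤_N` (brackets `[X_N, X_j] = X_{j-1}`, `2 ≤ j ≤ N - 1`), and also on its dual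
`V = 𝔟* = {ξ ∈ 𝔤_N* : ξ(X_N) = 0}`.  The index `i : Fin (N - 1)` stands for `X_{i+1}`. -/
abbrev V (N : ℕ) : Type := Fin (N - 1) → ℝ

/-- The duality pairing between `𝔟*` and `𝔟`. -/
def pair {N : ℕ} (l u : V N) : ℝ := ∑ i, l i * u i

/-- The coadjoint action `t · ξ = Ad*(exp (t X_N)) ξ` on `V`:
`(t · ξ)_j = ∑_{k=0}^{j-1} (-t)^k / k! ξ_{j-k}`. -/
def coact {N : ℕ} (t : ℝ) (l : V N) : V N :=
  fun i => ∑ j ∈ Finset.Iic i,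
    (-t) ^ ((i : ℕ) - (j : ℕ)) / (Nat.factorial ((i : ℕ) - (j : ℕ)) : ℝ) * l j

/-- The adjoint action `Ad (exp (t X_N))` on `𝔟`, `Ad (exp (t X_N)) X_j = ∑_k t^k / k! X_{j-k}`. -/
def adj {N : ℕ} (t : ℝ) (u : V N) : V N :=
  fun i => ∑ j ∈ Finset.Ici i,
    t ^ ((j : ℕ) - (i : ℕ)) / (Nat.factorial ((j : ℕ) - (i : ℕ)) : ℝ) * u j

theorem coact_zero {N : ℕ} (l : V N) : coact 0 l = l := by
  funext i
  unfold coact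
  rw [Finset.sum_eq_single i]
  · simp
  · intro j hj hji
    have h1 : j ≤ i := by simpa using hj
    have h2 : j < i := lt_of_le_of_ne h1 hji
    have h3 : (i : ℕ) - (j : ℕ) ≠ 0 := by
      have : (j : ℕ) < (i : ℕ) := h2
      omega
    simp [h3]
  · intro h
    simp at h

theorem binom_sum (x y : ℝ) (m : ℕ) :
    ∑ k ∈ Finset.range (m + 1), x ^ (m - k) / (Nat.factorial (m - k) : ℝ) *
      (y ^ k / (Nat.factorial k : ℝ)) = (x + y) ^ m / (Nat.factorial m : ℝ) := by
  rw [add_comm x y, add_pow, Finset.sum_div]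
  refine Finset.sum_congr rfl fun k hk => ?_
  have hk' : k ≤ m := Nat.lt_succ_iff.mp (Finset.mem_range.mp hk)
  rw [Nat.cast_choose ℝ hk']
  have h1 : (Nat.factorial m : ℝ) ≠ 0 := by positivity
  have h2 : (Nat.factorial k : ℝ) ≠ 0 := by positivity
  have h3 : (Nat.factorial (m - k) : ℝ) ≠ 0 := by positivity
  field_simp

theorem coact_coact {N : ℕ} (t r : ℝ) (l : V N) : coact t (coact r l) = coact (t + r) l := by
  funext i
  unfold coact
  simp_rw [Finset.mul_sum]
  rw [Finset.sum_comm' (t' := Finset.Iic i) (s' := fun j => Finset.Icc j i)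
    (by
      intro x y
      simp only [Finset.mem_Iic, Finset.mem_Icc]
      constructor
      · rintro ⟨h1, h2⟩
        exact ⟨⟨h2, h1⟩, h2.trans h1⟩
      · rintro ⟨⟨h1, h2⟩, _⟩
        exact ⟨h2, h1⟩)]
  refine Finset.sum_congr rfl fun j hj => ?_
  have hji : (j : ℕ) ≤ (i : ℕ) := by
    have : j ≤ i := by simpa using hj
    exact this
  simp_rw [← mul_assoc]
  rw [← Finset.sum_mul]
  congr 1
  rw [neg_add, ← binom_sum]
  refine Finset.sum_bij (fun x _ => (x : ℕ) - (j : ℕ)) ?_ ?_ ?_ ?_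
  · intro x hx
    have hx' : j ≤ x ∧ x ≤ i := by simpa using hx
    have h1 : (j : ℕ) ≤ (x : ℕ) := hx'.1
    have h2 : (x : ℕ) ≤ (i : ℕ) := hx'.2
    simp only [Finset.mem_range]
    omega
  · intro x hx y hy hxy
    have hx' : j ≤ x ∧ x ≤ i := by simpa using hx
    have hy' : j ≤ y ∧ y ≤ i := by simpa using hy
    have h1 : (j : ℕ) ≤ (x : ℕ) := hx'.1
    have h2 : (j : ℕ) ≤ (y : ℕ) := hy'.1
    have hxy' : (x : ℕ) - (j : ℕ) = (y : ℕ) - (j : ℕ) := hxy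
    apply Fin.ext
    omega
  · intro k hk
    have hk' : k < (i : ℕ) - (j : ℕ) + 1 := by simpa using hk
    have hi := i.isLt
    refine ⟨⟨(j : ℕ) + k, by omega⟩, ?_, ?_⟩
    · simp only [Finset.mem_Icc, Fin.le_def]
      omega
    · simp
  · intro x hx
    have hx' : j ≤ x ∧ x ≤ i := by simpa using hx
    have h1 : (j : ℕ) ≤ (x : ℕ) := hx'.1
    have h2 : (x : ℕ) ≤ (i : ℕ) := hx'.2
    have h3 : (i : ℕ) - (j : ℕ) - ((x : ℕ) - (j : ℕ)) = (i : ℕ) - (x : ℕ) := by omega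
    rw [h3]

theorem pair_coact {N : ℕ} (t : ℝ) (l u : V N) : pair (coact t l) u = pair l (adj (-t) u) := by
  unfold pair coact adj
  simp_rw [Finset.sum_mul, Finset.mul_sum]
  rw [Finset.sum_comm' (t' := Finset.univ) (s' := fun j => Finset.Ici j) (by simp)]
  refine Finset.sum_congr rfl fun j _ => Finset.sum_congr rfl fun i _ => ?_
  ring

theorem pair_add_right {N : ℕ} (l u v : V N) : pair l (u + v) = pair l u + pair l v := by
  simp [pair, mul_add, Finset.sum_add_distrib]

theorem pair_zero_right {N : ℕ} (l : V N) : pair l 0 = 0 := by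
  simp [pair]

theorem eq_of_pair {N : ℕ} {u v : V N} (h : ∀ l : V N, pair l u = pair l v) : u = v := by
  funext i
  have := h (Pi.single i 1)
  simpa [pair, Pi.single_apply] using this

theorem adj_adj {N : ℕ} (t r : ℝ) (u : V N) : adj t (adj r u) = adj (t + r) u := by
  refine eq_of_pair fun l => ?_
  have e1 := pair_coact (-t) l (adj r u)
  have e2 := pair_coact (-r) (coact (-t) l) u
  have e3 := pair_coact (-(t + r)) l u
  rw [neg_neg] at e1 e2 e3
  rw [← e1, ← e2, ← e3, coact_coact]
  congr 2
  ring

theorem adj_zero {N : ℕ} (u : V N) : adj 0 u = u := by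
  refine eq_of_pair fun l => ?_
  have e := pair_coact 0 l u
  rw [neg_zero, coact_zero] at e
  exact e.symm

theorem adj_add {N : ℕ} (t : ℝ) (u v : V N) : adj t (u + v) = adj t u + adj t v := by
  funext i
  simp [adj, mul_add, Finset.sum_add_distrib]

/-- The simply connected thread-like Lie group `G_N`; the pair `(t, u)` stands for
`exp (t X_N) exp u` with `u ∈ 𝔟`. -/
def ThreadGroup (N : ℕ) : Type := ℝ × V N

instance (N : ℕ) : TopologicalSpace (ThreadGroup N) := inferInstanceAs (TopologicalSpace (ℝ × V N))
instance (N : ℕ) : SecondCountableTopology (ThreadGroup N) :=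
  inferInstanceAs (SecondCountableTopology (ℝ × V N))
/-- The Haar measure of `G_N` is the Lebesgue measure in the coordinates `(t, u)`. -/
instance (N : ℕ) : MeasureSpace (ThreadGroup N) := inferInstanceAs (MeasureSpace (ℝ × V N))
instance (N : ℕ) : BorelSpace (ThreadGroup N) := inferInstanceAs (BorelSpace (ℝ × V N))

instance (N : ℕ) : Mul (ThreadGroup N) := ⟨fun g h => (g.1 + h.1, adj (-h.1) g.2 + h.2)⟩
instance (N : ℕ) : One (ThreadGroup N) := ⟨((0 : ℝ), (0 : V N))⟩
instance (N : ℕ) : Inv (ThreadGroup N) := ⟨fun g => (-g.1, -adj g.1 g.2)⟩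

theorem mul_def {N : ℕ} (g h : ThreadGroup N) :
    g * h = ((g.1 + h.1, adj (-h.1) g.2 + h.2) : ℝ × V N) := rfl

instance (N : ℕ) : Group (ThreadGroup N) :=
  Group.ofLeftAxioms
    (by
      intro a b c
      refine Prod.ext (add_assoc _ _ _) ?_
      change adj (-c.1) (adj (-b.1) a.2 + b.2) + c.2 =
        adj (-(b.1 + c.1)) a.2 + (adj (-c.1) b.2 + c.2)
      rw [adj_add, adj_adj, add_assoc]
      congr 2
      ring)
    (by
      intro a
      refine Prod.ext (zero_add _) ?_
      change adj (-a.1) 0 + a.2 = a.2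
      have : adj (-a.1) (0 : V N) = 0 := by
        funext i
        simp [adj]
      rw [this, zero_add])
    (by
      intro a
      refine Prod.ext (neg_add_cancel _) ?_
      change adj (-a.1) (-adj a.1 a.2) + a.2 = 0
      have : ∀ (t : ℝ) (u : V N), adj t (-u) = -adj t u := by
        intro t u
        funext i
        simp [adj]
      rw [this, adj_adj, neg_add_cancel, adj_zero, neg_add_cancel])

/-! ### Operators on `L²(ℝ)` -/

/-- The Hilbert space `L²(ℝ)`. -/
abbrev L2 : Type := Lp ℂ 2 (volume : Measure ℝ)

/-- The bounded operators on `L²(ℝ)`. -/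
abbrev BL2 : Type := L2 →L[ℂ] L2

/-- The unitary translation `(U(r)ξ)(s) = ξ(s + r)`. -/
def U (r : ℝ) : BL2 :=
  (Lp.compMeasurePreservingₗᵢ ℂ (fun s : ℝ => s + r)
    (measurePreserving_add_right volume r)).toContinuousLinearMap

/-- The operator of multiplication with an essentially bounded function. -/
def mulOp (m : ℝ → ℂ) (hm : MemLp m ∞ (volume : Measure ℝ)) : BL2 :=
  (ContinuousLinearMap.mul ℂ ℂ).holderL volume ∞ 2 2 (hm.toLp m)

theorem memLp_indicator_one {T : Set ℝ} (hT : MeasurableSet T) :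
    MemLp (T.indicator fun _ => (1 : ℂ)) ∞ (volume : Measure ℝ) :=
  memLp_top_of_bound ((measurable_const.indicator hT).aestronglyMeasurable) 1
    (Eventually.of_forall fun x => by
      by_cases h : x ∈ T <;> simp [h])

/-- The projection `M_T` of multiplication with the characteristic function of `T`. -/
def M (T : Set ℝ) (hT : MeasurableSet T) : BL2 :=
  mulOp (T.indicator fun _ => (1 : ℂ)) (memLp_indicator_one hT)

/-- The projection `M_s`, multiplication with the characteristic function of `(-s, s)`. -/
def Mint (s : ℝ) : BL2 := M (Set.Ioo (-s) s) measurableSet_Ioo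

theorem U_coe (r : ℝ) (f : L2) : (U r f : ℝ → ℂ) =ᵐ[volume] fun s => f (s + r) :=
  Lp.coeFn_compMeasurePreserving f (measurePreserving_add_right volume r)

theorem mulOp_coe (m : ℝ → ℂ) (hm : MemLp m ∞ (volume : Measure ℝ)) (f : L2) :
    (mulOp m hm f : ℝ → ℂ) =ᵐ[volume] fun s => m s * f s := by
  have h1 := (ContinuousLinearMap.mul ℂ ℂ).coeFn_holder (r := 2) (hm.toLp m) f
  filter_upwards [h1, hm.coeFn_toLp] with s hs1 hs2
  have : (mulOp m hm f : ℝ → ℂ) s =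
    ((ContinuousLinearMap.mul ℂ ℂ).holder 2 (hm.toLp m) f : ℝ → ℂ) s := rfl
  rw [this, hs1, hs2]
  rfl

/-! ### The irreducible representations of `G_N` -/

theorem continuous_pair_coact {N : ℕ} (l : V N) :
    Continuous fun p : ℝ × ThreadGroup N => pair (coact (p.1 - p.2.1) l) p.2.2 := by
  have h1 : Continuous fun p : ℝ × ThreadGroup N => p.2.1 :=
    (continuous_fst (X := ℝ) (Y := V N)).comp continuous_snd
  have h2 : Continuous fun p : ℝ × ThreadGroup N => p.2.2 :=
    (continuous_snd (X := ℝ) (Y := V N)).comp continuous_snd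
  have h3 : ∀ i, Continuous fun p : ℝ × ThreadGroup N => p.2.2 i :=
    fun i => (continuous_apply i).comp h2
  unfold pair coact
  fun_prop

/-- The phase `s ↦ exp (-2πi ⟨(s - t) · ℓ, u⟩)` for `g = exp (t X_N) exp u`. -/
def phase {N : ℕ} (l : V N) (g : ThreadGroup N) (s : ℝ) : ℂ :=
  Complex.exp ((-2 * Real.pi * pair (coact (s - g.1) l) g.2 : ℝ) * Complex.I)

theorem continuous_phase {N : ℕ} (l : V N) :
    Continuous fun p : ℝ × ThreadGroup N => phase l p.2 p.1 := by
  unfold phase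
  have := continuous_pair_coact l
  fun_prop

theorem continuous_phase_left {N : ℕ} (l : V N) (g : ThreadGroup N) : Continuous (phase l g) := by
  have h : Continuous fun s : ℝ => ((s, g) : ℝ × ThreadGroup N) :=
    continuous_id.prodMk continuous_const
  simpa only [Function.comp_def] using (continuous_phase l).comp h

theorem continuous_phase_right {N : ℕ} (l : V N) (s : ℝ) :
    Continuous fun g : ThreadGroup N => phase l g s := by
  have h : Continuous fun g : ThreadGroup N => ((s, g) : ℝ × ThreadGroup N) :=
    continuous_const.prodMk continuous_id
  simpa only [Function.comp_def] using (continuous_phase l).comp h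

theorem norm_phase {N : ℕ} (l : V N) (g : ThreadGroup N) (s : ℝ) : ‖phase l g s‖ = 1 :=
  Complex.norm_exp_ofReal_mul_I _

theorem memLp_phase {N : ℕ} (l : V N) (g : ThreadGroup N) :
    MemLp (phase l g) ∞ (volume : Measure ℝ) :=
  memLp_top_of_bound
    (continuous_phase_left l g).aestronglyMeasurable 1
    (Eventually.of_forall fun s => (norm_phase l g s).le)

/-- `(π_ℓ(g)ξ)(s) = exp (-2πi ⟨(s - t) · ℓ, u⟩) ξ(s - t)` for `g = exp (t X_N) exp u`. -/
def piOp {N : ℕ} (l : V N) (g : ThreadGroup N) : BL2 :=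
  (mulOp (phase l g) (memLp_phase l g)).comp (U (-g.1))

theorem piOp_coe {N : ℕ} (l : V N) (g : ThreadGroup N) (f : L2) :
    (piOp l g f : ℝ → ℂ) =ᵐ[volume] fun s => phase l g s * f (s - g.1) := by
  filter_upwards [mulOp_coe (phase l g) (memLp_phase l g) (U (-g.1) f), U_coe (-g.1) f]
    with s h1 h2
  change (mulOp (phase l g) (memLp_phase l g) (U (-g.1) f) : ℝ → ℂ) s = _
  rw [h1, h2, sub_eq_add_neg]

theorem norm_piOp_apply {N : ℕ} (l : V N) (g : ThreadGroup N) (f : L2) : ‖piOp l g f‖ = ‖f‖ := by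
  have h : ‖U (-g.1) f‖ = ‖f‖ :=
    (Lp.compMeasurePreservingₗᵢ ℂ (fun s : ℝ => s + -g.1)
      (measurePreserving_add_right volume (-g.1))).norm_map f
  rw [← h, Lp.norm_def, Lp.norm_def]
  congr 1
  refine eLpNorm_congr_norm_ae ?_
  filter_upwards [mulOp_coe (phase l g) (memLp_phase l g) (U (-g.1) f)] with s h1
  change ‖(mulOp (phase l g) (memLp_phase l g) (U (-g.1) f) : ℝ → ℂ) s‖ = _
  rw [h1, norm_mul, norm_phase, one_mul]

theorem phase_mul {N : ℕ} (l : V N) (g h : ThreadGroup N) (s : ℝ) :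
    phase l (g * h) s = phase l g s * phase l h (s - g.1) := by
  unfold phase
  rw [← Complex.exp_add, ← add_mul, ← Complex.ofReal_add, mul_def]
  congr 3
  change -2 * Real.pi * pair (coact (s - (g.1 + h.1)) l) (adj (-h.1) g.2 + h.2) = _
  rw [pair_add_right, ← pair_coact, coact_coact]
  rw [show h.1 + (s - (g.1 + h.1)) = s - g.1 by ring,
    show s - (g.1 + h.1) = s - g.1 - h.1 by ring]
  ring

/-- The unitary representation `π_ℓ = ind_B^G χ_ℓ` of `G_N`, realized on `L²(ℝ)`. -/
def piRep {N : ℕ} (l : V N) : ThreadGroup N →* BL2 where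
  toFun := piOp l
  map_one' := by
    ext f
    filter_upwards [piOp_coe l 1 f] with s hs
    have h1 : (1 : ThreadGroup N).1 = 0 := rfl
    have h2 : (1 : ThreadGroup N).2 = 0 := rfl
    rw [hs]
    simp [phase, h1, h2, pair_zero_right]
  map_mul' g h := by
    ext f
    have hq := (measurePreserving_sub_right (volume : Measure ℝ) g.1).quasiMeasurePreserving.ae_eq
      (piOp_coe l h f)
    filter_upwards [piOp_coe l (g * h) f, piOp_coe l g (piOp l h f), hq] with s h1 h2 h3
    have h4 : (piOp l h f : ℝ → ℂ) (s - g.1) =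
      phase l h (s - g.1) * f (s - g.1 - h.1) := h3
    change (piOp l (g * h) f : ℝ → ℂ) s = (piOp l g (piOp l h f) : ℝ → ℂ) s
    rw [h1, h2, h4, phase_mul, mul_assoc]
    congr 3
    change s - (g.1 + h.1) = _
    ring

theorem norm_mulOp_phase {N : ℕ} (l : V N) (g : ThreadGroup N) (f : L2) :
    ‖mulOp (phase l g) (memLp_phase l g) f‖ = ‖f‖ := by
  rw [Lp.norm_def, Lp.norm_def]
  congr 1
  refine eLpNorm_congr_norm_ae ?_
  filter_upwards [mulOp_coe (phase l g) (memLp_phase l g) f] with s h1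
  rw [h1, norm_mul, norm_phase, one_mul]

theorem continuous_mulOp_phase {N : ℕ} (l : V N) (f : L2) :
    Continuous fun g : ThreadGroup N => mulOp (phase l g) (memLp_phase l g) f := by
  rw [continuous_iff_continuousAt]
  intro g₀
  obtain ⟨x, hx⟩ : ∃ x : ThreadGroup N → L2, ∀ g, x g = mulOp (phase l g) (memLp_phase l g) f :=
    ⟨_, fun _ => rfl⟩
  have hin : ∀ g, inner ℂ (x g) (x g₀) =
      ∫ s, inner ℂ (phase l g s * f s) (phase l g₀ s * f s) := by
    intro g
    rw [L2.inner_def]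
    refine integral_congr_ae ?_
    filter_upwards [mulOp_coe (phase l g) (memLp_phase l g) f,
      mulOp_coe (phase l g₀) (memLp_phase l g₀) f] with s h1 h2
    rw [hx, hx, h1, h2]
  have hf2 : Integrable (fun s => ‖f s‖ ^ 2) (volume : Measure ℝ) :=
    (memLp_two_iff_integrable_sq_norm (Lp.aestronglyMeasurable f)).1 (Lp.memLp f)
  have hlim : Tendsto (fun g => inner ℂ (x g) (x g₀)) (𝓝 g₀) (𝓝 (inner ℂ (x g₀) (x g₀))) := by
    have : FirstCountableTopology (ThreadGroup N) := inferInstance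
    simp_rw [hin]
    have hc : ∀ g, Continuous (phase l g) := continuous_phase_left l
    refine tendsto_integral_filter_of_dominated_convergence (fun s => ‖f s‖ ^ 2) ?_ ?_ hf2 ?_
    · refine Eventually.of_forall fun g => ?_
      exact ((hc g).aestronglyMeasurable.mul (Lp.aestronglyMeasurable f)).inner
        ((hc g₀).aestronglyMeasurable.mul (Lp.aestronglyMeasurable f))
    · refine Eventually.of_forall fun g => Eventually.of_forall fun s => ?_
      refine (norm_inner_le_norm _ _).trans ?_
      rw [norm_mul, norm_mul, norm_phase, norm_phase, one_mul, sq]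
    · refine Eventually.of_forall fun s => ?_
      have h2 := continuous_phase_right l s
      exact (((h2.mul continuous_const).inner continuous_const).tendsto g₀)
  have hnorm : ∀ g, ‖x g - x g₀‖ ^ 2 = ‖f‖ ^ 2 - 2 * RCLike.re (inner ℂ (x g) (x g₀)) + ‖f‖ ^ 2 := by
    intro g
    rw [@norm_sub_sq ℂ]
    rw [hx, hx, norm_mulOp_phase, norm_mulOp_phase]
  have h0 : Tendsto (fun g => ‖x g - x g₀‖ ^ 2) (𝓝 g₀) (𝓝 0) := by
    have e0 := hnorm g₀
    rw [sub_self, norm_zero, zero_pow two_ne_zero] at e0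
    rw [e0]
    simp_rw [hnorm]
    have := (RCLike.continuous_re.tendsto _).comp hlim
    exact ((this.const_mul 2).const_sub _).add_const _
  have h1 : Tendsto (fun g => ‖x g - x g₀‖) (𝓝 g₀) (𝓝 0) := by
    have := h0.sqrt
    simpa [Real.sqrt_sq (norm_nonneg _)] using this
  refine tendsto_iff_norm_sub_tendsto_zero.2 ?_
  simpa only [hx] using h1

theorem continuous_U (f : L2) : Continuous fun r : ℝ => U r f := by
  let c : ℝ → C(ℝ, ℝ) := fun r => ⟨fun s => s + r, by fun_prop⟩
  have hc : Continuous c :=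
    ContinuousMap.continuous_of_continuous_uncurry c (by
      change Continuous fun p : ℝ × ℝ => p.2 + p.1
      fun_prop)
  exact (continuous_const (y := f)).compMeasurePreservingLp hc
    (fun r => measurePreserving_add_right volume r) (by simp)

/-- The representations `π_ℓ` are strongly continuous. -/
theorem continuous_piRep {N : ℕ} (l : V N) (f : L2) :
    Continuous fun g : ThreadGroup N => piRep l g f := by
  rw [continuous_iff_continuousAt]
  intro g₀
  have hfst : Continuous fun g : ThreadGroup N => g.1 := continuous_fst (X := ℝ) (Y := V N)
  have h1 : Tendsto (fun g : ThreadGroup N => ‖U (-g.1) f - U (-g₀.1) f‖) (𝓝 g₀) (𝓝 0) :=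
    tendsto_iff_norm_sub_tendsto_zero.1 (((continuous_U f).comp hfst.neg).tendsto g₀)
  have h2 := tendsto_iff_norm_sub_tendsto_zero.1
    ((continuous_mulOp_phase l (U (-g₀.1) f)).tendsto g₀)
  refine tendsto_iff_norm_sub_tendsto_zero.2 ?_
  refine squeeze_zero (fun _ => norm_nonneg _) (fun g => ?_) (by simpa using h1.add h2)
  change ‖mulOp (phase l g) (memLp_phase l g) (U (-g.1) f) -
    mulOp (phase l g₀) (memLp_phase l g₀) (U (-g₀.1) f)‖ ≤ _
  refine (norm_sub_le_norm_sub_add_norm_sub _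
    (mulOp (phase l g) (memLp_phase l g) (U (-g₀.1) f)) _).trans ?_
  rw [← map_sub, norm_mulOp_phase]

/-- The one-dimensional character `χ_{a,b}(x_N, …, x₁) = exp (-2πi (a x_N + b x_{N-1}))`. -/
def chi {N : ℕ} [hN : Fact (3 ≤ N)] (p : ℝ × ℝ) (g : ThreadGroup N) : ℂ :=
  Complex.exp ((-2 * Real.pi *
    (p.1 * g.1 + p.2 * g.2 ⟨N - 2, by have := hN.out; omega⟩) : ℝ) * Complex.I)

theorem norm_chi {N : ℕ} [Fact (3 ≤ N)] (p : ℝ × ℝ) (g : ThreadGroup N) : ‖chi p g‖ = 1 :=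
  Complex.norm_exp_ofReal_mul_I _

theorem continuous_chi {N : ℕ} [hN : Fact (3 ≤ N)] :
    Continuous fun q : (ℝ × ℝ) × ThreadGroup N => chi q.1 q.2 := by
  have h1 : Continuous fun q : (ℝ × ℝ) × ThreadGroup N => q.2.1 :=
    (continuous_fst (X := ℝ) (Y := V N)).comp continuous_snd
  have h2 : Continuous fun q : (ℝ × ℝ) × ThreadGroup N => q.2.2 :=
    (continuous_snd (X := ℝ) (Y := V N)).comp continuous_snd
  have h3 : ∀ i, Continuous fun q : (ℝ × ℝ) × ThreadGroup N => q.2.2 i :=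
    fun i => (continuous_apply i).comp h2
  unfold chi
  fun_prop

/-! ### The group `C*`-algebra -/

/-- The Banach space `L¹(G_N)`. -/
abbrev L1 (N : ℕ) : Type := Lp ℂ 1 (volume : Measure (ThreadGroup N))

theorem integrable_smul_piRep {N : ℕ} (l : V N) (f : L1 N) (x : L2) :
    Integrable fun g => (f g) • piRep l g x :=
  (L1.integrable_coeFn f).smul_bdd ‖x‖
    (continuous_piRep l x).aestronglyMeasurable
    (Eventually.of_forall fun g => (norm_piOp_apply l g x).le)

theorem norm_integral_piRep_le {N : ℕ} (l : V N) (f : L1 N) (x : L2) :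
    ‖∫ g, (f g) • piRep l g x‖ ≤ ‖f‖ * ‖x‖ := by
  refine (norm_integral_le_integral_norm _).trans ?_
  change ∫ g, ‖(f g) • piOp l g x‖ ≤ _
  simp_rw [norm_smul, norm_piOp_apply]
  rw [integral_mul_const, ← L1.norm_eq_integral_norm]

/-- The integrated representation `π_ℓ(f)ξ = ∫ f(g) π_ℓ(g)ξ dg` of `f ∈ L¹(G_N)`. -/
def piL1 {N : ℕ} (l : V N) : L1 N →ₗ[ℂ] BL2 where
  toFun f := LinearMap.mkContinuous
    { toFun := fun x => ∫ g, (f g) • piRep l g x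
      map_add' := fun x y => by
        simp_rw [map_add, smul_add]
        exact integral_add (integrable_smul_piRep l f x) (integrable_smul_piRep l f y)
      map_smul' := fun c x => by
        simp_rw [map_smul, smul_comm _ c]
        exact integral_smul c _ } ‖f‖ (norm_integral_piRep_le l f)
  map_add' f h := by
    ext1 x
    change ∫ g, ((f + h : L1 N) g) • piRep l g x =
      (∫ g, (f g) • piRep l g x) + ∫ g, (h g) • piRep l g x
    rw [← integral_add (integrable_smul_piRep l f x) (integrable_smul_piRep l h x)]
    refine integral_congr_ae ?_
    filter_upwards [Lp.coeFn_add f h] with g hg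
    rw [hg, Pi.add_apply, add_smul]
  map_smul' c f := by
    ext1 x
    change ∫ g, ((c • f : L1 N) g) • piRep l g x = c • ∫ g, (f g) • piRep l g x
    rw [← integral_smul]
    refine integral_congr_ae ?_
    filter_upwards [Lp.coeFn_smul c f] with g hg
    rw [hg, Pi.smul_apply, smul_assoc]

theorem piL1_apply {N : ℕ} (l : V N) (f : L1 N) (x : L2) :
    piL1 l f x = ∫ g, (f g) • piRep l g x := rfl

theorem norm_piL1_le {N : ℕ} (l : V N) (f : L1 N) : ‖piL1 l f‖ ≤ ‖f‖ :=
  ContinuousLinearMap.opNorm_le_bound _ (norm_nonneg _) (norm_integral_piRep_le l f)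

theorem integrable_mul_chi {N : ℕ} [Fact (3 ≤ N)] (p : ℝ × ℝ) (f : L1 N) :
    Integrable fun g => f g * chi p g :=
  (L1.integrable_coeFn f).smul_bdd 1
    ((continuous_chi (N := N)).comp (Continuous.prodMk_right p)).aestronglyMeasurable
    (Eventually.of_forall fun g => (norm_chi p g).le)

/-- The integrated character `χ_{a,b}(f) = ∫ f(g) χ_{a,b}(g) dg` of `f ∈ L¹(G_N)`. -/
def chiL1 {N : ℕ} [Fact (3 ≤ N)] (p : ℝ × ℝ) : L1 N →ₗ[ℂ] ℂ where
  toFun f := ∫ g, f g * chi p g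
  map_add' f h := by
    rw [← integral_add (integrable_mul_chi p f) (integrable_mul_chi p h)]
    refine integral_congr_ae ?_
    filter_upwards [Lp.coeFn_add f h] with g hg
    rw [hg, Pi.add_apply, add_mul]
  map_smul' c f := by
    rw [RingHom.id_apply, ← integral_smul]
    refine integral_congr_ae ?_
    filter_upwards [Lp.coeFn_smul c f] with g hg
    rw [hg, Pi.smul_apply, smul_eq_mul, smul_eq_mul, mul_assoc]

theorem norm_chiL1_le {N : ℕ} [Fact (3 ≤ N)] (p : ℝ × ℝ) (f : L1 N) : ‖chiL1 p f‖ ≤ ‖f‖ := by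
  refine (norm_integral_le_integral_norm _).trans ?_
  simp_rw [norm_mul, norm_chi, mul_one]
  rw [← L1.norm_eq_integral_norm]

/-- `ℓ ∈ V` lies in `S_N^j` for some `1 ≤ j ≤ N - 2`: `ℓ(X_j) ≠ 0`, `ℓ(X_{j+1}) = 0` and
`ℓ(X_k) = 0` for `k < j`.  (The index `j` below is shifted by one.) -/
def IsGen {N : ℕ} (l : V N) : Prop :=
  ∃ (j : ℕ) (hj : j + 1 < N - 1), l ⟨j, by omega⟩ ≠ 0 ∧ l ⟨j + 1, hj⟩ = 0 ∧
    ∀ k : Fin (N - 1), (k : ℕ) < j → l k = 0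

/-- The set `S_N^gen` of normalized representatives of the two-dimensional coadjoint orbits. -/
abbrev Sgen (N : ℕ) : Type := {l : V N // IsGen l}

/-- The set `S_N = S_N^gen ∪ X*`, which parametrizes the unitary dual of `G_N`; here
`X* ≅ ℝ²` parametrizes the characters `χ_{a,b}`. -/
abbrev SN (N : ℕ) : Type := Sgen N ⊕ (ℝ × ℝ)

/-- The norm `‖π(f)‖` for the irreducible representation `π` with parameter in `S_N`. -/
def repNorm {N : ℕ} [Fact (3 ≤ N)] (f : L1 N) : SN N → ℝ :=
  Sum.elim (fun l => ‖piL1 l.1 f‖) (fun p => ‖chiL1 p f‖)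

theorem repNorm_le {N : ℕ} [Fact (3 ≤ N)] (f : L1 N) (σ : SN N) : repNorm f σ ≤ ‖f‖ := by
  cases σ with
  | inl l => exact norm_piL1_le l.1 f
  | inr p => exact norm_chiL1_le p f

theorem bddAbove_repNorm {N : ℕ} [Fact (3 ≤ N)] (f : L1 N) :
    BddAbove (Set.range (repNorm f)) :=
  ⟨‖f‖, by rintro _ ⟨σ, rfl⟩; exact repNorm_le f σ⟩

theorem repNorm_add_le {N : ℕ} [Fact (3 ≤ N)] (f h : L1 N) (σ : SN N) :
    repNorm (f + h) σ ≤ repNorm f σ + repNorm h σ := by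
  cases σ with
  | inl l =>
    change ‖piL1 l.1 (f + h)‖ ≤ ‖piL1 l.1 f‖ + ‖piL1 l.1 h‖
    rw [map_add]
    exact norm_add_le _ _
  | inr p =>
    change ‖chiL1 p (f + h)‖ ≤ ‖chiL1 p f‖ + ‖chiL1 p h‖
    rw [map_add]
    exact norm_add_le _ _

theorem repNorm_smul {N : ℕ} [Fact (3 ≤ N)] (c : ℂ) (f : L1 N) (σ : SN N) :
    repNorm (c • f) σ = ‖c‖ * repNorm f σ := by
  cases σ with
  | inl l =>
    change ‖piL1 l.1 (c • f)‖ = ‖c‖ * ‖piL1 l.1 f‖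
    rw [map_smul, norm_smul]
  | inr p =>
    change ‖chiL1 p (c • f)‖ = ‖c‖ * ‖chiL1 p f‖
    rw [map_smul, norm_smul]

/-- The space `L¹(G_N)` regarded with the `C*`-norm instead of the `L¹`-norm. -/
def L1C (N : ℕ) : Type := L1 N

instance (N : ℕ) : AddCommGroup (L1C N) := inferInstanceAs (AddCommGroup (L1 N))
instance (N : ℕ) : Module ℂ (L1C N) := inferInstanceAs (Module ℂ (L1 N))

/-- The identity map `L¹(G_N) → L¹(G_N)`, the target being regarded with the `C*`-norm. -/
def toL1C {N : ℕ} : L1 N ≃ₗ[ℂ] L1C N := LinearEquiv.refl ℂ (L1 N)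

/-- The `C*`-norm `‖f‖ = sup_{ℓ ∈ S_N} ‖π_ℓ(f)‖`, the supremum being taken over all irreducible
unitary representations of `G_N`. -/
def cstarSeminorm (N : ℕ) [Fact (3 ≤ N)] : Seminorm ℂ (L1C N) :=
  Seminorm.of (fun f => ⨆ σ : SN N, repNorm (toL1C.symm f) σ)
    (fun f h => by
      have : Nonempty (SN N) := ⟨Sum.inr (0, 0)⟩
      refine ciSup_le fun σ => ?_
      rw [map_add]
      exact (repNorm_add_le _ _ σ).trans
        (add_le_add (le_ciSup (bddAbove_repNorm _) σ) (le_ciSup (bddAbove_repNorm _) σ)))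
    (fun c f => by
      rw [map_smul, Real.mul_iSup_of_nonneg (norm_nonneg c)]
      simp_rw [repNorm_smul])

instance (N : ℕ) [Fact (3 ≤ N)] : SeminormedAddCommGroup (L1C N) :=
  (cstarSeminorm N).toAddGroupSeminorm.toSeminormedAddCommGroup

theorem norm_L1C {N : ℕ} [Fact (3 ≤ N)] (f : L1C N) :
    ‖f‖ = ⨆ σ : SN N, repNorm (toL1C.symm f) σ := rfl

instance (N : ℕ) [Fact (3 ≤ N)] : NormedSpace ℂ (L1C N) where
  norm_smul_le c f := ((cstarSeminorm N).smul' c f).le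

theorem repNorm_le_norm {N : ℕ} [Fact (3 ≤ N)] (f : L1C N) (σ : SN N) :
    repNorm (toL1C.symm f) σ ≤ ‖f‖ :=
  le_ciSup (bddAbove_repNorm (toL1C.symm f)) σ

/-- The full group `C*`-algebra `C*(G_N)`: the completion of `L¹(G_N)` in the `C*`-norm. -/
abbrev CStar (N : ℕ) [Fact (3 ≤ N)] : Type := UniformSpace.Completion (L1C N)

/-- The canonical map `L¹(G_N) → C*(G_N)`. -/
def ofL1 {N : ℕ} [Fact (3 ≤ N)] (f : L1 N) : CStar N := ((toL1C f : L1C N) : CStar N)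

/-- The representation `π_ℓ`, `ℓ ∈ S_N^gen`, of `C*(G_N)`: the continuous extension of the
integrated representation of `L¹(G_N)`. -/
def piStar {N : ℕ} [Fact (3 ≤ N)] (l : Sgen N) : CStar N →L[ℂ] BL2 :=
  ContinuousLinearMap.extend
    (LinearMap.mkContinuous ((piL1 l.1).comp (toL1C (N := N)).symm.toLinearMap) 1 (fun f => by
      rw [one_mul]
      exact repNorm_le_norm f (Sum.inl l)))
    (UniformSpace.Completion.toComplL (𝕜 := ℂ) (E := L1C N))

/-- The character `χ_{a,b}` of `C*(G_N)`, by continuous extension from `L¹(G_N)`. -/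
def chiStar {N : ℕ} [Fact (3 ≤ N)] (p : ℝ × ℝ) : CStar N →L[ℂ] ℂ :=
  ContinuousLinearMap.extend
    (LinearMap.mkContinuous ((chiL1 p).comp (toL1C (N := N)).symm.toLinearMap) 1 (fun f => by
      rw [one_mul]
      exact repNorm_le_norm f (Sum.inr p)))
    (UniformSpace.Completion.toComplL (𝕜 := ℂ) (E := L1C N))

theorem piStar_ofL1 {N : ℕ} [Fact (3 ≤ N)] (l : Sgen N) (f : L1 N) :
    piStar l (ofL1 f) = piL1 l.1 f :=
  ContinuousLinearMap.extend_eq _ UniformSpace.Completion.denseRange_coe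
    (UniformSpace.Completion.isUniformInducing_coe _) (toL1C f)

theorem chiStar_ofL1 {N : ℕ} [Fact (3 ≤ N)] (p : ℝ × ℝ) (f : L1 N) :
    chiStar p (ofL1 f) = chiL1 p f :=
  ContinuousLinearMap.extend_eq _ UniformSpace.Completion.denseRange_coe
    (UniformSpace.Completion.isUniformInducing_coe _) (toL1C f)

/-! ### The Fourier transform of `C*(G_N)` -/

/-- The last coordinate index, which stands for `X_{N-1}`. -/
def top (N : ℕ) [hN : Fact (3 ≤ N)] : Fin (N - 1) := ⟨N - 2, by have := hN.out; omega⟩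

/-- The functional `(x_N, …, x₁) ↦ a x_N + b x_{N-1}`. -/
def planeDual (N : ℕ) [Fact (3 ≤ N)] : ℝ × ℝ →ₗ[ℝ] StrongDual ℝ (ℝ × V N) where
  toFun p := p.1 • ContinuousLinearMap.fst ℝ ℝ (V N) +
    p.2 • (ContinuousLinearMap.proj (top N)).comp (ContinuousLinearMap.snd ℝ ℝ (V N))
  map_add' p q := by
    simp only [Prod.fst_add, Prod.snd_add, add_smul]
    abel
  map_smul' c p := by
    simp only [Prod.smul_fst, Prod.smul_snd, smul_assoc, smul_add, RingHom.id_apply]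

theorem planeDual_apply {N : ℕ} [Fact (3 ≤ N)] (p : ℝ × ℝ) (x : ℝ × V N) :
    planeDual N p x = p.1 * x.1 + p.2 * x.2 (top N) := rfl

theorem planeDual_injective (N : ℕ) [Fact (3 ≤ N)] : Function.Injective (planeDual N) := by
  refine (injective_iff_map_eq_zero _).2 fun p hp => ?_
  have h1 := planeDual_apply p ((1, 0) : ℝ × V N)
  have h2 := planeDual_apply p ((0, Pi.single (top N) 1) : ℝ × V N)
  rw [hp] at h1 h2
  refine Prod.ext ?_ ?_
  · simpa using h1.symm
  · simpa using h2.symm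

theorem continuous_chiL1 {N : ℕ} [Fact (3 ≤ N)] (f : L1 N) :
    Continuous fun p : ℝ × ℝ => chiL1 p f := by
  refine continuous_of_dominated (bound := fun g => ‖f g‖)
    (fun p => (integrable_mul_chi p f).aestronglyMeasurable)
    (fun p => Eventually.of_forall fun g => ?_) (L1.integrable_coeFn f).norm
    (Eventually.of_forall fun g => ?_)
  · rw [norm_mul, norm_chi, mul_one]
  · have h : Continuous fun p : ℝ × ℝ => ((p, g) : (ℝ × ℝ) × ThreadGroup N) :=
      continuous_id.prodMk continuous_const
    have h2 : Continuous fun p : ℝ × ℝ => chi p g := by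
      simpa only [Function.comp_def] using (continuous_chi (N := N)).comp h
    exact continuous_const.mul h2

theorem tendsto_chiL1_cocompact {N : ℕ} [Fact (3 ≤ N)] (f : L1 N) :
    Tendsto (fun p : ℝ × ℝ => chiL1 p f) (cocompact (ℝ × ℝ)) (𝓝 0) := by
  have h0 : (volume : Measure (ℝ × V N)).IsAddHaarMeasure := by
    rw [Measure.volume_eq_prod]
    infer_instance
  have h1 := tendsto_integral_exp_smul_cocompact (V := ℝ × V N) (fun x => f x)
    (volume : Measure (ℝ × V N))
  have h2 : Tendsto (planeDual N) (cocompact (ℝ × ℝ)) (cocompact (StrongDual ℝ (ℝ × V N))) :=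
    ((planeDual N).isClosedEmbedding_of_injective
      (LinearMap.ker_eq_bot.2 (planeDual_injective N))).tendsto_cocompact
  refine (h1.comp h2).congr fun p => ?_
  change (∫ x : ℝ × V N, Real.fourierChar (-(planeDual N p x)) • f x) =
    ∫ g : ℝ × V N, f g * chi p g
  refine integral_congr_ae (Eventually.of_forall fun x => ?_)
  have e : chi p (x : ThreadGroup N) = (Real.fourierChar (-(planeDual N p x)) : ℂ) := by
    rw [Real.fourierChar_apply, planeDual_apply]
    unfold chi top
    congr 2
    push_cast
    ring
  change Real.fourierChar (-(planeDual N p x)) • f x = f x * chi p (x : ThreadGroup N)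
  rw [e, Circle.smul_def, smul_eq_mul, mul_comm]

/-- The `C*`-algebra `C*(ℝ²)`, identified by the Fourier transform with `C₀(ℝ²)`; an element `φ`
is thus given by its Fourier transform `φ̂`. -/
abbrev CStarR2 : Type := C₀(ℝ × ℝ, ℂ)

/-- `ρ(f)`, `f ∈ L¹(G_N)`, for `ρ = ind_C^G 1`: its Fourier transform at `(a, b)` is
`χ_{a,b}(f) = f̂(a, b, 0, …, 0)`. -/
def rhoL1 {N : ℕ} [Fact (3 ≤ N)] : L1 N →ₗ[ℂ] CStarR2 where
  toFun f := ⟨⟨fun p => chiL1 p f, continuous_chiL1 f⟩, tendsto_chiL1_cocompact f⟩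
  map_add' f h := by
    ext p
    exact map_add (chiL1 p) f h
  map_smul' c f := by
    ext p
    exact map_smul (chiL1 p) c f

theorem norm_rhoL1_le {N : ℕ} [Fact (3 ≤ N)] (f : L1C N) : ‖rhoL1 (toL1C.symm f)‖ ≤ ‖f‖ := by
  rw [← ZeroAtInftyContinuousMap.norm_toBCF_eq_norm]
  refine (BoundedContinuousFunction.norm_le (norm_nonneg f)).2 fun p => ?_
  exact repNorm_le_norm f (Sum.inr p)

/-- The representation `ρ : C*(G_N) → C*(ℝ²)`. -/
def rhoStar {N : ℕ} [Fact (3 ≤ N)] : CStar N →L[ℂ] CStarR2 :=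
  ContinuousLinearMap.extend
    (LinearMap.mkContinuous (rhoL1.comp (toL1C (N := N)).symm.toLinearMap) 1 (fun f => by
      rw [one_mul]
      exact norm_rhoL1_le f))
    (UniformSpace.Completion.toComplL (𝕜 := ℂ) (E := L1C N))

theorem rhoStar_ofL1 {N : ℕ} [Fact (3 ≤ N)] (f : L1 N) :
    rhoStar (ofL1 f) = rhoL1 f :=
  ContinuousLinearMap.extend_eq _ UniformSpace.Completion.denseRange_coe
    (UniformSpace.Completion.isUniformInducing_coe _) (toL1C f)

/-- Operator fields `A = (A(ℓ), ℓ ∈ S_N^gen; A(0))`, `A(ℓ)` a bounded operator on `L²(ℝ)` and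
`A(0) ∈ C*(ℝ²)`. -/
structure OpField (N : ℕ) where
  gen : Sgen N → BL2
  zero : CStarR2

/-- The Fourier transform `F(a) = (π_ℓ(a), ℓ ∈ S_N^gen; ρ(a))` of `a ∈ C*(G_N)`. -/
def fourier {N : ℕ} [Fact (3 ≤ N)] (a : CStar N) : OpField N where
  gen l := piStar l a
  zero := rhoStar a

/-! ### The topology of the dual space -/

/-- The unitary dual of `G_N`, parametrized by `S_N`. -/
def UDual (N : ℕ) : Type := SN N

/-- The point of the dual given by `π_ℓ`, `ℓ ∈ S_N^gen`. -/
def UDual.pi {N : ℕ} (l : Sgen N) : UDual N := (Sum.inl l : SN N)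

/-- `π(a) ≠ 0`. -/
def UDual.NonVanishing {N : ℕ} [Fact (3 ≤ N)] (a : CStar N) (σ : UDual N) : Prop :=
  Sum.elim (fun l => piStar l a ≠ 0) (fun p => chiStar p a ≠ 0) (σ : SN N)

/-- The hull-kernel (Fell) topology of the dual: its open sets are the sets `{π : π(I) ≠ 0}` for
the ideals `I` of `C*(G_N)`, that is, the unions of sets of the form `{π : π(a) ≠ 0}`. -/
instance (N : ℕ) [Fact (3 ≤ N)] : TopologicalSpace (UDual N) :=
  TopologicalSpace.generateFrom (Set.range fun a : CStar N => {σ | UDual.NonVanishing a σ})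

/-- A sequence is properly convergent if it converges and all its cluster points are limits. -/
def ProperlyConvergent {N : ℕ} [Fact (3 ≤ N)] (x : ℕ → UDual N) : Prop :=
  (∃ σ, Tendsto x atTop (𝓝 σ)) ∧ ∀ σ, MapClusterPt σ atTop x → Tendsto x atTop (𝓝 σ)

/-! ### Perfect data -/

/-- The polynomial `ξ̂(t) = (t · ξ)_{N-1}` associated with `ξ ∈ V`. -/
def hat {N : ℕ} [Fact (3 ≤ N)] (l : V N) (t : ℝ) : ℝ := coact t l (top N)

/-- `ℓ ∈ V` is a character: `ℓ(X_j) = 0` for `1 ≤ j ≤ N - 2`. -/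
def IsCharacter {N : ℕ} [Fact (3 ≤ N)] (l : V N) : Prop := ∀ i, i ≠ top N → l i = 0

/-- The objects that occur in perfect data for a sequence `(ℓ_k)`. -/
structure Data (N : ℕ) where
  /-- the common degree of the polynomials `p_k = ℓ̂_k` -/
  d : ℕ
  /-- the leading coefficients `c_k` -/
  c : ℕ → ℝ
  /-- the (complex) roots `a_j^k` -/
  root : Fin d → ℕ → ℂ
  /-- the number of the sequences `(t_i^k)_k` -/
  m : ℕ
  /-- the sequences `(t_i^k)_k` -/
  t : Fin m → ℕ → ℝ
  /-- the limits `ℓ^i` of `t_i^k · ℓ_k` -/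
  lim : Fin m → V N
  /-- the indices `j(i)` -/
  near : Fin m → Fin d
  /-- the sets `L(i)` -/
  L : Fin m → Finset (Fin d)
  /-- the polynomials `p^i` -/
  p : Fin m → Polynomial ℝ

namespace Data

variable {N : ℕ} [Fact (3 ≤ N)]

/-- The set `C` of the indices `i` for which `ℓ^i` is a character; `D` is its complement. -/
def C (D : Data N) : Set (Fin D.m) := {i | IsCharacter (D.lim i)}

/-- The distance `|t_i^k - a_j^k|`. -/
def dist (D : Data N) (i : Fin D.m) (j : Fin D.d) (k : ℕ) : ℝ := ‖(D.t i k : ℂ) - D.root j k‖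

open Classical in
/-- `ρ_i^k = |t_i^k - a_{j(i)}^k|` for `i ∈ C` and `ρ_i^k = 1` for `i ∈ D`. -/
def rho (D : Data N) (i : Fin D.m) (k : ℕ) : ℝ :=
  if i ∈ D.C then D.dist i (D.near i) k else 1

/-- The set `J(i)` of the indices `j` with `|t_i^k - a_j^k| → ∞`. -/
def J (D : Data N) (i : Fin D.m) : Set (Fin D.d) := {j | Tendsto (D.dist i j) atTop atTop}

/-- `D` is a system of perfect data for the sequence `(ℓ_k)`. -/
structure IsPerfect (D : Data N) (l : ℕ → Sgen N) : Prop where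
  /-- `p_k(t) = c_k ∏_j (t - a_j^k)` has degree `d` -/
  lead : ∀ k, D.c k ≠ 0
  factor : ∀ k (x : ℝ), ((hat (l k).1 x : ℝ) : ℂ) = D.c k * ∏ j, ((x : ℂ) - D.root j k)
  m_pos : 0 < D.m
  m_le : D.m ≤ 2 * D.d
  /-- `t_i^k · ℓ_k → ℓ^i` -/
  tendsto_lim : ∀ i, Tendsto (fun k => coact (D.t i k) (l k).1) atTop (𝓝 (D.lim i))
  separated : ∀ i i', i ≠ i' → Tendsto (fun k => |D.t i k - D.t i' k|) atTop atTop
  /-- the conditions on the indices `i ∈ C` -/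
  dist_tendsto : ∀ i ∈ D.C, ∀ j, Tendsto (D.dist i j) atTop atTop
  near_le : ∀ i ∈ D.C, ∀ k j, D.dist i (D.near i) k ≤ D.dist i j k
  ratio_mem : ∀ i ∈ D.C, ∀ j ∈ D.L i, ∃ x : ℝ,
    Tendsto (fun k => D.dist i j k / D.rho i k) atTop (𝓝 x)
  ratio_not_mem : ∀ i ∈ D.C, ∀ j, j ∉ D.L i →
    Tendsto (fun k => D.dist i j k / D.rho i k) atTop atTop
  scaled : ∀ i ∈ D.C, ∀ x : ℝ, TendstoLocallyUniformly
    (fun k (y : ℝ) => hat (l k).1 (y + (D.t i k + x * D.rho i k)))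
    (fun _ => (D.p i).eval x) atTop
  degree_p : ∀ i ∈ D.C, (D.p i).natDegree = (D.L i).card
  L_disjoint : ∀ i ∈ D.C, ∀ i' ∈ D.C, i ≠ i' → Disjoint (D.L i) (D.L i')
  /-- for `i ∈ D` each of the roots either stays at bounded distance from `t_i^k` or is in `J(i)` -/
  bounded_of_not_mem_J : ∀ i, i ∉ D.C → ∀ j, j ∉ D.J i →
    ∃ R : ℝ, ∀ k, D.dist i j k ≤ R
  /-- maximality: if `r_k · ℓ_k → ℓ` along a subsequence and `ℓ` is not a character, then, along a
  further subsequence, `r_k` stays at bounded distance from some `t_i^k`, `i ∈ D` -/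
  maximal_gen : ∀ ψ : ℕ → ℕ, StrictMono ψ → ∀ (r : ℕ → ℝ) (ξ : V N),
    Tendsto (fun k => coact (r k) (l (ψ k)).1) atTop (𝓝 ξ) → ¬ IsCharacter ξ →
    ∃ φ : ℕ → ℕ, StrictMono φ ∧ ∃ i, i ∉ D.C ∧
      ∃ R : ℝ, ∀ k, |r (φ k) - D.t i (ψ (φ k))| ≤ R
  /-- maximality: if `r_k · ℓ_k → ℓ` along a subsequence and `ℓ` is a character, then, along a
  further subsequence, `|r_k - a_j^k| / |t_i^k - a_j^k|` converges for some `i ∈ C`, `j ∈ L(i)`, and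
  `ℓ = p^i(s) X_{N-1}^*` for some `s` -/
  maximal_char : ∀ ψ : ℕ → ℕ, StrictMono ψ → ∀ (r : ℕ → ℝ) (ξ : V N),
    Tendsto (fun k => coact (r k) (l (ψ k)).1) atTop (𝓝 ξ) → IsCharacter ξ →
    ∃ φ : ℕ → ℕ, StrictMono φ ∧ ∃ i ∈ D.C,
      (∃ j ∈ D.L i, ∃ x : ℝ, Tendsto
        (fun k => ‖(r (φ k) : ℂ) - D.root j (ψ (φ k))‖ / D.dist i j (ψ (φ k))) atTop (𝓝 x)) ∧
      ∃ y : ℝ, ξ = Pi.single (top N) ((D.p i).eval y)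

/-- The real sequences `(s_k)` that are adapted to the perfect data. -/
structure IsAdapted (D : Data N) (s : ℕ → ℝ) : Prop where
  tendsto_atTop : Tendsto s atTop atTop
  gen : ∀ i, i ∉ D.C → ∀ j ∈ D.J i, Tendsto (fun k => s k / D.dist i j k) atTop (𝓝 0)
  char : ∀ i ∈ D.C, ∀ j, j ∉ D.L i →
    Tendsto (fun k => s k * D.rho i k / D.dist i j k) atTop (𝓝 0)
  char' : ∀ i ∈ D.C, Tendsto (fun k => s k / D.rho i k) atTop (𝓝 0)

/-- `T_k = ℝ \ ⋃_i [t_i^k - s_k ρ_i^k, t_i^k + s_k ρ_i^k]`. -/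
def T (D : Data N) (s : ℕ → ℝ) (k : ℕ) : Set ℝ :=
  (⋃ i, Set.Icc (D.t i k - s k * D.rho i k) (D.t i k + s k * D.rho i k))ᶜ

theorem measurableSet_T (D : Data N) (s : ℕ → ℝ) (k : ℕ) : MeasurableSet (D.T s k) :=
  (MeasurableSet.iUnion fun _ => measurableSet_Icc).compl

end Data

/-! ### The operators `ν(φ)(i,k)` -/

/-- The function `η(i,k,u)(x) = η(s_k p^i(x / ρ_i^k) + s_k b) exp (2πi a x)`, `u = (a, b)`. -/
def wave (η : ℝ → ℂ) (s ρ : ℝ) (p : Polynomial ℝ) (u : ℝ × ℝ) (x : ℝ) : ℂ :=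
  η (s * p.eval (x / ρ) + s * u.2) * Complex.exp ((2 * Real.pi * u.1 * x : ℝ) * Complex.I)

/-- The scalar product `⟨ξ, w⟩ = ∫ ξ(x) conj(w(x)) dx`. -/
def coef (w : ℝ → ℂ) (ξ : L2) : ℂ := ∫ x, ξ x * starRingEnd ℂ (w x)

/-- The bounded operator `S` is `ν(φ)(i,k) = s_k ∫ φ̂(a, -b) P_{i,k,u} da db`, where `u = (a, b)`
and `P_{i,k,u}` is the rank one operator `ξ ↦ ⟨ξ, η(i,k,u)⟩ η(i,k,u)` on `L²(ℝ)`.  The integral of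
operators is understood weakly, so that it makes sense for all `φ ∈ C*(ℝ²)`:
`⟨Sξ, ζ⟩ = s_k ∫ φ̂(a, -b) ⟨ξ, η(i,k,u)⟩ ⟨η(i,k,u), ζ⟩ da db` for all `ξ`, `ζ`.  There is at most
one such operator. -/
def IsNu (η : ℝ → ℂ) (s ρ : ℝ) (p : Polynomial ℝ) (φ : CStarR2) (S : BL2) : Prop :=
  (∀ u, MemLp (wave η s ρ p u) 2 (volume : Measure ℝ)) ∧
  ∀ ξ ζ : L2,
    Integrable (fun u : ℝ × ℝ => φ (u.1, -u.2) *
      (coef (wave η s ρ p u) ξ * starRingEnd ℂ (coef (wave η s ρ p u) ζ))) ∧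
    inner ℂ ζ (S ξ) = s * ∫ u : ℝ × ℝ, φ (u.1, -u.2) *
      (coef (wave η s ρ p u) ξ * starRingEnd ℂ (coef (wave η s ρ p u) ζ))

/-! ### The generic, the character and the infinity conditions -/

namespace OpField

variable {N : ℕ} [Fact (3 ≤ N)]

/-- The generic condition.  A field `A` over `S_N^gen` is evaluated at the limit `ℓ^i` by
covariance: if `ℓ^i = r · ℓ₀` with `ℓ₀ ∈ S_N^gen` (such `r` and `ℓ₀` are unique), then `A(ℓ^i)` is
`U(r) A(ℓ₀) U(-r)`. -/
def GenericCondition (A : OpField N) : Prop :=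
  ∀ (l : ℕ → Sgen N) (D : Data N), ProperlyConvergent (fun k => UDual.pi (l k)) →
    D.IsPerfect l → ∀ i, i ∉ D.C → ∀ s : ℕ → ℝ, D.IsAdapted s →
    ∃ (r : ℝ) (l₀ : Sgen N), coact r l₀.1 = D.lim i ∧
      Tendsto (fun k => ‖(U (D.t i k) ∘L A.gen (l k) ∘L U (-D.t i k)) ∘L Mint (s k) -
        (U r ∘L A.gen l₀ ∘L U (-r)) ∘L Mint (s k)‖) atTop (𝓝 0)

/-- The character condition, for the window function `η`. -/
def CharacterCondition (η : ℝ → ℂ) (A : OpField N) : Prop :=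
  ∀ (l : ℕ → Sgen N) (D : Data N), ProperlyConvergent (fun k => UDual.pi (l k)) →
    D.IsPerfect l → ∀ i ∈ D.C, ∀ s : ℕ → ℝ, D.IsAdapted s →
    ∃ S : ℕ → BL2, (∀ᶠ k in atTop, IsNu η (s k) (D.rho i k) (D.p i) A.zero (S k)) ∧
      Tendsto (fun k => ‖(U (D.t i k) ∘L A.gen (l k) ∘L U (-D.t i k)) ∘L
        Mint (s k * D.rho i k) - S k ∘L Mint (s k * D.rho i k)‖) atTop (𝓝 0)

/-- The coadjoint orbit `{t · ℓ + x X_N^* : t, x ∈ ℝ}` of `ℓ ∈ S_N^gen` in `𝔤_N* = ℝ X_N^* ⊕ V`. -/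
def orbit (l : Sgen N) : Set (ℝ × V N) := {ξ | ∃ t : ℝ, ξ.2 = coact t l.1}

/-- The infinity condition. -/
def InfinityCondition (A : OpField N) : Prop :=
  (∀ (l : ℕ → Sgen N) (D : Data N), ProperlyConvergent (fun k => UDual.pi (l k)) →
    D.IsPerfect l → ∀ s : ℕ → ℝ, D.IsAdapted s →
    Tendsto (fun k => ‖A.gen (l k) ∘L M (D.T s k) (D.measurableSet_T s k)‖) atTop (𝓝 0)) ∧
  ∀ l : ℕ → Sgen N,
    (∀ K : Set (ℝ × V N), IsCompact K → ∀ᶠ k in atTop, Disjoint (orbit (l k)) K) →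
    Tendsto (fun k => A.gen (l k)) atTop (𝓝 0)

end OpField

end ThreadLike

/-!
The condition that is verified for an element of `C*(G_N)` is each time that a uniformly bounded
sequence of linear maps `C*(G_N) → B(L²(ℝ))` tends to zero, or that an operator is compact.  The
elements for which this holds form a closed subspace, so that it suffices to treat the elementary
tensors `α ⊗ β`, `(α ⊗ β)(exp (t X_N) exp u) = α(t) β(u)`, with a test function `α` on `ℝ` and a
function `β` on `𝔟` whose Fourier transform `h = β̂` is continuous with compact support
(`CStar.induction`).  The support condition is available because the `C*`-norm of `α ⊗ β` is at
most `‖α‖₁ ‖β̂‖_∞`.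

For such an element `π_ℓ(α ⊗ β)` is the multiplication by `x ↦ h(x · ℓ)` followed by the
convolution with `α` (`hasKernel_piL1`).  All operators that occur have a kernel `K(x, t)` with
respect to the displacement `t`, and by Schur's test (`HasKernel.norm_le`) the norm is at most
`ε ‖α‖₁` if `|K(x, t)| ≤ ε |α(t)|`.  Hence the conditions become statements about the functions
`x ↦ h(x · ℓ_k)`.

* `x ↦ h(x · ℓ)` has compact support if `ℓ` is not a character, as the polynomial `ℓ̂` is not
  constant; therefore `π_ℓ(α ⊗ β)` is a Hilbert–Schmidt operator.
* Near `t_i^k`, on bounded multiples of `ρ_i^k`, the functions `x ↦ h(x · ℓ_k)` converge uniformly,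
  to `h(x · ℓ^i)` for `i ∈ D` and, in the variable `x / ρ_i^k`, to `h(p^i(x / ρ_i^k) X_{N-1}^*)` for
  `i ∈ C`.  On the rest of the interval of radius `s_k ρ_i^k` both functions vanish: the roots of
  `ℓ̂_k` are either at distance `O(ρ_i^k)` of `t_i^k` or much farther away than `s_k ρ_i^k`, which
  makes `ℓ̂_k` large there (`eventually_le_abs_of_roots`).
* Outside of all these intervals `h(x · ℓ_k)` vanishes for large `k`, because otherwise a
  subsequence of points would contradict the maximality of the perfect data
  (`Data.IsPerfect.eventually_infinity`).

For the character condition the operators `ν(φ)` have to be constructed.  By Plancherel's theorem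
the coefficients `u ↦ ⟨ξ, η(u)⟩` have the square norm `‖ξ‖² / s` in `L²(ℝ²)`
(`lintegral_sq_coef_wave`).  Thus `ν(φ) = s W* φ(a, -b) W` with `√s W` an isometry, and
`‖ν(φ)‖ ≤ ‖φ‖` (`exists_isNu`).  If `φ(a, b) = α̂(a) H(b)`, then Fourier inversion shows that `ν(φ)`
has the kernel `α(t) κ(x, t)`, where `κ(x, t)` is an average of the values of `H` near
`p((x - t) / ρ)` with total mass nearly `∫ |η|² = 1`, so that it tends uniformly to
`H(p((x - t) / ρ))` (`eventually_nuKernel`).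
This is the kernel found above for `π_{ℓ_k}(α ⊗ β)` near `t_i^k`.
-/

namespace ThreadLike

/-! ### Operators with a dominated kernel -/

/-- Tonelli, and the Cauchy–Schwarz inequality for each displacement `t`. -/
theorem lintegral_mul_shift_le (φ ψ : L2) {g : ℝ → ℝ} (hg : AEStronglyMeasurable g volume) :
    ∫⁻ q : ℝ × ℝ, ‖g q.2‖ₑ * ‖φ q.1 * ψ (q.1 - q.2)‖ₑ ≤ (∫⁻ t, ‖g t‖ₑ) * (‖φ‖ₑ * ‖ψ‖ₑ) := by
  have hφ : Measurable (φ : ℝ → ℂ) := (Lp.stronglyMeasurable φ).measurable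
  have hψ : Measurable (ψ : ℝ → ℂ) := (Lp.stronglyMeasurable ψ).measurable
  have hm : AEMeasurable (fun q : ℝ × ℝ => ‖g q.2‖ₑ * ‖φ q.1 * ψ (q.1 - q.2)‖ₑ)
      (volume.prod volume) := by
    refine (hg.comp_snd.enorm).mul ?_
    exact ((hφ.comp measurable_fst).mul
      (hψ.comp (measurable_fst.sub measurable_snd))).enorm.aemeasurable
  rw [Measure.volume_eq_prod, lintegral_prod_symm _ hm,
    ← lintegral_mul_const'' _ hg.enorm]
  refine lintegral_mono fun t => ?_
  change ∫⁻ x, ‖g t‖ₑ * ‖φ x * ψ (x - t)‖ₑ ≤ _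
  have hψt : Measurable fun x => ψ (x - t) := hψ.comp (measurable_id.sub_const t)
  have hφψ : Measurable fun x => φ x * ψ (x - t) := hφ.mul hψt
  rw [lintegral_const_mul _ hφψ.enorm]
  gcongr
  have hmp := measurePreserving_sub_right (volume : Measure ℝ) t
  have h2 : eLpNorm (fun x => ψ (x - t)) 2 volume = eLpNorm ψ 2 volume :=
    eLpNorm_comp_measurePreserving (Lp.aestronglyMeasurable ψ) hmp
  have h1 := eLpNorm_smul_le_mul_eLpNorm (p := 2) (q := 2) (r := 1)
    (f := fun x => ψ (x - t)) (φ := (φ : ℝ → ℂ)) (μ := volume)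
    hψt.aestronglyMeasurable (Lp.aestronglyMeasurable φ)
  rw [h2, ← Lp.enorm_def, ← Lp.enorm_def, eLpNorm_one_eq_lintegral_enorm] at h1
  exact h1

variable {K K' : ℝ × ℝ → ℂ} {g : ℝ → ℝ}

theorem measurable_shift (ζ ξ : L2) :
    Measurable fun q : ℝ × ℝ => starRingEnd ℂ (ζ q.1) * ξ (q.1 - q.2) := by
  have hζ : Measurable (ζ : ℝ → ℂ) := (Lp.stronglyMeasurable ζ).measurable
  have hξ : Measurable (ξ : ℝ → ℂ) := (Lp.stronglyMeasurable ξ).measurable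
  exact ((RCLike.continuous_conj (K := ℂ)).measurable.comp (hζ.comp measurable_fst)).mul
    (hξ.comp (measurable_fst.sub measurable_snd))

theorem lintegral_kernel_le (hg : Integrable g) (hKg : ∀ q, ‖K q‖ ≤ g q.2) (ζ ξ : L2) :
    ∫⁻ q : ℝ × ℝ, ‖K q * (starRingEnd ℂ (ζ q.1) * ξ (q.1 - q.2))‖ₑ ≤
      (∫⁻ t, ‖g t‖ₑ) * (‖ζ‖ₑ * ‖ξ‖ₑ) := by
  refine le_trans (lintegral_mono fun q => ?_) (lintegral_mul_shift_le ζ ξ hg.1)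
  rw [enorm_mul, enorm_mul, enorm_mul, RCLike.enorm_conj]
  gcongr
  rw [enorm_le_iff_norm_le]
  exact (hKg q).trans (le_abs_self _)

theorem integrable_kernel (hK : AEStronglyMeasurable K) (hg : Integrable g)
    (hKg : ∀ q, ‖K q‖ ≤ g q.2) (ζ ξ : L2) :
    Integrable fun q : ℝ × ℝ => K q * (starRingEnd ℂ (ζ q.1) * ξ (q.1 - q.2)) := by
  refine ⟨hK.mul (measurable_shift ζ ξ).aestronglyMeasurable, ?_⟩
  refine (lintegral_kernel_le hg hKg ζ ξ).trans_lt ?_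
  exact ENNReal.mul_lt_top hg.2 (ENNReal.mul_lt_top enorm_lt_top enorm_lt_top)

theorem norm_integral_kernel_le (hg : Integrable g)
    (hKg : ∀ q, ‖K q‖ ≤ g q.2) (ζ ξ : L2) :
    ‖∫ q : ℝ × ℝ, K q * (starRingEnd ℂ (ζ q.1) * ξ (q.1 - q.2))‖ ≤
      (∫ t, g t) * (‖ζ‖ * ‖ξ‖) := by
  have hg0 : ∀ t, 0 ≤ g t := fun t => (norm_nonneg _).trans (hKg (0, t))
  have h1 : ∫ t, g t = (∫⁻ t, ‖g t‖ₑ).toReal := by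
    rw [← integral_norm_eq_lintegral_enorm hg.1]
    exact integral_congr_ae (Eventually.of_forall fun t => (Real.norm_of_nonneg (hg0 t)).symm)
  have h2 := (enorm_integral_le_lintegral_enorm
    (fun q : ℝ × ℝ => K q * (starRingEnd ℂ (ζ q.1) * ξ (q.1 - q.2)))).trans
    (lintegral_kernel_le hg hKg ζ ξ)
  have h3 : (∫⁻ t, ‖g t‖ₑ) * (‖ζ‖ₑ * ‖ξ‖ₑ) ≠ ⊤ :=
    (ENNReal.mul_lt_top hg.2 (ENNReal.mul_lt_top enorm_lt_top enorm_lt_top)).ne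
  have h4 := ENNReal.toReal_mono h3 h2
  rw [h1]
  simpa [ENNReal.toReal_mul] using h4

/-- The operator `T` on `L²(ℝ)` is given by `(Tξ)(x) = ∫ K(x, t) ξ(x - t) dt`, in the weak sense;
the kernel is dominated by an integrable function of the displacement `t` alone. -/
structure HasKernel (T : BL2) (K : ℝ × ℝ → ℂ) : Prop where
  meas : AEStronglyMeasurable K
  dom : ∃ g : ℝ → ℝ, Integrable g ∧ ∀ q, ‖K q‖ ≤ g q.2
  inner_eq : ∀ ζ ξ : L2,
    inner ℂ ζ (T ξ) = ∫ q : ℝ × ℝ, K q * (starRingEnd ℂ (ζ q.1) * ξ (q.1 - q.2))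

namespace HasKernel

variable {T T' : BL2}

theorem integrable (h : HasKernel T K) (ζ ξ : L2) :
    Integrable fun q : ℝ × ℝ => K q * (starRingEnd ℂ (ζ q.1) * ξ (q.1 - q.2)) := by
  obtain ⟨g, hg, hKg⟩ := h.dom
  exact integrable_kernel h.meas hg hKg ζ ξ

/-- Schur's test. -/
theorem norm_le (h : HasKernel T K) (hg : Integrable g) (hKg : ∀ q, ‖K q‖ ≤ g q.2) :
    ‖T‖ ≤ ∫ t, g t := by
  have hg0 : ∀ t, 0 ≤ g t := fun t => (norm_nonneg _).trans (hKg (0, t))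
  refine T.opNorm_le_bound (integral_nonneg hg0) fun ξ => ?_
  have h1 := norm_integral_kernel_le hg hKg (T ξ) ξ
  rw [← h.inner_eq, inner_self_eq_norm_sq_to_K] at h1
  have h2 : ‖T ξ‖ ^ 2 ≤ (∫ t, g t) * (‖T ξ‖ * ‖ξ‖) := by
    simpa using h1
  rcases (norm_nonneg (T ξ)).eq_or_lt with h0 | h0
  · rw [← h0]
    exact mul_nonneg (integral_nonneg hg0) (norm_nonneg _)
  · refine le_of_mul_le_mul_left ?_ h0
    linarith

theorem sub (h : HasKernel T K) (h' : HasKernel T' K') :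
    HasKernel (T - T') (fun q => K q - K' q) where
  meas := h.meas.sub h'.meas
  dom := by
    obtain ⟨g, hg, hKg⟩ := h.dom
    obtain ⟨g', hg', hKg'⟩ := h'.dom
    exact ⟨fun t => g t + g' t, hg.add hg', fun q =>
      (norm_sub_le _ _).trans (add_le_add (hKg q) (hKg' q))⟩
  inner_eq ζ ξ := by
    rw [sub_apply, inner_sub_right, h.inner_eq, h'.inner_eq,
      ← integral_sub (h.integrable ζ ξ) (h'.integrable ζ ξ)]
    simp_rw [sub_mul]

theorem congr (h : HasKernel T K) (hK : ∀ q, K q = K' q) : HasKernel T K' := by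
  rwa [← funext hK]

theorem comp_M (h : HasKernel T K) {A : Set ℝ} (hA : MeasurableSet A) :
    HasKernel (T ∘L M A hA) (fun q => K q * A.indicator (fun _ => 1) (q.1 - q.2)) where
  meas := h.meas.mul (((measurable_const.indicator hA).comp
    (measurable_fst.sub measurable_snd)).aestronglyMeasurable)
  dom := by
    obtain ⟨g, hg, hKg⟩ := h.dom
    refine ⟨g, hg, fun q => le_trans ?_ (hKg q)⟩
    by_cases hq : q.1 - q.2 ∈ A <;> simp [hq]
  inner_eq ζ ξ := by
    rw [ContinuousLinearMap.comp_apply, h.inner_eq]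
    refine integral_congr_ae ?_
    have h1 := mulOp_coe (A.indicator fun _ => (1 : ℂ)) (memLp_indicator_one hA) ξ
    have h2 := (quasiMeasurePreserving_sub (volume : Measure ℝ) volume).ae_eq_comp h1
    rw [← Measure.volume_eq_prod] at h2
    filter_upwards [h2] with q hq
    have hq' : (M A hA ξ : ℝ → ℂ) (q.1 - q.2) =
      A.indicator (fun _ => (1 : ℂ)) (q.1 - q.2) * ξ (q.1 - q.2) := hq
    rw [hq']
    ring

theorem conj_U (h : HasKernel T K) (r : ℝ) :
    HasKernel (U r ∘L T ∘L U (-r)) (fun q => K (q.1 + r, q.2)) where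
  meas := by
    have hmp : MeasurePreserving (fun q : ℝ × ℝ => (q.1 + r, q.2)) volume volume := by
      rw [Measure.volume_eq_prod]
      exact (measurePreserving_add_right volume r).prod (MeasurePreserving.id volume)
    exact h.meas.comp_measurePreserving hmp
  dom := by
    obtain ⟨g, hg, hKg⟩ := h.dom
    exact ⟨g, hg, fun q => hKg _⟩
  inner_eq ζ ξ := by
    have hU : ∀ y : L2, inner ℂ ζ (U r y) = inner ℂ (U (-r) ζ) y := by
      intro y
      have e : ζ = U r (U (-r) ζ) := by
        refine Lp.ext ?_
        have h1 := (measurePreserving_add_right (volume : Measure ℝ) r).quasiMeasurePreserving.ae_eq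
          (U_coe (-r) ζ)
        filter_upwards [U_coe r (U (-r) ζ), h1] with s h2 h3
        have h4 : (U (-r) ζ : ℝ → ℂ) (s + r) = ζ (s + r + -r) := h3
        rw [h2, h4]
        congr 1
        ring
      conv_lhs => rw [e]
      let V : L2 →ₗᵢ[ℂ] L2 := Lp.compMeasurePreservingₗᵢ ℂ (fun s : ℝ => s + r)
        (measurePreserving_add_right volume r)
      exact V.inner_map_map _ _
    have hmp : MeasurePreserving (fun q : ℝ × ℝ => (q.1 + r, q.2)) volume volume := by
      rw [Measure.volume_eq_prod]
      exact (measurePreserving_add_right volume r).prod (MeasurePreserving.id volume)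
    have hme : MeasurableEmbedding (fun q : ℝ × ℝ => (q.1 + r, q.2)) :=
      (Homeomorph.addRight r).measurableEmbedding.prodMap MeasurableEmbedding.id
    change inner ℂ ζ (U r (T (U (-r) ξ))) = _
    rw [hU, h.inner_eq, ← hmp.integral_comp hme]
    refine integral_congr_ae ?_
    have h1 := (quasiMeasurePreserving_sub (volume : Measure ℝ) volume).ae_eq_comp (U_coe (-r) ξ)
    have h2 := (Measure.quasiMeasurePreserving_fst (μ := (volume : Measure ℝ))
      (ν := (volume : Measure ℝ))).ae_eq_comp (U_coe (-r) ζ)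
    rw [← Measure.volume_eq_prod] at h1 h2
    filter_upwards [hmp.quasiMeasurePreserving.ae_eq_comp h1,
      hmp.quasiMeasurePreserving.ae_eq_comp h2] with q h3 h4
    have h3' : (U (-r) ξ : ℝ → ℂ) (q.1 + r - q.2) = ξ (q.1 + r - q.2 + -r) := h3
    have h4' : (U (-r) ζ : ℝ → ℂ) (q.1 + r) = ζ (q.1 + r + -r) := h4
    simp only [h3', h4']
    rw [show q.1 + r - q.2 + -r = q.1 - q.2 by ring, show q.1 + r + -r = q.1 by ring]

end HasKernel

/-! ### Compactness of Hilbert–Schmidt operators -/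

/-- The Hilbert–Schmidt operator `ξ ↦ ∫ ξ(y) F(y) dy` given by a square integrable `F : ℝ → L²(ℝ)`,
as a continuous linear function of `F`. -/
def hsOp : Lp L2 2 (volume : Measure ℝ) →L[ℂ] BL2 :=
  (ContinuousLinearMap.compL ℂ L2 (Lp L2 1 (volume : Measure ℝ)) L2 (L1.integralCLM' ℂ)).comp
    ((ContinuousLinearMap.lsmul ℂ ℂ (E := L2)).holderL volume 2 2 1).flip

theorem hsOp_apply (F : Lp L2 2 (volume : Measure ℝ)) (ξ : L2) :
    hsOp F ξ = ∫ y, ξ y • F y := by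
  have h1 : hsOp F ξ = L1.integralCLM' ℂ
    ((ContinuousLinearMap.lsmul ℂ ℂ (E := L2)).holder 1 ξ F) := rfl
  have h2 : ∀ G : Lp L2 1 (volume : Measure ℝ), L1.integralCLM' ℂ G = ∫ y, G y := by
    intro G
    rw [← L1.integral_eq_integral, L1.integral_eq' ℂ]
  rw [h1, h2]
  refine integral_congr_ae ?_
  filter_upwards [(ContinuousLinearMap.lsmul ℂ ℂ (E := L2)).coeFn_holder (r := 1) ξ F] with y hy
  rw [hy]
  rfl

/-- The operator has rank one if `F` is the multiple of an indicator function, and such `F` span a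
dense subspace. -/
theorem isCompactOperator_hsOp (F : Lp L2 2 (volume : Measure ℝ)) :
    IsCompactOperator (hsOp F) := by
  refine Lp.induction ENNReal.ofNat_ne_top (fun F => IsCompactOperator (hsOp F)) ?_ ?_ ?_ F
  · intro c s hs hμs
    have e : hsOp (Lp.simpleFunc.indicatorConst 2 hs hμs.ne c : Lp.simpleFunc L2 2 volume) =
        (ContinuousLinearMap.toSpanSingleton ℂ c).comp
          (innerSL ℂ (indicatorConstLp 2 hs hμs.ne (1 : ℂ))) := by
      ext1 ξ
      rw [hsOp_apply, Lp.simpleFunc.coe_indicatorConst]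
      change _ = inner ℂ (indicatorConstLp 2 hs hμs.ne (1 : ℂ)) ξ • c
      rw [L2.inner_indicatorConstLp_one, ← integral_smul_const, ← integral_indicator hs]
      refine integral_congr_ae ?_
      filter_upwards [indicatorConstLp_coeFn (p := 2) (hs := hs) (hμs := hμs.ne) (c := c)]
        with y hy
      rw [hy]
      by_cases h : y ∈ s <;> simp [h]
    rw [e]
    have h0 : IsCompactOperator (ContinuousLinearMap.toSpanSingleton ℂ c) :=
      isCompactOperator_of_locallyCompactSpace_rng (ContinuousLinearMap.toSpanSingleton ℂ c)
    exact h0.comp_clm (innerSL ℂ (indicatorConstLp 2 hs hμs.ne (1 : ℂ)))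
  · intro f g hf hg _ h1 h2
    rw [map_add]
    exact h1.add h2
  · exact isClosed_setOfPred_isCompactOperator.preimage hsOp.continuous

theorem measurePreserving_shear : MeasurePreserving (fun q : ℝ × ℝ => (q.1, q.1 - q.2))
    (volume : Measure (ℝ × ℝ)) volume := by
  rw [Measure.volume_eq_prod]
  exact MeasurePreserving.skew_product (g := fun x y : ℝ => x - y) (MeasurePreserving.id volume)
    (measurable_fst.sub measurable_snd)
    (Eventually.of_forall fun x => (Measure.measurePreserving_sub_left volume x).map_eq)

/-- Convolution after multiplication, for continuous functions with compact support, is compact. -/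
theorem HasKernel.isCompactOperator {T : BL2} {α b : ℝ → ℂ} (hα : Continuous α)
    (hαc : HasCompactSupport α) (hb : Continuous b) (hbc : HasCompactSupport b)
    (h : HasKernel T fun q => α q.2 * b (q.1 - q.2)) : IsCompactOperator T := by
  have hα2 : MemLp α 2 (volume : Measure ℝ) := hα.memLp_of_hasCompactSupport hαc
  let F : ℝ → L2 := fun y => b y • U (-y) (hα2.toLp α)
  have hF : Continuous F := hb.smul ((continuous_U _).comp continuous_neg)
  have hFc : HasCompactSupport F := hbc.smul_right
  have hF2 : MemLp F 2 (volume : Measure ℝ) := hF.memLp_of_hasCompactSupport hFc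
  suffices T = hsOp (hF2.toLp F) by
    rw [this]
    exact isCompactOperator_hsOp _
  ext1 ξ
  refine ext_inner_left ℂ fun ζ => ?_
  have hi : Integrable fun y => ξ y • F y :=
    memLp_one_iff_integrable.1 (hF2.smul (Lp.memLp ξ))
  have h1 : hsOp (hF2.toLp F) ξ = ∫ y, ξ y • F y := by
    rw [hsOp_apply]
    refine integral_congr_ae ?_
    filter_upwards [hF2.coeFn_toLp] with y hy
    rw [hy]
  have hint : Integrable (fun q : ℝ × ℝ =>
      α (q.1 - q.2) * b q.2 * (starRingEnd ℂ (ζ q.1) * ξ q.2)) (volume.prod volume) := by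
    rw [← Measure.volume_eq_prod]
    have := measurePreserving_shear.integrable_comp_of_integrable (h.integrable ζ ξ)
    simpa [Function.comp_def] using this
  rw [h.inner_eq, h1, ← integral_inner hi, Measure.volume_eq_prod,
    integral_prod _ (by simpa only [Measure.volume_eq_prod] using h.integrable ζ ξ)]
  have h2 : ∀ x, ∫ t, α t * b (x - t) * (starRingEnd ℂ (ζ x) * ξ (x - t)) =
      ∫ y, α (x - y) * b y * (starRingEnd ℂ (ζ x) * ξ y) := by
    intro x
    rw [← integral_sub_left_eq_self _ volume x]
    simp
  change ∫ x, ∫ t, α t * b (x - t) * (starRingEnd ℂ (ζ x) * ξ (x - t)) = _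
  simp_rw [h2]
  rw [integral_integral_swap hint]
  refine integral_congr_ae (Eventually.of_forall fun y => ?_)
  change _ = inner ℂ ζ (ξ y • b y • U (-y) (hα2.toLp α))
  rw [inner_smul_right, inner_smul_right, L2.inner_def, ← integral_const_mul,
    ← integral_const_mul]
  refine integral_congr_ae ?_
  have h3 := (measurePreserving_add_right (volume : Measure ℝ) (-y)).quasiMeasurePreserving.ae_eq
    hα2.coeFn_toLp
  filter_upwards [U_coe (-y) (hα2.toLp α), h3] with x h4 h5
  have h6 : (hα2.toLp α : ℝ → ℂ) (x + -y) = α (x + -y) := h5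
  rw [h4, h6, RCLike.inner_apply, ← sub_eq_add_neg]
  ring

open scoped FourierTransform SchwartzMap symmDiff

/-! ### Elementary tensors in `L¹(G_N)` -/

/-- The elementary tensor `α ⊗ β ∈ L¹(G_N)`, `(α ⊗ β)(exp (t X_N) exp u) = α(t) β(u)`. -/
def tensor {N : ℕ} {α : ℝ → ℂ} {β : V N → ℂ} (hα : Integrable α) (hβ : Integrable β) : L1 N :=
  Integrable.toL1 (μ := (volume : Measure (ThreadGroup N)))
    (fun g : ThreadGroup N => α g.1 * β g.2) (hα.mul_prod hβ)

theorem tensor_coe {N : ℕ} {α : ℝ → ℂ} {β : V N → ℂ} (hα : Integrable α) (hβ : Integrable β) :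
    (tensor hα hβ : ThreadGroup N → ℂ) =ᵐ[volume] fun g => α g.1 * β g.2 :=
  Integrable.coeFn_toL1 _

/-- The Fourier transform on `𝔟`, as a function on `V = 𝔟*`. -/
def fourierV {N : ℕ} (β : V N → ℂ) (l : V N) : ℂ :=
  ∫ u, β u * Complex.exp ((-2 * Real.pi * pair l u : ℝ) * Complex.I)

theorem continuous_pair {N : ℕ} : Continuous fun p : V N × V N => pair p.1 p.2 := by
  unfold pair
  fun_prop

theorem norm_fourierV_le {N : ℕ} (β : V N → ℂ) (l : V N) : ‖fourierV β l‖ ≤ ∫ u, ‖β u‖ := by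
  refine (norm_integral_le_integral_norm _).trans (le_of_eq ?_)
  simp_rw [norm_mul, Complex.norm_exp_ofReal_mul_I, mul_one]

theorem continuous_fourierV {N : ℕ} {β : V N → ℂ} (hβ : Integrable β) :
    Continuous (fourierV β) := by
  have hc : Continuous fun p : V N × V N =>
      Complex.exp ((-2 * Real.pi * pair p.1 p.2 : ℝ) * Complex.I) := by
    have := continuous_pair (N := N)
    fun_prop
  refine continuous_of_dominated (bound := fun u => ‖β u‖) (fun l => ?_)
    (fun l => Eventually.of_forall fun u => ?_) hβ.norm (Eventually.of_forall fun u => ?_)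
  · exact hβ.1.mul (hc.comp (Continuous.prodMk_right l)).aestronglyMeasurable
  · rw [norm_mul, Complex.norm_exp_ofReal_mul_I, mul_one]
  · exact continuous_const.mul (hc.comp (Continuous.prodMk_left u))

theorem continuous_coact {N : ℕ} : Continuous fun p : ℝ × V N => coact p.1 p.2 := by
  refine continuous_pi fun i => ?_
  unfold coact
  fun_prop

theorem integrable_conj_mul_shift (ζ ξ : L2) (t : ℝ) :
    Integrable fun x => starRingEnd ℂ (ζ x) * ξ (x - t) := by
  have h1 : MemLp (fun x => ξ (x - t)) 2 (volume : Measure ℝ) :=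
    (Lp.memLp ξ).comp_measurePreserving (measurePreserving_sub_right volume t)
  have h2 : MemLp (fun x => starRingEnd ℂ (ζ x)) 2 (volume : Measure ℝ) := (Lp.memLp ζ).star
  exact h2.integrable_mul h1

theorem inner_piRep {N : ℕ} (l : V N) (g : ThreadGroup N) (ζ ξ : L2) :
    inner ℂ ζ (piRep l g ξ) = ∫ x, phase l g x * (starRingEnd ℂ (ζ x) * ξ (x - g.1)) := by
  rw [L2.inner_def]
  refine integral_congr_ae ?_
  filter_upwards [piOp_coe l g ξ] with x hx
  change inner ℂ (ζ x) ((piOp l g ξ : ℝ → ℂ) x) = _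
  rw [hx, RCLike.inner_apply]
  ring

/-- The group element `exp (t X_N) exp u`. -/
def ThreadGroup.mk {N : ℕ} (t : ℝ) (u : V N) : ThreadGroup N := ((t, u) : ℝ × V N)

/-- The integration over `𝔟` turns the phase of `π_ℓ` into the Fourier transform of `β` along the
orbit of `ℓ`. -/
theorem integral_mul_inner_piRep {N : ℕ} (l : V N) {β : V N → ℂ} (hβ : Integrable β) (t : ℝ)
    (ζ ξ : L2) :
    ∫ u, β u * inner ℂ ζ (piRep l (ThreadGroup.mk t u) ξ) =
      ∫ x, fourierV β (coact (x - t) l) * (starRingEnd ℂ (ζ x) * ξ (x - t)) := by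
  obtain ⟨Φ, hΦ⟩ : ∃ Φ : V N → ℝ → ℂ, ∀ u x, Φ u x =
      Complex.exp ((-2 * Real.pi * pair (coact (x - t) l) u : ℝ) * Complex.I) := ⟨_, fun _ _ => rfl⟩
  have hΦ' : ∀ u x, phase l (ThreadGroup.mk t u) x = Φ u x := fun u x => by rw [hΦ]; rfl
  have hc : Continuous fun p : V N × ℝ => Φ p.1 p.2 := by
    simp_rw [hΦ]
    have h1 : Continuous fun p : V N × ℝ => (coact (p.2 - t) l, p.1) := by
      have h2 : Continuous fun p : V N × ℝ => (p.2 - t, l) := by fun_prop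
      exact (continuous_coact.comp h2).prodMk continuous_fst
    have h3 := continuous_pair.comp h1
    simp only [Function.comp_def] at h3
    fun_prop
  have hi : Integrable (fun p : V N × ℝ => Φ p.1 p.2 *
      (β p.1 * (starRingEnd ℂ (ζ p.2) * ξ (p.2 - t)))) (volume.prod volume) :=
    (hβ.mul_prod (integrable_conj_mul_shift ζ ξ t)).bdd_mul (c := 1)
      hc.aestronglyMeasurable (Eventually.of_forall fun p => by
        rw [hΦ, Complex.norm_exp_ofReal_mul_I])
  have hi' : Integrable (Function.uncurry fun u x => β u * (Φ u x *
      (starRingEnd ℂ (ζ x) * ξ (x - t)))) (volume.prod volume) :=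
    hi.congr (Eventually.of_forall fun p => by simp only [Function.uncurry]; ring)
  have e : ∀ u, β u * inner ℂ ζ (piRep l (ThreadGroup.mk t u) ξ) =
      ∫ x, β u * (Φ u x * (starRingEnd ℂ (ζ x) * ξ (x - t))) := by
    intro u
    rw [inner_piRep, ← integral_const_mul]
    simp_rw [hΦ']
    rfl
  simp_rw [e]
  rw [integral_integral_swap hi']
  refine integral_congr_ae (Eventually.of_forall fun x => ?_)
  simp only [fourierV]
  rw [← integral_mul_const]
  refine integral_congr_ae (Eventually.of_forall fun u => ?_)
  simp only [hΦ]
  ring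

/-- `π_ℓ(α ⊗ β)` is multiplication by `x ↦ β̂(x · ℓ)` followed by convolution with `α`. -/
theorem hasKernel_piL1 {N : ℕ} (l : V N) {α : ℝ → ℂ} {β : V N → ℂ} (hα : Integrable α)
    (hβ : Integrable β) :
    HasKernel (piL1 l (tensor hα hβ)) fun q => α q.2 * fourierV β (coact (q.1 - q.2) l) := by
  have hm : AEStronglyMeasurable fun q : ℝ × ℝ => α q.2 * fourierV β (coact (q.1 - q.2) l) := by
    have h1 : Continuous fun q : ℝ × ℝ => fourierV β (coact (q.1 - q.2) l) := by
      have h2 : Continuous fun q : ℝ × ℝ => (q.1 - q.2, l) := by fun_prop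
      exact (continuous_fourierV hβ).comp (continuous_coact.comp h2)
    exact hα.1.comp_snd.mul h1.aestronglyMeasurable
  have hd : ∀ q : ℝ × ℝ, ‖α q.2 * fourierV β (coact (q.1 - q.2) l)‖ ≤
      ‖α q.2‖ * ∫ u, ‖β u‖ := by
    intro q
    rw [norm_mul]
    gcongr
    exact norm_fourierV_le _ _
  have hg : Integrable fun t => ‖α t‖ * ∫ u, ‖β u‖ := hα.norm.mul_const _
  refine ⟨hm, ⟨_, hg, hd⟩, fun ζ ξ => ?_⟩
  have hint : Integrable (fun g : ℝ × V N => α g.1 * β g.2 *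
      inner ℂ ζ (piRep l (g : ThreadGroup N) ξ)) := by
    have h1 := (integrable_smul_piRep l (tensor hα hβ) ξ).const_inner (𝕜 := ℂ) ζ
    refine h1.congr ?_
    filter_upwards [tensor_coe hα hβ] with g hg
    rw [hg, inner_smul_right]
  have hker := integrable_kernel hm hg hd ζ ξ
  have e : inner ℂ ζ (piL1 l (tensor hα hβ) ξ) =
      ∫ g : ℝ × V N, α g.1 * β g.2 * inner ℂ ζ (piRep l (g : ThreadGroup N) ξ) := by
    rw [piL1_apply, ← integral_inner (integrable_smul_piRep l _ ξ)]
    refine integral_congr_ae ?_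
    filter_upwards [tensor_coe hα hβ] with g hg
    rw [hg, inner_smul_right]
  rw [e, Measure.volume_eq_prod, Measure.volume_eq_prod]
  refine (integral_prod _ hint).trans (Eq.trans ?_ (integral_prod_symm _ hker).symm)
  refine integral_congr_ae (Eventually.of_forall fun t => ?_)
  change ∫ u, α t * β u * inner ℂ ζ (piRep l (ThreadGroup.mk t u) ξ) =
    ∫ x, α t * fourierV β (coact (x - t) l) * (starRingEnd ℂ (ζ x) * ξ (x - t))
  simp_rw [mul_assoc (α t)]
  rw [integral_const_mul, integral_const_mul, integral_mul_inner_piRep l hβ]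

theorem chiL1_tensor {N : ℕ} [Fact (3 ≤ N)] (p : ℝ × ℝ) {α : ℝ → ℂ} {β : V N → ℂ}
    (hα : Integrable α) (hβ : Integrable β) :
    chiL1 p (tensor hα hβ) = 𝓕 α p.1 * fourierV β (Pi.single (top N) p.2) := by
  have h1 : chiL1 p (tensor hα hβ) = ∫ g : ℝ × V N,
      (α g.1 * Complex.exp ((-2 * Real.pi * (p.1 * g.1) : ℝ) * Complex.I)) *
      (β g.2 * Complex.exp ((-2 * Real.pi * pair (Pi.single (top N) p.2) g.2 : ℝ) *
        Complex.I)) := by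
    change ∫ g, tensor hα hβ g * chi p g = _
    refine integral_congr_ae ?_
    filter_upwards [tensor_coe hα hβ] with g hg
    have h2 : pair (Pi.single (top N) p.2) g.2 = p.2 * g.2 (top N) := by
      simp [pair, Pi.single_apply]
    rw [hg, h2]
    have h3 : chi p g = Complex.exp ((-2 * Real.pi * (p.1 * g.1) : ℝ) * Complex.I) *
        Complex.exp ((-2 * Real.pi * (p.2 * g.2 (top N)) : ℝ) * Complex.I) := by
      rw [← Complex.exp_add, ← add_mul, ← Complex.ofReal_add]
      unfold chi top
      congr 3
      ring
    rw [h3]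
    ring
  rw [h1, Measure.volume_eq_prod]
  refine (integral_prod_mul (fun t : ℝ => α t * Complex.exp ((-2 * Real.pi * (p.1 * t) : ℝ) *
    Complex.I)) fun u : V N => β u * Complex.exp ((-2 * Real.pi *
      pair (Pi.single (top N) p.2) u : ℝ) * Complex.I)).trans ?_
  congr 1
  rw [Real.fourier_eq']
  refine integral_congr_ae (Eventually.of_forall fun t => ?_)
  simp only [smul_eq_mul]
  rw [mul_comm]
  congr 3

theorem repNorm_tensor_le {N : ℕ} [Fact (3 ≤ N)] {α : ℝ → ℂ} {β : V N → ℂ} (hα : Integrable α)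
    (hβ : Integrable β) {c : ℝ} (hc : ∀ l, ‖fourierV β l‖ ≤ c) (σ : SN N) :
    repNorm (tensor hα hβ) σ ≤ (∫ t, ‖α t‖) * c := by
  cases σ with
  | inl l =>
    have h := (hasKernel_piL1 l.1 hα hβ).norm_le (hα.norm.mul_const c) (fun q => by
      rw [norm_mul]
      gcongr
      exact hc _)
    rwa [integral_mul_const] at h
  | inr p =>
    change ‖chiL1 p (tensor hα hβ)‖ ≤ _
    rw [chiL1_tensor, norm_mul]
    refine mul_le_mul ?_ (hc _) (norm_nonneg _) (integral_nonneg fun _ => norm_nonneg _)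
    rw [Real.fourier_eq']
    refine (norm_integral_le_integral_norm _).trans (le_of_eq ?_)
    refine integral_congr_ae (Eventually.of_forall fun t => ?_)
    simp only [norm_smul, Complex.norm_exp_ofReal_mul_I, one_mul]

/-- The `C*`-norm of `α ⊗ β` is controlled by the supremum of `β̂` alone, so that `β̂` may be
changed near infinity. -/
theorem norm_ofL1_tensor_le {N : ℕ} [Fact (3 ≤ N)] {α : ℝ → ℂ} {β : V N → ℂ} (hα : Integrable α)
    (hβ : Integrable β) {c : ℝ} (hc : ∀ l, ‖fourierV β l‖ ≤ c) :
    ‖ofL1 (tensor hα hβ)‖ ≤ (∫ t, ‖α t‖) * c := by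
  have : Nonempty (SN N) := ⟨Sum.inr (0, 0)⟩
  rw [ofL1, UniformSpace.Completion.norm_coe, norm_L1C]
  exact ciSup_le fun σ => repNorm_tensor_le hα hβ hc σ

theorem norm_ofL1_le {N : ℕ} [Fact (3 ≤ N)] (f : L1 N) : ‖ofL1 f‖ ≤ ‖f‖ := by
  have : Nonempty (SN N) := ⟨Sum.inr (0, 0)⟩
  rw [ofL1, UniformSpace.Completion.norm_coe, norm_L1C]
  exact ciSup_le fun σ => repNorm_le f σ

/-! ### Density of elementary tensors -/

section Rectangles

variable {X Y : Type*} [MeasurableSpace X] [MeasurableSpace Y] {μ : Measure X} {ν : Measure Y}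

theorem indicatorConstLp_mem_of_tendsto {W : Set (Lp ℂ 1 μ)} (hW : IsClosed W)
    {s : ℕ → Set X} (hs : ∀ n, MeasurableSet (s n)) (hmono : Monotone s)
    (hμ : μ (⋃ n, s n) ≠ ⊤) (hμn : ∀ n, μ (s n) ≠ ⊤)
    (h : ∀ n, indicatorConstLp 1 (hs n) (hμn n) (1 : ℂ) ∈ W) :
    indicatorConstLp 1 (MeasurableSet.iUnion hs) hμ (1 : ℂ) ∈ W := by
  refine hW.mem_of_tendsto (b := atTop) (tendsto_indicatorConstLp_set (ht := hs) (hμt := hμn)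
    ENNReal.one_ne_top ?_) (Eventually.of_forall h)
  have h1 : ∀ n, s n ∆ (⋃ n, s n) = (⋃ n, s n) \ s n := by
    intro n
    rw [Set.symmDiff_def, Set.sdiff_eq_empty.2 (Set.subset_iUnion s n), Set.empty_union]
  simp_rw [h1]
  have h2 := tendsto_measure_iInter_atTop (μ := μ) (s := fun n => (⋃ n, s n) \ s n)
    (fun n => ((MeasurableSet.iUnion hs).diff (hs n)).nullMeasurableSet)
    (fun m n hmn => Set.sdiff_subset_sdiff_right (hmono hmn))
    ⟨0, measure_ne_top_of_subset Set.sdiff_subset hμ⟩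
  have h3 : ⋂ n, (⋃ n, s n) \ s n = ∅ := by
    rw [← Set.sdiff_iUnion, Set.sdiff_self]
  rwa [h3, measure_empty] at h2

/-- Equal sets have equal indicator functions, whatever the proofs of measurability and of finite
measure are. -/
theorem indicatorConstLp_set_congr {s t : Set X} (hst : s = t) (hs : MeasurableSet s)
    (ht : MeasurableSet t) (hμs : μ s ≠ ⊤) (hμt : μ t ≠ ⊤) :
    indicatorConstLp 1 hs hμs (1 : ℂ) = indicatorConstLp 1 ht hμt (1 : ℂ) := by
  subst hst
  rfl

variable [SigmaFinite μ] [SigmaFinite ν]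

/-- The characteristic functions of measurable rectangles span a dense subspace of `L¹(X × Y)`. -/
theorem mem_of_forall_rectangle (W : Submodule ℂ (Lp ℂ 1 (μ.prod ν)))
    (hW : IsClosed (W : Set (Lp ℂ 1 (μ.prod ν))))
    (h : ∀ s t (hs : MeasurableSet s) (ht : MeasurableSet t) (hst : μ.prod ν (s ×ˢ t) ≠ ⊤),
      μ s ≠ ⊤ → ν t ≠ ⊤ → indicatorConstLp 1 (hs.prod ht) hst (1 : ℂ) ∈ W)
    (f : Lp ℂ 1 (μ.prod ν)) : f ∈ W := by
  let B : ℕ → Set (X × Y) := fun n => spanningSets μ n ×ˢ spanningSets ν n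
  have hB : ∀ n, MeasurableSet (B n) := fun n =>
    (measurableSet_spanningSets μ n).prod (measurableSet_spanningSets ν n)
  have hBμ : ∀ n, μ.prod ν (B n) ≠ ⊤ := fun n => by
    rw [Measure.prod_prod]
    exact (ENNReal.mul_lt_top (measure_spanningSets_lt_top μ n)
      (measure_spanningSets_lt_top ν n)).ne
  have hEB : ∀ n (E : Set (X × Y)), μ.prod ν (E ∩ B n) ≠ ⊤ := fun n E =>
    measure_ne_top_of_subset Set.inter_subset_right (hBμ n)
  -- Within the rectangle `B n` of finite measure this is a Dynkin class argument.
  have hloc : ∀ n (E : Set (X × Y)) (hE : MeasurableSet E),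
      indicatorConstLp 1 (hE.inter (hB n)) (hEB n E) (1 : ℂ) ∈ W := by
    intro n
    have hBW : indicatorConstLp 1 (hB n) (hBμ n) (1 : ℂ) ∈ W :=
      h _ _ (measurableSet_spanningSets μ n) (measurableSet_spanningSets ν n) (hBμ n)
        (measure_spanningSets_lt_top μ n).ne (measure_spanningSets_lt_top ν n).ne
    refine MeasurableSpace.induction_on_inter (m := Prod.instMeasurableSpace)
      generateFrom_prod.symm isPiSystem_prod ?_ ?_ ?_ ?_
    · rw [indicatorConstLp_set_congr (Set.empty_inter (B n)) _ MeasurableSet.empty _ (by simp),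
        indicatorConstLp_empty]
      exact W.zero_mem
    · rintro _ ⟨s, hs, t, ht, rfl⟩
      have hs' : MeasurableSet (s ∩ spanningSets μ n) :=
        MeasurableSet.inter hs (measurableSet_spanningSets μ n)
      have ht' : MeasurableSet (t ∩ spanningSets ν n) :=
        MeasurableSet.inter ht (measurableSet_spanningSets ν n)
      have e : (s ×ˢ t) ∩ B n = (s ∩ spanningSets μ n) ×ˢ (t ∩ spanningSets ν n) :=
        Set.prod_inter_prod
      rw [indicatorConstLp_set_congr e _ (hs'.prod ht') _ (e ▸ hEB n _)]
      exact h _ _ hs' ht' _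
        (measure_ne_top_of_subset Set.inter_subset_right (measure_spanningSets_lt_top μ n).ne)
        (measure_ne_top_of_subset Set.inter_subset_right (measure_spanningSets_lt_top ν n).ne)
    · intro E hE hEW
      have hd : Disjoint (E ∩ B n) (Eᶜ ∩ B n) :=
        (disjoint_compl_right (a := E)).mono Set.inter_subset_left Set.inter_subset_left
      have e : E ∩ B n ∪ Eᶜ ∩ B n = B n := by
        rw [← Set.union_inter_distrib_right, Set.union_compl_self, Set.univ_inter]
      have h1 := indicatorConstLp_disjoint_union (p := 1) (hE.inter (hB n))
        (hE.compl.inter (hB n)) (hEB n E) (hEB n Eᶜ) hd (1 : ℂ)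
      rw [indicatorConstLp_set_congr e _ (hB n) _ (hBμ n)] at h1
      rw [← sub_eq_iff_eq_add'.2 h1]
      exact W.sub_mem hBW hEW
    · intro E hdis hE hEW
      have hacc : ∀ m, MeasurableSet (Set.accumulate E m) := fun m =>
        MeasurableSet.biUnion (Set.to_countable _) fun i _ => hE i
      have haccW : ∀ m, indicatorConstLp 1 ((hacc m).inter (hB n)) (hEB n _) (1 : ℂ) ∈ W := by
        intro m
        induction m with
        | zero =>
          have e : Set.accumulate E 0 ∩ B n = E 0 ∩ B n := by
            rw [Set.accumulate_zero_nat]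
          rw [indicatorConstLp_set_congr e _ ((hE 0).inter (hB n)) _ (hEB n _)]
          exact hEW 0
        | succ m ih =>
          have hd : Disjoint (Set.accumulate E m ∩ B n) (E (m + 1) ∩ B n) := by
            refine Disjoint.mono Set.inter_subset_left Set.inter_subset_left ?_
            exact Set.disjoint_accumulate hdis (Nat.lt_succ_self m)
          have e : Set.accumulate E (m + 1) ∩ B n =
              Set.accumulate E m ∩ B n ∪ E (m + 1) ∩ B n := by
            rw [Set.accumulate_succ, Set.union_inter_distrib_right]
          rw [indicatorConstLp_set_congr e _ (((hacc m).inter (hB n)).union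
              ((hE (m + 1)).inter (hB n))) _ (e ▸ hEB n _),
            indicatorConstLp_disjoint_union ((hacc m).inter (hB n)) ((hE (m + 1)).inter (hB n))
              (hEB n _) (hEB n _) hd]
          exact W.add_mem ih (hEW (m + 1))
      have e : (⋃ i, E i) ∩ B n = ⋃ m, Set.accumulate E m ∩ B n := by
        rw [← Set.iUnion_inter, Set.iUnion_accumulate]
      rw [indicatorConstLp_set_congr e _ (MeasurableSet.iUnion fun m => (hacc m).inter (hB n)) _
        (e ▸ hEB n _)]
      exact indicatorConstLp_mem_of_tendsto hW (fun m => (hacc m).inter (hB n))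
        (fun a b hab => Set.inter_subset_inter_left _ (Set.monotone_accumulate hab)) _
        (fun m => hEB n _) haccW
  refine Lp.induction ENNReal.one_ne_top (fun f => f ∈ W) ?_ ?_ hW f
  · intro c E hE hEμ
    have e : E = ⋃ n, E ∩ B n := by
      rw [← Set.inter_iUnion, Set.iUnion_prod_of_monotone (monotone_spanningSets μ)
        (monotone_spanningSets ν), iUnion_spanningSets, iUnion_spanningSets, Set.univ_prod_univ,
        Set.inter_univ]
    have h1 : indicatorConstLp 1 hE hEμ.ne (1 : ℂ) ∈ W := by
      rw [indicatorConstLp_set_congr e _ (MeasurableSet.iUnion fun m => hE.inter (hB m)) _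
        (e ▸ hEμ.ne)]
      exact indicatorConstLp_mem_of_tendsto hW (fun m => hE.inter (hB m))
        (fun a b hab => Set.inter_subset_inter_right _ (Set.prod_mono
          (monotone_spanningSets μ hab) (monotone_spanningSets ν hab))) _
        (fun m => hEB m _) (fun m => hloc m E hE)
    have h2 : ((Lp.simpleFunc.indicatorConst 1 hE hEμ.ne c : Lp.simpleFunc ℂ 1 (μ.prod ν)) :
        Lp ℂ 1 (μ.prod ν)) = c • indicatorConstLp 1 hE hEμ.ne (1 : ℂ) := by
      rw [Lp.simpleFunc.coe_indicatorConst]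
      refine Lp.ext ?_
      filter_upwards [indicatorConstLp_coeFn (p := 1) (hs := hE) (hμs := hEμ.ne) (c := c),
        indicatorConstLp_coeFn (p := 1) (hs := hE) (hμs := hEμ.ne) (c := (1 : ℂ)),
        Lp.coeFn_smul c (indicatorConstLp 1 hE hEμ.ne (1 : ℂ))] with q h3 h4 h5
      rw [h5, Pi.smul_apply, h3, h4]
      by_cases hq : q ∈ E <;> simp [hq]
    rw [h2]
    exact W.smul_mem c h1
  · intro f g hf hg _ h1 h2
    exact W.add_mem h1 h2

end Rectangles

section Density

variable {N : ℕ}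

theorem ae_comp_fst {a b : ℝ → ℂ} (h : a =ᵐ[volume] b) :
    ∀ᵐ g : ThreadGroup N, a g.1 = b g.1 :=
  (Measure.quasiMeasurePreserving_fst (μ := (volume : Measure ℝ))
    (ν := (volume : Measure (V N)))).ae h

theorem ae_comp_snd {a b : V N → ℂ} (h : a =ᵐ[volume] b) :
    ∀ᵐ g : ThreadGroup N, a g.2 = b g.2 :=
  (Measure.quasiMeasurePreserving_snd (μ := (volume : Measure ℝ))
    (ν := (volume : Measure (V N)))).ae h

theorem norm_tensor {α : ℝ → ℂ} {β : V N → ℂ} (hα : Integrable α) (hβ : Integrable β) :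
    ‖tensor hα hβ‖ = (∫ t, ‖α t‖) * ∫ u, ‖β u‖ := by
  have h : ‖tensor hα hβ‖ = ∫ g : ℝ × V N, ‖α g.1‖ * ‖β g.2‖ := by
    rw [L1.norm_eq_integral_norm]
    refine integral_congr_ae ?_
    filter_upwards [tensor_coe hα hβ] with g hg
    rw [hg, norm_mul]
  rw [h, Measure.volume_eq_prod]
  exact integral_prod_mul (fun t => ‖α t‖) fun u => ‖β u‖

theorem tensor_congr {α α' : ℝ → ℂ} {β β' : V N → ℂ} (hα : Integrable α) (hβ : Integrable β)
    (hα' : Integrable α') (hβ' : Integrable β') (h1 : α =ᵐ[volume] α') (h2 : β =ᵐ[volume] β') :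
    tensor hα hβ = tensor hα' hβ' := by
  refine Lp.ext ?_
  filter_upwards [tensor_coe hα hβ, tensor_coe hα' hβ', ae_comp_fst h1, ae_comp_snd h2]
    with g e1 e2 e3 e4
  rw [e1, e2, e3, e4]

theorem tensor_add_left {α α' : ℝ → ℂ} {β : V N → ℂ} (hα : Integrable α) (hα' : Integrable α')
    (hβ : Integrable β) : tensor (hα.add hα') hβ = tensor hα hβ + tensor hα' hβ := by
  refine Lp.ext ?_
  filter_upwards [tensor_coe hα hβ, tensor_coe hα' hβ, tensor_coe (hα.add hα') hβ,
    Lp.coeFn_add (tensor hα hβ) (tensor hα' hβ)] with g e1 e2 e3 e4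
  exact e3.trans ((add_mul _ _ _).trans (e4.trans (congrArg₂ (· + ·) e1 e2)).symm)

theorem tensor_add_right {α : ℝ → ℂ} {β β' : V N → ℂ} (hα : Integrable α) (hβ : Integrable β)
    (hβ' : Integrable β') : tensor hα (hβ.add hβ') = tensor hα hβ + tensor hα hβ' := by
  refine Lp.ext ?_
  filter_upwards [tensor_coe hα hβ, tensor_coe hα hβ', tensor_coe hα (hβ.add hβ'),
    Lp.coeFn_add (tensor hα hβ) (tensor hα hβ')] with g e1 e2 e3 e4
  exact e3.trans ((mul_add _ _ _).trans (e4.trans (congrArg₂ (· + ·) e1 e2)).symm)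

theorem tensor_smul_left {α : ℝ → ℂ} {β : V N → ℂ} (c : ℂ) (hα : Integrable α)
    (hβ : Integrable β) : tensor (hα.smul c) hβ = c • tensor hα hβ := by
  refine Lp.ext ?_
  filter_upwards [tensor_coe hα hβ, tensor_coe (hα.smul c) hβ,
    Lp.coeFn_smul c (tensor hα hβ)] with g e1 e2 e3
  exact e2.trans ((smul_mul_assoc _ _ _).trans (e3.trans (congrArg (c • ·) e1)).symm)

theorem tensor_smul_right {α : ℝ → ℂ} {β : V N → ℂ} (c : ℂ) (hα : Integrable α)
    (hβ : Integrable β) : tensor hα (hβ.smul c) = c • tensor hα hβ := by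
  refine Lp.ext ?_
  filter_upwards [tensor_coe hα hβ, tensor_coe hα (hβ.smul c),
    Lp.coeFn_smul c (tensor hα hβ)] with g e1 e2 e3
  exact e2.trans ((mul_smul_comm _ _ _).trans (e3.trans (congrArg (c • ·) e1)).symm)

/-- The elementary tensor as a bounded bilinear map `L¹(ℝ) × L¹(𝔟) → L¹(G_N)`. -/
def tensorL (N : ℕ) :
    Lp ℂ 1 (volume : Measure ℝ) →L[ℂ] Lp ℂ 1 (volume : Measure (V N)) →L[ℂ] L1 N :=
  LinearMap.mkContinuous₂
    (LinearMap.mk₂ ℂ (fun α β => tensor (L1.integrable_coeFn α) (L1.integrable_coeFn β))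
      (fun α α' β => by
        rw [← tensor_add_left]
        exact tensor_congr _ _ _ _ (Lp.coeFn_add α α') (ae_eq_refl _))
      (fun c α β => by
        rw [← tensor_smul_left]
        exact tensor_congr _ _ _ _ (Lp.coeFn_smul c α) (ae_eq_refl _))
      (fun α β β' => by
        rw [← tensor_add_right]
        exact tensor_congr _ _ _ _ (ae_eq_refl _) (Lp.coeFn_add β β'))
      (fun c α β => by
        rw [← tensor_smul_right]
        exact tensor_congr _ _ _ _ (ae_eq_refl _) (Lp.coeFn_smul c β))) 1
    (fun α β => by
      rw [one_mul, LinearMap.mk₂_apply, norm_tensor, L1.norm_eq_integral_norm,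
        L1.norm_eq_integral_norm])

theorem tensorL_apply (α : Lp ℂ 1 (volume : Measure ℝ)) (β : Lp ℂ 1 (volume : Measure (V N))) :
    tensorL N α β = tensor (L1.integrable_coeFn α) (L1.integrable_coeFn β) := rfl

theorem integrable_comp_toLp (ψ : 𝓢(EuclideanSpace ℝ (Fin (N - 1)), ℂ)) :
    Integrable fun u : V N => ψ (WithLp.toLp 2 u) :=
  (PiLp.volume_preserving_toLp (Fin (N - 1))).integrable_comp_of_integrable ψ.integrable

theorem fourierV_comp_toLp (ψ : 𝓢(EuclideanSpace ℝ (Fin (N - 1)), ℂ)) (l : V N) :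
    fourierV (fun u : V N => ψ (WithLp.toLp 2 u)) l = 𝓕 ψ (WithLp.toLp 2 l) := by
  rw [SchwartzMap.fourier_coe, Real.fourier_eq']
  have h := (PiLp.volume_preserving_toLp (Fin (N - 1))).integral_comp
    (MeasurableEquiv.toLp 2 (Fin (N - 1) → ℝ)).measurableEmbedding
    (fun v => Complex.exp (((-2 * Real.pi * inner ℝ v (WithLp.toLp 2 l) : ℝ) : ℂ) * Complex.I) •
      ψ v)
  rw [← h]
  refine integral_congr_ae (Eventually.of_forall fun u => ?_)
  simp only [smul_eq_mul]
  rw [mul_comm]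
  congr 5

variable [Fact (3 ≤ N)]

/-- The canonical map `L¹(G_N) → C*(G_N)` as a continuous linear map. -/
def ofL1L (N : ℕ) [Fact (3 ≤ N)] : L1 N →L[ℂ] CStar N :=
  LinearMap.mkContinuous
    { toFun := ofL1
      map_add' := fun f h => by
        simp only [ofL1, map_add, UniformSpace.Completion.coe_add]
      map_smul' := fun c f => by
        simp only [ofL1, map_smul, UniformSpace.Completion.coe_smul, RingHom.id_apply] } 1
    (fun f => by
      rw [one_mul]
      exact norm_ofL1_le f)

theorem ofL1L_apply (f : L1 N) : ofL1L N f = ofL1 f := rfl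

/-- A closed subspace of `C*(G_N)` which contains all `α ⊗ β` with `α` a test function and
`β̂` of compact support is the whole algebra. -/
theorem CStar.induction {W : Submodule ℂ (CStar N)} (hW : IsClosed (W : Set (CStar N)))
    (h : ∀ (α : ℝ → ℂ) (β : V N → ℂ) (_ : ContDiff ℝ ∞ α) (_ : HasCompactSupport α)
      (hα : Integrable α volume) (hβ : Integrable β volume), HasCompactSupport (fourierV β) →
      ofL1 (tensor hα hβ) ∈ W) (a : CStar N) : a ∈ W := by
  -- For a Schwartz function `β` the compact support of `β̂` is achieved by a cutoff of `β̂` where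
  -- it is small.
  have h1 : ∀ (α : ℝ → ℂ) (hα : Integrable α volume) (_ : ContDiff ℝ ∞ α) (_ : HasCompactSupport α)
      (ψ : 𝓢(EuclideanSpace ℝ (Fin (N - 1)), ℂ)),
      ofL1 (tensor hα (integrable_comp_toLp ψ)) ∈ W := by
    intro α hα hα1 hα2 ψ
    rw [← SetLike.mem_coe, ← hW.closure_eq, Metric.mem_closure_iff]
    intro ε hε
    obtain ⟨δ, hδ, hδε⟩ : ∃ δ > 0, (∫ t, ‖α t‖) * δ < ε := by
      have h0 : 0 ≤ ∫ t, ‖α t‖ := integral_nonneg fun _ => norm_nonneg _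
      refine ⟨ε / ((∫ t, ‖α t‖) + 1), by positivity, ?_⟩
      rw [mul_div_assoc', div_lt_iff₀ (by positivity)]
      linarith
    obtain ⟨R, hR0, hR⟩ : ∃ R > 0, ∀ v, R ≤ ‖v‖ → ‖𝓕 ψ v‖ ≤ δ := by
      have h0 := (tendsto_zero_iff_norm_tendsto_zero.1 (zero_at_infty (𝓕 ψ))).eventually
        (eventually_le_nhds hδ)
      rw [← Metric.cobounded_eq_cocompact, Filter.Eventually,
        ← comap_norm_atTop, mem_comap] at h0
      obtain ⟨t, ht, hts⟩ := h0
      obtain ⟨R, hR⟩ := mem_atTop_sets.1 ht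
      exact ⟨max R 1, by positivity, fun v hv => hts (hR _ ((le_max_left _ _).trans hv))⟩
    let χ : ContDiffBump (0 : EuclideanSpace ℝ (Fin (N - 1))) := ⟨R, R + 1, hR0, by linarith⟩
    have hs : ContDiff ℝ ∞ fun v => (χ v : ℂ) * 𝓕 ψ v :=
      (Complex.ofRealCLM.contDiff.comp χ.contDiff).mul ((𝓕 ψ).smooth ⊤)
    have hc : HasCompactSupport fun v => (χ v : ℂ) * 𝓕 ψ v :=
      (χ.hasCompactSupport.comp_left (g := fun r : ℝ => (r : ℂ)) Complex.ofReal_zero).mul_right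
    let Θ : 𝓢(EuclideanSpace ℝ (Fin (N - 1)), ℂ) := hc.toSchwartzMap hs
    have hΘ : 𝓕 (𝓕⁻ Θ) = Θ := FourierTransform.fourier_fourierInv_eq Θ
    refine ⟨ofL1 (tensor hα (integrable_comp_toLp (𝓕⁻ Θ))), h _ _ hα1 hα2 hα _ ?_, ?_⟩
    · have e : fourierV (fun u : V N => (𝓕⁻ Θ) (WithLp.toLp 2 u)) =
          (fun v => (χ v : ℂ) * 𝓕 ψ v) ∘ (PiLp.homeomorph 2 fun _ : Fin (N - 1) => ℝ).symm := by
        funext l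
        rw [fourierV_comp_toLp, hΘ]
        rfl
      rw [e]
      exact hc.comp_homeomorph _
    · have e : ofL1 (tensor hα (integrable_comp_toLp ψ)) -
          ofL1 (tensor hα (integrable_comp_toLp (𝓕⁻ Θ))) =
          ofL1 (tensor hα (integrable_comp_toLp (ψ - 𝓕⁻ Θ))) := by
        rw [← ofL1L_apply, ← ofL1L_apply, ← ofL1L_apply, ← map_sub]
        congr 1
        rw [sub_eq_iff_eq_add, ← tensor_add_right]
        refine tensor_congr _ _ _ _ (ae_eq_refl _) (Eventually.of_forall fun u => ?_)
        simp
      rw [dist_eq_norm, e]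
      have hsub : 𝓕 (ψ - 𝓕⁻ Θ) = 𝓕 ψ - 𝓕 (𝓕⁻ Θ) := map_sub
        (FourierTransform.fourierCLM ℂ 𝓢(EuclideanSpace ℝ (Fin (N - 1)), ℂ)) _ _
      refine (norm_ofL1_tensor_le hα _ (c := δ) fun l => ?_).trans_lt hδε
      rw [fourierV_comp_toLp, hsub, hΘ]
      set v : EuclideanSpace ℝ (Fin (N - 1)) := WithLp.toLp 2 l
      change ‖𝓕 ψ v - (χ v : ℂ) * 𝓕 ψ v‖ ≤ δ
      by_cases hv : R ≤ ‖v‖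
      · have e1 : 𝓕 ψ v - (χ v : ℂ) * 𝓕 ψ v = ((1 - χ v : ℝ) : ℂ) * 𝓕 ψ v := by
          push_cast
          ring
        rw [e1, norm_mul, Complex.norm_real, Real.norm_of_nonneg (by linarith [χ.le_one (x := v)])]
        calc (1 - χ v) * ‖𝓕 ψ v‖ ≤ 1 * δ := by
              gcongr
              · linarith [χ.nonneg (x := v)]
              · exact hR v hv
          _ = δ := one_mul δ
      · have e1 : χ v = 1 := χ.one_of_mem_closedBall (by
          rw [mem_closedBall_zero_iff]
          exact (not_le.1 hv).le)
        rw [e1, Complex.ofReal_one, one_mul, sub_self, norm_zero]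
        exact hδ.le
  -- Test functions are dense in `L¹(ℝ)` and in `L¹(𝔟)`.
  have h2 : ∀ (α : Lp ℂ 1 (volume : Measure ℝ)) (β : Lp ℂ 1 (volume : Measure (V N))),
      ofL1L N (tensorL N α β) ∈ W := by
    have hd : ∀ (α : ℝ → ℂ) (hα : Integrable α volume) (_ : ContDiff ℝ ∞ α)
        (_ : HasCompactSupport α) (β : Lp ℂ 1 (volume : Measure (V N))),
        ofL1L N (tensorL N (hα.toL1 α) β) ∈ W := by
      intro α hα hα1 hα2
      have hcl : IsClosed {β : Lp ℂ 1 (volume : Measure (V N)) |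
          ofL1L N (tensorL N (hα.toL1 α) β) ∈ W} :=
        hW.preimage ((ofL1L N).continuous.comp (tensorL N (hα.toL1 α)).continuous)
      refine fun β => hcl.closure_subset_iff.2 ?_
        (Lp.dense_hasCompactSupport_contDiff ENNReal.one_ne_top β)
      rintro β ⟨g, hg, hg1, hg2⟩
      have hc : HasCompactSupport fun v : EuclideanSpace ℝ (Fin (N - 1)) => g (WithLp.ofLp v) :=
        hg1.comp_homeomorph (PiLp.homeomorph 2 fun _ : Fin (N - 1) => ℝ)
      have hs : ContDiff ℝ ∞ fun v : EuclideanSpace ℝ (Fin (N - 1)) => g (WithLp.ofLp v) :=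
        hg2.comp (PiLp.contDiff_ofLp)
      have := h1 α hα hα1 hα2 (hc.toSchwartzMap hs)
      change ofL1 _ ∈ W
      rw [tensorL_apply]
      convert this using 2
      exact tensor_congr _ _ _ _ hα.coeFn_toL1 hg
    intro α β
    have hcl : IsClosed {α : Lp ℂ 1 (volume : Measure ℝ) | ofL1L N (tensorL N α β) ∈ W} :=
      hW.preimage ((ofL1L N).continuous.comp ((tensorL N).flip β).continuous)
    refine hcl.closure_subset_iff.2 ?_ (Lp.dense_hasCompactSupport_contDiff ENNReal.one_ne_top α)
    rintro α ⟨g, hg, hg1, hg2⟩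
    have hi := (hg2.continuous.integrable_of_hasCompactSupport (μ := volume) hg1)
    have e : α = hi.toL1 g := Lp.ext (hg.trans hi.coeFn_toL1.symm)
    rw [e]
    exact hd g hi hg2 hg1 β
  have h3 : ∀ f : L1 N, ofL1L N f ∈ W := by
    intro f
    refine mem_of_forall_rectangle (μ := (volume : Measure ℝ)) (ν := (volume : Measure (V N)))
      (W.comap (ofL1L N).toLinearMap) (hW.preimage (ofL1L N).continuous) ?_ f
    intro s t hs ht hst hsμ htμ
    have e : (indicatorConstLp 1 (hs.prod ht) hst (1 : ℂ) : L1 N) =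
        tensorL N (indicatorConstLp 1 hs hsμ 1) (indicatorConstLp 1 ht htμ 1) := by
      rw [tensorL_apply]
      refine Lp.ext ?_
      have e1 := ae_comp_fst (N := N) (indicatorConstLp_coeFn (p := 1) (hs := hs) (hμs := hsμ)
        (c := (1 : ℂ)))
      have e2 := ae_comp_snd (indicatorConstLp_coeFn (p := 1) (hs := ht) (hμs := htμ)
        (c := (1 : ℂ)))
      have e3 := indicatorConstLp_coeFn (p := 1) (hs := hs.prod ht) (hμs := hst) (c := (1 : ℂ))
      filter_upwards [tensor_coe (L1.integrable_coeFn (indicatorConstLp 1 hs hsμ (1 : ℂ)))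
        (L1.integrable_coeFn (indicatorConstLp 1 ht htμ (1 : ℂ))), e1, e2, e3] with g a1 a2 a3 a4
      rw [a1, a2, a3]
      have a5 : ∀ q : ℝ × V N, (s ×ˢ t).indicator (fun _ => (1 : ℂ)) q =
          s.indicator (fun _ => 1) q.1 * t.indicator (fun _ => 1) q.2 := by
        intro q
        by_cases hq1 : q.1 ∈ s <;> by_cases hq2 : q.2 ∈ t <;>
          simp [hq1, hq2, Set.mem_prod]
      exact a4.trans (a5 g)
    change ofL1L N (indicatorConstLp 1 (hs.prod ht) hst (1 : ℂ) : L1 N) ∈ W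
    rw [e]
    exact h2 _ _
  have hd : DenseRange (fun f : L1C N => (f : CStar N)) := UniformSpace.Completion.denseRange_coe
  exact hd.induction_on a hW fun f => h3 (toL1C.symm f)

end Density

/-! ### The polynomials `ℓ̂` -/

section HatPolynomial

variable {N : ℕ}

/-- The polynomial function `t ↦ ℓ̂(t)` as a polynomial. -/
def hatPoly (l : V N) : Polynomial ℝ :=
  ∑ j : Fin (N - 1), Polynomial.monomial (N - 2 - (j : ℕ))
    ((-1) ^ (N - 2 - (j : ℕ)) / (Nat.factorial (N - 2 - (j : ℕ)) : ℝ) * l j)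

theorem coeff_hatPoly (l : V N) (j : Fin (N - 1)) :
    (hatPoly l).coeff (N - 2 - (j : ℕ)) =
      (-1) ^ (N - 2 - (j : ℕ)) / (Nat.factorial (N - 2 - (j : ℕ)) : ℝ) * l j := by
  unfold hatPoly
  rw [Polynomial.finsetSum_coeff, Finset.sum_eq_single j]
  · rw [Polynomial.coeff_monomial, if_pos rfl]
  · intro i _ hij
    have hi := i.isLt
    have hj := j.isLt
    have hne : (i : ℕ) ≠ (j : ℕ) := fun h => hij (Fin.ext h)
    rw [Polynomial.coeff_monomial, if_neg (by omega)]
  · simp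

theorem eq_zero_of_hatPoly {l : V N} {j : Fin (N - 1)}
    (h : (hatPoly l).coeff (N - 2 - (j : ℕ)) = 0) : l j = 0 := by
  rw [coeff_hatPoly] at h
  refine (mul_eq_zero.1 h).resolve_left ?_
  positivity

/-- The dilation of `V` which corresponds to the dilation of the variable of `ℓ̂`. -/
def scale (τ : ℝ) (l : V N) : V N := fun i => τ ^ (N - 2 - (i : ℕ)) * l i

theorem continuous_scale : Continuous fun p : ℝ × V N => scale p.1 p.2 := by
  refine continuous_pi fun i => ?_
  unfold scale
  fun_prop

/-- The substitution `t ↦ ρt` in `ℓ̂`, on the level of `V`. -/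
theorem coact_mul (x : ℝ) {ρ : ℝ} (hρ : ρ ≠ 0) (l : V N) :
    coact (x * ρ) l = scale ρ⁻¹ (coact x (scale ρ l)) := by
  funext i
  simp only [scale, coact]
  rw [Finset.mul_sum]
  refine Finset.sum_congr rfl fun j hj => ?_
  have hji : (j : ℕ) ≤ (i : ℕ) := by
    have : j ≤ i := by simpa using hj
    exact this
  have hi := i.isLt
  have e : N - 2 - (j : ℕ) = (N - 2 - (i : ℕ)) + ((i : ℕ) - (j : ℕ)) := by omega
  rw [e, pow_add, neg_mul_eq_neg_mul, mul_pow, inv_pow]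
  field_simp

variable [Fact (3 ≤ N)]

theorem coe_top : ((top N : Fin (N - 1)) : ℕ) = N - 2 := rfl

theorem le_top' (i : Fin (N - 1)) : i ≤ top N := by
  have h := i.isLt
  rw [Fin.le_def, coe_top]
  omega

theorem eval_hatPoly (l : V N) (t : ℝ) : (hatPoly l).eval t = hat l t := by
  have h : Finset.Iic (top N) = Finset.univ := by
    ext i
    simpa using le_top' i
  unfold hatPoly hat coact
  rw [Polynomial.eval_finsetSum, h]
  refine Finset.sum_congr rfl fun j _ => ?_
  rw [Polynomial.eval_monomial, coe_top, neg_pow t]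
  ring

theorem natDegree_hatPoly_lt (l : V N) : (hatPoly l).natDegree < N - 1 := by
  have hN : 3 ≤ N := Fact.out
  refine lt_of_le_of_lt (Polynomial.natDegree_sum_le_of_forall_le _ _ (n := N - 2) fun j _ => ?_)
    (by omega)
  exact (Polynomial.natDegree_monomial_le _).trans (Nat.sub_le _ _)

theorem degree_hatPoly_pos {l : V N} (h : ¬ IsCharacter l) : 0 < (hatPoly l).degree := by
  unfold IsCharacter at h
  push Not at h
  obtain ⟨i, hi, hli⟩ := h
  rw [← Polynomial.natDegree_pos_iff_degree_pos]
  have h1 : (hatPoly l).coeff (N - 2 - (i : ℕ)) ≠ 0 := fun h0 => hli (eq_zero_of_hatPoly h0)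
  refine lt_of_lt_of_le ?_ (Polynomial.le_natDegree_of_ne_zero h1)
  have h2 := i.isLt
  have h3 : (i : ℕ) ≠ N - 2 := fun h => hi (Fin.ext h)
  omega

theorem continuous_hat : Continuous fun p : ℝ × V N => hat p.2 p.1 :=
  (continuous_apply (top N)).comp continuous_coact

/-- Translation of the variable of `ℓ̂`. -/
theorem hat_coact (t x : ℝ) (l : V N) : hat (coact t l) x = hat l (x + t) := by
  unfold hat
  rw [coact_coact]

/-- Evaluation of `ℓ̂` at `0, …, N - 2`. -/
def evalHat (N : ℕ) [Fact (3 ≤ N)] : V N →ₗ[ℝ] V N where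
  toFun l := fun i => hat l (i : ℕ)
  map_add' l l' := by
    funext i
    simp [hat, coact, mul_add, Finset.sum_add_distrib]
  map_smul' c l := by
    funext i
    simp only [hat, coact, Pi.smul_apply, smul_eq_mul, RingHom.id_apply, Finset.mul_sum]
    exact Finset.sum_congr rfl fun j _ => by ring

/-- The degree of `ℓ̂` is at most `N - 2`, so that `N - 1` values determine `ℓ̂` and `ℓ`. -/
theorem evalHat_injective : Function.Injective (evalHat N) := by
  refine (injective_iff_map_eq_zero _).2 fun l hl => ?_
  have h0 : hatPoly l = 0 := by
    refine Polynomial.eq_zero_of_natDegree_lt_card_of_eval_eq_zero (hatPoly l)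
      (f := fun i : Fin (N - 1) => ((i : ℕ) : ℝ)) ?_ ?_ ?_
    · exact fun i j hij => Fin.ext (Nat.cast_injective (R := ℝ) hij)
    · intro i
      rw [eval_hatPoly]
      exact congrFun hl i
    · simpa using natDegree_hatPoly_lt l
  funext j
  refine eq_zero_of_hatPoly ?_
  rw [h0, Polynomial.coeff_zero]

/-- Pointwise convergence of the polynomials `η̂_k` implies convergence of the `η_k`. -/
theorem exists_tendsto_of_hat {η : ℕ → V N} {Q : ℝ → ℝ}
    (h : ∀ x, Tendsto (fun k => hat (η k) x) atTop (𝓝 (Q x))) :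
    ∃ ξ : V N, Tendsto η atTop (𝓝 ξ) ∧ ∀ x, hat ξ x = Q x := by
  let e : V N ≃L[ℝ] V N :=
    (LinearEquiv.ofInjectiveEndo (evalHat N) evalHat_injective).toContinuousLinearEquiv
  have he : ∀ l i, e l i = hat l ((i : Fin (N - 1)) : ℕ) := fun l i => rfl
  have h1 : Tendsto (fun k => e (η k)) atTop (𝓝 fun i : Fin (N - 1) => Q (i : ℕ)) :=
    tendsto_pi_nhds.2 fun i => h _
  have h2 : Tendsto η atTop (𝓝 (e.symm fun i : Fin (N - 1) => Q (i : ℕ))) := by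
    have := (e.symm.continuous.tendsto _).comp h1
    simpa only [Function.comp_def, e.symm_apply_apply] using this
  refine ⟨_, h2, fun x => ?_⟩
  have hc : Continuous fun l : V N => hat l x := continuous_hat.comp (Continuous.prodMk_right x)
  exact tendsto_nhds_unique ((hc.tendsto _).comp h2) (h x)

/-- The degenerate dilation is the projection to the characters. -/
theorem scale_zero (l : V N) : scale 0 l = Pi.single (top N) (l (top N)) := by
  funext i
  by_cases hi : i = top N
  · subst hi
    simp [scale, coe_top]
  · have h2 := i.isLt
    have h3 : (i : ℕ) ≠ N - 2 := fun h => hi (Fin.ext h)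
    rw [Pi.single_eq_of_ne hi, scale, zero_pow (by omega), zero_mul]

theorem hat_scale (x : ℝ) {ρ : ℝ} (hρ : ρ ≠ 0) (l : V N) : hat (scale ρ l) x = hat l (x * ρ) := by
  unfold hat
  rw [coact_mul x hρ]
  simp [scale, coe_top]

end HatPolynomial

/-! ### Growth of the polynomials outside of large intervals -/

/-- Let `P_k(x) = c_k ∏_j (x - a_j^k)` and suppose that `P_k(t_k + x ρ_k)` converges to an unbounded
function.  If each root is either at distance `O(ρ_k)` or at distance at least `2 s_k ρ_k` of `t_k`,
then `P_k(t_k + x ρ_k)` is large for all `x` with `X ≤ |x| < s_k`, uniformly in `k`. -/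
theorem eventually_le_abs_of_roots {d : ℕ} {a : Fin d → ℕ → ℂ} {c : ℕ → ℝ} {P : ℕ → ℝ → ℝ}
    (hP : ∀ k (x : ℝ), ((P k x : ℝ) : ℂ) = c k * ∏ j, ((x : ℂ) - a j k)) {t ρ s : ℕ → ℝ}
    (hρ : ∀ᶠ k in atTop, 0 < ρ k) (hs : Tendsto s atTop atTop) {L : Set (Fin d)}
    (hL : ∀ j ∈ L, ∃ R : ℝ, ∀ᶠ k in atTop, ‖(t k : ℂ) - a j k‖ ≤ R * ρ k)
    (hL' : ∀ j ∉ L, ∀ᶠ k in atTop, 2 * (s k * ρ k) ≤ ‖(t k : ℂ) - a j k‖) {Q : ℝ → ℝ}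
    (hQ : ∀ x, Tendsto (fun k => P k (t k + x * ρ k)) atTop (𝓝 (Q x)))
    (hunb : ∀ B, ∃ x, B < |Q x|) (B : ℝ) :
    ∃ X, ∀ᶠ k in atTop, ∀ x, X ≤ |x| → |x| < s k → B ≤ |P k (t k + x * ρ k)| := by
  classical
  obtain ⟨R, hR1, hR⟩ : ∃ R : ℝ, 1 ≤ R ∧ ∀ j ∈ L, ∀ᶠ k in atTop,
      ‖(t k : ℂ) - a j k‖ ≤ R * ρ k := by
    choose! R hR using hL
    refine ⟨1 + ∑ j, |R j|, le_add_of_nonneg_right (Finset.sum_nonneg fun j _ => abs_nonneg _),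
      fun j hj => ?_⟩
    filter_upwards [hR j hj, hρ] with k hk hρk
    refine hk.trans ?_
    gcongr
    have h1 : |R j| ≤ ∑ j, |R j| :=
      Finset.single_le_sum (f := fun j => |R j|) (fun j _ => abs_nonneg _) (Finset.mem_univ j)
    linarith [le_abs_self (R j)]
  -- A root near `t_k` contributes a factor between `|x| - R` and `|x| + R` times `ρ k`, and a
  -- distant one a factor between `1 / 2` and `2` times its distance to `t_k`.  Thus `b k` is, up to
  -- a bounded factor, the leading coefficient of `x ↦ P_k(t_k + x ρ_k)` near `t_k`.
  let G : Fin d → ℕ → ℝ := fun j k => if j ∈ L then ρ k else ‖(t k : ℂ) - a j k‖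
  let b : ℕ → ℝ := fun k => |c k| * ∏ j, G j k
  let u : ℝ → Fin d → ℝ := fun x j => if j ∈ L then |x| + R else 2
  let v : ℝ → Fin d → ℝ := fun x j => if j ∈ L then |x| - R else 1 / 2
  have habs : ∀ k x, |P k (t k + x * ρ k)| =
      |c k| * ∏ j, ‖(t k : ℂ) + x * ρ k - a j k‖ := by
    intro k x
    rw [← Real.norm_eq_abs, ← Complex.norm_real, hP, norm_mul, Complex.norm_real, norm_prod,
      Real.norm_eq_abs]
    push_cast
    rfl
  have hall : ∀ᶠ k in atTop, 0 < ρ k ∧ 0 < s k ∧ ∀ j,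
      (j ∈ L → ‖(t k : ℂ) - a j k‖ ≤ R * ρ k) ∧
      (j ∉ L → 2 * (s k * ρ k) ≤ ‖(t k : ℂ) - a j k‖) := by
    refine hρ.and ((hs.eventually_gt_atTop 0).and (eventually_all.2 fun j => ?_))
    by_cases hj : j ∈ L
    · filter_upwards [hR j hj] with k hk
      exact ⟨fun _ => hk, fun h => absurd hj h⟩
    · filter_upwards [hL' j hj] with k hk
      exact ⟨fun h => absurd h hj, fun _ => hk⟩
  have hxρ : ∀ k x, 0 < ρ k → ‖((x : ℝ) : ℂ) * ρ k‖ = |x| * ρ k := by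
    intro k x h
    rw [norm_mul, Complex.norm_real, Complex.norm_real, Real.norm_eq_abs, Real.norm_of_nonneg h.le]
  have hupper : ∀ᶠ k in atTop, ∀ x, |x| < s k → |P k (t k + x * ρ k)| ≤ b k * ∏ j, u x j := by
    filter_upwards [hall] with k ⟨hρk, hsk, hk⟩ x hx
    rw [habs, mul_assoc, ← Finset.prod_mul_distrib]
    gcongr with j
    have h1 : ‖(t k : ℂ) + x * ρ k - a j k‖ ≤ ‖(t k : ℂ) - a j k‖ + |x| * ρ k := by
      rw [← hxρ k x hρk, add_sub_right_comm]
      exact norm_add_le _ _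
    refine h1.trans ?_
    by_cases hj : j ∈ L
    · simp only [G, u, if_pos hj]
      nlinarith [(hk j).1 hj]
    · simp only [G, u, if_neg hj]
      nlinarith [(hk j).2 hj]
  have hlower : ∀ᶠ k in atTop, ∀ x, R ≤ |x| → |x| < s k →
      b k * ∏ j, v x j ≤ |P k (t k + x * ρ k)| := by
    filter_upwards [hall] with k ⟨hρk, hsk, hk⟩ x hRx hx
    rw [habs, mul_assoc, ← Finset.prod_mul_distrib]
    have hG0 : ∀ j, 0 ≤ G j k := by
      intro j
      by_cases hj : j ∈ L
      · simp only [G, if_pos hj]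
        exact hρk.le
      · simp only [G, if_neg hj]
        exact norm_nonneg _
    have hv0 : ∀ j, 0 ≤ v x j := by
      intro j
      by_cases hj : j ∈ L
      · simp only [v, if_pos hj]
        linarith
      · simp only [v, if_neg hj]
        norm_num
    refine mul_le_mul_of_nonneg_left (Finset.prod_le_prod
      (fun j _ => mul_nonneg (hG0 j) (hv0 j)) fun j _ => ?_) (abs_nonneg _)
    have h1 : ‖(t k : ℂ) - a j k‖ - |x| * ρ k ≤ ‖(t k : ℂ) + x * ρ k - a j k‖ := by
      have := norm_sub_le ((t k : ℂ) + x * ρ k - a j k) ((x : ℂ) * ρ k)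
      rw [hxρ k x hρk] at this
      have e : (t k : ℂ) + x * ρ k - a j k - x * ρ k = t k - a j k := by ring
      rw [e] at this
      linarith
    have h2 : |x| * ρ k - ‖(t k : ℂ) - a j k‖ ≤ ‖(t k : ℂ) + x * ρ k - a j k‖ := by
      have := norm_sub_le ((t k : ℂ) + x * ρ k - a j k) ((t k : ℂ) - a j k)
      have e : (t k : ℂ) + x * ρ k - a j k - (t k - a j k) = x * ρ k := by ring
      rw [e, hxρ k x hρk] at this
      linarith
    by_cases hj : j ∈ L
    · simp only [G, v, if_pos hj]
      nlinarith [(hk j).1 hj]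
    · simp only [G, v, if_neg hj]
      nlinarith [(hk j).2 hj]
  have hu0 : ∀ x, 0 < ∏ j, u x j := by
    intro x
    refine Finset.prod_pos fun j _ => ?_
    by_cases hj : j ∈ L
    · simp only [u, if_pos hj]
      positivity
    · simp only [u, if_neg hj]
      norm_num
  -- `b k` stays away from zero, since `Q` is not identically zero.
  obtain ⟨x₀, hx₀⟩ := hunb 0
  obtain ⟨δ, hδ, hbδ⟩ : ∃ δ > 0, ∀ᶠ k in atTop, δ ≤ b k := by
    refine ⟨|Q x₀| / 2 / ∏ j, u x₀ j, by have := hu0 x₀; positivity, ?_⟩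
    have h1 := (hQ x₀).abs.eventually (eventually_ge_nhds (half_lt_self hx₀))
    filter_upwards [h1, hupper, hs.eventually_gt_atTop |x₀|] with k h1 h2 h3
    rw [div_le_iff₀ (hu0 x₀)]
    exact h1.trans (h2 x₀ h3)
  -- If all roots were distant, then `Q` would be bounded.
  have hne : L.Nonempty := by
    rw [Set.nonempty_iff_ne_empty]
    rintro rfl
    obtain ⟨x₁, hx₁⟩ := hunb (2 ^ d * (2 ^ d * |Q R|))
    refine absurd hx₁ (not_lt.2 ?_)
    refine le_of_tendsto_of_tendsto (hQ x₁).abs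
      (((hQ R).abs.const_mul (2 ^ d : ℝ)).const_mul (2 ^ d : ℝ)) ?_
    filter_upwards [hupper, hlower, hs.eventually_gt_atTop |x₁|, hs.eventually_gt_atTop |R|]
      with k h1 h2 h3 h4
    have h5 := h1 x₁ h3
    have h6 := h2 R (le_abs_self R) h4
    simp only [u, v, Set.mem_empty_iff_false, if_false, Finset.prod_const, Finset.card_univ,
      Fintype.card_fin] at h5 h6
    rw [one_div, inv_pow, ← div_eq_mul_inv, div_le_iff₀ (by positivity)] at h6
    calc _ ≤ b k * 2 ^ d := h5
      _ ≤ (|P k (t k + R * ρ k)| * 2 ^ d) * 2 ^ d := by gcongr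
      _ = _ := by ring
  -- One root near `t_k` is enough for linear growth of the lower bound.
  obtain ⟨j₀, hj₀⟩ := hne
  have hv : ∀ x, R + 1 ≤ |x| → (|x| - R) * (1 / 2) ^ d ≤ ∏ j, v x j := by
    intro x hx
    have h1 : ∀ j, 1 / 2 ≤ v x j := by
      intro j
      by_cases hj : j ∈ L
      · simp only [v, if_pos hj]
        linarith
      · simp only [v, if_neg hj]
        exact le_rfl
    have h2 : v x j₀ = |x| - R := by simp only [v, if_pos hj₀]
    rw [← Finset.mul_prod_erase _ _ (Finset.mem_univ j₀), h2]
    have h3 : (1 / 2 : ℝ) ^ d ≤ ∏ j ∈ Finset.univ.erase j₀, v x j := by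
      calc (1 / 2 : ℝ) ^ d ≤ (1 / 2 : ℝ) ^ (Finset.univ.erase j₀).card := by
            refine pow_le_pow_of_le_one (by norm_num) (by norm_num) ?_
            exact (Finset.card_le_univ _).trans (by simp)
        _ = ∏ j ∈ Finset.univ.erase j₀, (1 / 2 : ℝ) := by rw [Finset.prod_const]
        _ ≤ _ := Finset.prod_le_prod (fun _ _ => by norm_num) fun j _ => h1 j
    exact mul_le_mul_of_nonneg_left h3 (by linarith)
  refine ⟨R + 1 + |B| * 2 ^ d / δ, ?_⟩
  filter_upwards [hlower, hbδ] with k h1 h2 x hx hxs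
  have hX : 0 ≤ |B| * 2 ^ d / δ := by positivity
  refine le_trans ?_ (h1 x (by linarith) hxs)
  have h3 := hv x (by linarith)
  calc B ≤ |B| := le_abs_self B
    _ = δ * (|B| * 2 ^ d / δ * (1 / 2) ^ d) := by
        rw [one_div, inv_pow]
        field_simp
    _ ≤ δ * ((|x| - R) * (1 / 2) ^ d) := by
        gcongr
        linarith
    _ ≤ b k * ∏ j, v x j := by
        refine mul_le_mul h2 h3 ?_ (hδ.le.trans h2)
        refine mul_nonneg ?_ (by positivity)
        linarith

/-! ### Test functions along the orbits -/

section Orbits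

variable {N : ℕ} [Fact (3 ≤ N)]

theorem exists_eq_zero_of_le_top {h : V N → ℂ} (hc : HasCompactSupport h) :
    ∃ B > 0, ∀ ξ : V N, B ≤ |ξ (top N)| → h ξ = 0 := by
  obtain ⟨R, hR0, hR⟩ := hc.exists_pos_le_norm
  exact ⟨R, hR0, fun ξ hξ => hR ξ (hξ.trans (norm_le_pi_norm ξ (top N)))⟩

theorem exists_le_abs_eval {p : Polynomial ℝ} (hp : 0 < p.degree) (B : ℝ) :
    ∃ X, ∀ x : ℝ, X ≤ |x| → B ≤ |p.eval x| := by
  have h := (p.tendsto_norm_atTop hp (l := comap (fun x : ℝ => |x|) atTop) (z := id)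
    tendsto_comap).eventually_ge_atTop B
  rw [Filter.Eventually, mem_comap] at h
  obtain ⟨t, ht, hts⟩ := h
  obtain ⟨X, hX⟩ := mem_atTop_sets.1 ht
  exact ⟨X, fun x hx => hts (hX _ hx)⟩

theorem exists_lt_abs_eval {p : Polynomial ℝ} (hp : 0 < p.degree) (B : ℝ) :
    ∃ x : ℝ, B < |p.eval x| := by
  obtain ⟨X, hX⟩ := exists_le_abs_eval hp (B + 1)
  exact ⟨X, by linarith [hX X (le_abs_self X)]⟩

/-- Along the orbit of a non-character, a function with compact support has compact support. -/
theorem hasCompactSupport_comp_coact {h : V N → ℂ} (hc : HasCompactSupport h) {l : V N}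
    (hl : ¬ IsCharacter l) : HasCompactSupport fun x => h (coact x l) := by
  obtain ⟨B, -, hB⟩ := exists_eq_zero_of_le_top hc
  obtain ⟨X, hX⟩ := exists_le_abs_eval (degree_hatPoly_pos hl) B
  refine HasCompactSupport.intro (isCompact_closedBall (0 : ℝ) X) fun x hx => hB _ ?_
  rw [mem_closedBall_zero_iff, not_le] at hx
  have := hX x hx.le
  rwa [eval_hatPoly] at this

theorem not_isCharacter_of_isGen {l : V N} (hl : IsGen l) : ¬ IsCharacter l := by
  obtain ⟨j, hj, h1, -, -⟩ := hl
  intro h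
  refine h1 (h _ fun h2 => ?_)
  have h3 : j = N - 2 := congrArg Fin.val h2
  omega

/-- Each non-character is on the orbit of an element of `S_N^gen`. -/
theorem exists_coact_isGen {l : V N} (hl : ¬ IsCharacter l) :
    ∃ (r : ℝ) (l₀ : Sgen N), coact r l₀.1 = l := by
  classical
  have hex : ∃ j : ℕ, ∃ hj : j < N - 1, l ⟨j, hj⟩ ≠ 0 := by
    unfold IsCharacter at hl
    push Not at hl
    obtain ⟨i, -, hi⟩ := hl
    exact ⟨i, i.isLt, hi⟩
  obtain ⟨hj, hlj⟩ := Nat.find_spec hex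
  have hmin : ∀ k : Fin (N - 1), (k : ℕ) < Nat.find hex → l k = 0 := by
    intro k hk
    by_contra h
    exact Nat.find_min hex hk ⟨k.isLt, h⟩
  set j := Nat.find hex
  have hj1 : j + 1 < N - 1 := by
    unfold IsCharacter at hl
    push Not at hl
    obtain ⟨i, hi, hli⟩ := hl
    have h1 : j ≤ i := Nat.find_min' hex ⟨i.isLt, hli⟩
    have h2 := i.isLt
    have h3 : (i : ℕ) ≠ N - 2 := fun h => hi (Fin.ext h)
    omega
  let r : ℝ := l ⟨j + 1, hj1⟩ / l ⟨j, hj⟩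
  have hlow : ∀ k : Fin (N - 1), (k : ℕ) ≤ j → coact r l k = l k := by
    intro k hk
    unfold coact
    rw [Finset.sum_eq_single k]
    · simp
    · intro i hi hik
      have h1 : i ≤ k := by simpa using hi
      have h2 : i < k := lt_of_le_of_ne h1 hik
      have h3 : (i : ℕ) < (k : ℕ) := h2
      rw [hmin i (by omega), mul_zero]
    · simp
  have hgen : IsGen (coact r l) := by
    refine ⟨j, hj1, ?_, ?_, ?_⟩
    · rw [hlow _ le_rfl]
      exact hlj
    · unfold coact
      have hne : (⟨j, hj⟩ : Fin (N - 1)) ≠ ⟨j + 1, hj1⟩ := by simp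
      rw [← Finset.sum_subset (s₁ := {⟨j, hj⟩, ⟨j + 1, hj1⟩}), Finset.sum_pair hne]
      · have hr : r * l ⟨j, hj⟩ = l ⟨j + 1, hj1⟩ := div_mul_cancel₀ _ hlj
        simp [hr]
      · intro i hi
        simp only [Finset.mem_insert, Finset.mem_singleton] at hi
        rcases hi with rfl | rfl <;> simp [Fin.le_def]
      · intro i hi hi'
        have h1 : (i : ℕ) ≤ j + 1 := by simpa [Fin.le_def] using hi
        have h2 : (i : ℕ) ≠ j := fun h => hi' (by simp [Fin.ext_iff, h])
        have h3 : (i : ℕ) ≠ j + 1 := fun h => hi' (by simp [Fin.ext_iff, h])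
        rw [hmin i (by omega), mul_zero]
    · intro k hk
      rw [hlow k hk.le, hmin k hk]
  refine ⟨-r, ⟨_, hgen⟩, ?_⟩
  rw [coact_coact, neg_add_cancel, coact_zero]

/-- Convergence of the parameter implies uniform convergence on bounded intervals. -/
theorem eventually_norm_sub_le_of_isCompact {β : Type*} [TopologicalSpace β] {f : β → ℝ → ℂ}
    (hf : Continuous f.uncurry) {y : ℕ → β} {y₀ : β} (hy : Tendsto y atTop (𝓝 y₀)) (X : ℝ)
    {ε : ℝ} (hε : 0 < ε) : ∀ᶠ k in atTop, ∀ x, |x| ≤ X → ‖f (y k) x - f y₀ x‖ ≤ ε := by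
  obtain ⟨v, hv, hfv⟩ := (isCompact_closedBall (0 : ℝ) X).mem_uniformity_of_prod (s := Set.univ)
    (f := f) hf.continuousOn (Set.mem_univ y₀) (Metric.dist_mem_uniformity hε)
  rw [nhdsWithin_univ] at hv
  filter_upwards [hy hv] with k hk x hx
  have := hfv _ hk x (by rwa [mem_closedBall_zero_iff])
  rw [← dist_eq_norm]
  exact le_of_lt this

theorem eventually_two_mul_le {s δ : ℕ → ℝ} (hδ : Tendsto δ atTop atTop)
    (h : Tendsto (fun k => s k / δ k) atTop (𝓝 0)) : ∀ᶠ k in atTop, 2 * s k ≤ δ k := by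
  filter_upwards [h.eventually (eventually_le_nhds (by norm_num : (0 : ℝ) < 1 / 2)),
    hδ.eventually_gt_atTop 0] with k h1 h2
  rw [div_le_iff₀ h2] at h1
  linarith

namespace Data

variable {D : Data N} {l : ℕ → Sgen N} {s : ℕ → ℝ}

theorem rho_of_mem (D : Data N) {i : Fin D.m} (hi : i ∈ D.C) (k : ℕ) :
    D.rho i k = D.dist i (D.near i) k := if_pos hi

theorem rho_of_not_mem (D : Data N) {i : Fin D.m} (hi : i ∉ D.C) (k : ℕ) : D.rho i k = 1 :=
  if_neg hi

theorem IsPerfect.tendsto_rho (hD : D.IsPerfect l) {i : Fin D.m} (hi : i ∈ D.C) :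
    Tendsto (D.rho i) atTop atTop :=
  (hD.dist_tendsto i hi (D.near i)).congr fun k => (D.rho_of_mem hi k).symm

theorem IsPerfect.rho_pos (hD : D.IsPerfect l) (i : Fin D.m) : ∀ᶠ k in atTop, 0 < D.rho i k := by
  by_cases hi : i ∈ D.C
  · exact (hD.tendsto_rho hi).eventually_gt_atTop 0
  · exact Eventually.of_forall fun k => by rw [D.rho_of_not_mem hi]; exact one_pos

theorem IsPerfect.near_mem (hD : D.IsPerfect l) {i : Fin D.m} (hi : i ∈ D.C) :
    D.near i ∈ D.L i := by
  by_contra h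
  have h1 := (hD.ratio_not_mem i hi _ h).eventually_gt_atTop 1
  obtain ⟨k, hk, hk'⟩ := (h1.and (hD.rho_pos i)).exists
  rw [D.rho_of_mem hi] at hk hk'
  rw [div_self hk'.ne'] at hk
  exact lt_irrefl _ hk

theorem IsPerfect.degree_p_pos (hD : D.IsPerfect l) {i : Fin D.m} (hi : i ∈ D.C) :
    0 < (D.p i).degree := by
  rw [← Polynomial.natDegree_pos_iff_degree_pos, hD.degree_p i hi]
  exact Finset.card_pos.2 ⟨_, hD.near_mem hi⟩

/-- The generic condition for test functions on `V`.  On a bounded interval the convergence is a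
matter of continuity, and outside of it both functions vanish. -/
theorem IsPerfect.eventually_generic (hD : D.IsPerfect l) (hs : D.IsAdapted s) {i : Fin D.m}
    (hi : i ∉ D.C) {h : V N → ℂ} (hh : Continuous h) (hc : HasCompactSupport h) {ε : ℝ}
    (hε : 0 < ε) : ∀ᶠ k in atTop, ∀ x, |x| < s k →
      ‖h (coact (x + D.t i k) (l k).1) - h (coact x (D.lim i))‖ ≤ ε := by
  obtain ⟨B, -, hB⟩ := exists_eq_zero_of_le_top hc
  have hdeg := degree_hatPoly_pos (l := D.lim i) hi
  obtain ⟨X₁, hX₁⟩ := exists_le_abs_eval hdeg B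
  obtain ⟨X₂, hX₂⟩ := eventually_le_abs_of_roots (P := fun k => hat (l k).1) hD.factor
    (t := D.t i) (ρ := fun _ => 1) (L := (D.J i)ᶜ) (Q := hat (D.lim i))
    (Eventually.of_forall fun _ => one_pos) hs.tendsto_atTop
    (fun j hj => by
      obtain ⟨R, hR⟩ := hD.bounded_of_not_mem_J i hi j hj
      exact ⟨R, Eventually.of_forall fun k => by rw [mul_one]; exact hR k⟩)
    (fun j hj => by
      have hj' : j ∈ D.J i := not_not.1 hj
      filter_upwards [eventually_two_mul_le hj' (hs.gen i hi j hj')] with k hk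
      rw [mul_one]
      exact hk)
    (fun x => by
      have hcont : Continuous fun l : V N => hat l x := continuous_hat.comp
        (Continuous.prodMk_right x)
      refine ((hcont.tendsto _).comp (hD.tendsto_lim i)).congr fun k => ?_
      simp only [Function.comp_apply, hat_coact, mul_one]
      rw [add_comm])
    (fun B => by
      obtain ⟨x, hx⟩ := exists_lt_abs_eval hdeg B
      rw [eval_hatPoly] at hx
      exact ⟨x, hx⟩) B
  have hf : Continuous (Function.uncurry fun (ξ : V N) (x : ℝ) => h (coact x ξ)) :=
    hh.comp (continuous_coact.comp continuous_swap)
  filter_upwards [hX₂, eventually_norm_sub_le_of_isCompact hf (hD.tendsto_lim i) (max X₁ X₂) hε]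
    with k h1 h2 x hx
  rcases le_total |x| (max X₁ X₂) with hxX | hxX
  · have := h2 x hxX
    rwa [coact_coact] at this
  · have e1 : h (coact (x + D.t i k) (l k).1) = 0 := by
      refine hB _ ?_
      have := h1 x ((le_max_right _ _).trans hxX) hx
      rwa [mul_one, add_comm] at this
    have e2 : h (coact x (D.lim i)) = 0 := by
      refine hB _ ?_
      have := hX₁ x ((le_max_left _ _).trans hxX)
      rwa [eval_hatPoly] at this
    rw [e1, e2, sub_zero, norm_zero]
    exact hε.le

/-- The character condition for test functions on `V`.  In the variable `z = x / ρ_i^k` the proof is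
that of the generic condition. -/
theorem IsPerfect.eventually_character (hD : D.IsPerfect l) (hs : D.IsAdapted s) {i : Fin D.m}
    (hi : i ∈ D.C) {h : V N → ℂ} (hh : Continuous h) (hc : HasCompactSupport h) {ε : ℝ}
    (hε : 0 < ε) : ∀ᶠ k in atTop, ∀ x, |x| < s k * D.rho i k →
      ‖h (coact (x + D.t i k) (l k).1) -
        h (Pi.single (top N) ((D.p i).eval (x / D.rho i k)))‖ ≤ ε := by
  obtain ⟨B, -, hB⟩ := exists_eq_zero_of_le_top hc
  have hdeg := hD.degree_p_pos hi
  obtain ⟨X₁, hX₁⟩ := exists_le_abs_eval hdeg B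
  have hQ : ∀ x, Tendsto (fun k => hat (l k).1 (D.t i k + x * D.rho i k)) atTop
      (𝓝 ((D.p i).eval x)) := by
    intro x
    simpa using (tendstoLocallyUniformlyOn_univ.2 (hD.scaled i hi x)).tendsto_at (Set.mem_univ 0)
  obtain ⟨X₂, hX₂⟩ := eventually_le_abs_of_roots (P := fun k => hat (l k).1) hD.factor
    (t := D.t i) (ρ := D.rho i) (L := D.L i) (Q := fun x => (D.p i).eval x)
    (hD.rho_pos i) hs.tendsto_atTop
    (fun j hj => by
      obtain ⟨R, hR⟩ := hD.ratio_mem i hi j hj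
      refine ⟨R + 1, ?_⟩
      filter_upwards [hR.eventually (eventually_le_nhds (lt_add_one R)), hD.rho_pos i]
        with k h1 h2
      rwa [div_le_iff₀ h2] at h1)
    (fun j hj => eventually_two_mul_le (hD.dist_tendsto i hi j) (hs.char i hi j hj))
    hQ (exists_lt_abs_eval hdeg) B
  -- The dilated functionals converge in `V`, and undoing the dilation amounts to applying
  -- `scale (ρ_i^k)⁻¹`, which tends to the projection to the characters.
  obtain ⟨ξ, hξ, hξp⟩ := exists_tendsto_of_hat
    (η := fun k => scale (D.rho i k) (coact (D.t i k) (l k).1)) (Q := fun x => (D.p i).eval x)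
    (fun x => by
      refine (hQ x).congr' ?_
      filter_upwards [hD.rho_pos i] with k hk
      rw [hat_scale x hk.ne', hat_coact, add_comm])
  have hf : Continuous (Function.uncurry fun (y : ℝ × V N) (x : ℝ) =>
      h (scale y.1 (coact x y.2))) := by
    have h1 : Continuous fun q : (ℝ × V N) × ℝ => (q.2, q.1.2) := by fun_prop
    have h2 : Continuous fun q : (ℝ × V N) × ℝ => (q.1.1, coact q.2 q.1.2) :=
      (continuous_fst.comp continuous_fst).prodMk (continuous_coact.comp h1)
    exact hh.comp (continuous_scale.comp h2)
  have hy : Tendsto (fun k => ((D.rho i k)⁻¹, scale (D.rho i k) (coact (D.t i k) (l k).1))) atTop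
      (𝓝 ((0 : ℝ), ξ)) :=
    (tendsto_inv_atTop_zero.comp (hD.tendsto_rho hi)).prodMk_nhds hξ
  filter_upwards [hX₂, eventually_norm_sub_le_of_isCompact hf hy (max X₁ X₂) hε, hD.rho_pos i]
    with k h1 h2 hk x hx
  obtain ⟨z, rfl⟩ : ∃ z, x = z * D.rho i k := ⟨x / D.rho i k, by field_simp⟩
  rw [mul_div_cancel_right₀ _ hk.ne']
  rw [abs_mul, abs_of_pos hk, mul_lt_mul_iff_left₀ hk] at hx
  rcases le_total |z| (max X₁ X₂) with hzX | hzX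
  · have : ‖h (scale (D.rho i k)⁻¹ (coact z (scale (D.rho i k) (coact (D.t i k) (l k).1)))) -
        h (scale 0 (coact z ξ))‖ ≤ ε := h2 z hzX
    rw [← coact_mul z hk.ne', coact_coact, scale_zero] at this
    have e : coact z ξ (top N) = (D.p i).eval z := hξp z
    rwa [e] at this
  · have e1 : h (coact (z * D.rho i k + D.t i k) (l k).1) = 0 := by
      refine hB _ ?_
      have := h1 z ((le_max_right _ _).trans hzX) hx
      rwa [add_comm] at this
    have e2 : h (Pi.single (top N) ((D.p i).eval z)) = 0 := by
      refine hB _ ?_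
      rw [Pi.single_eq_same]
      exact hX₁ z ((le_max_left _ _).trans hzX)
    rw [e1, e2, sub_zero, norm_zero]
    exact hε.le

/-- The infinity condition for test functions on `V`: points `r_k ∈ T_k` with `r_k · ℓ_k` in the
support of `h` would have a limit along a subsequence, in contradiction to maximality. -/
theorem IsPerfect.eventually_infinity (hD : D.IsPerfect l) (hs : D.IsAdapted s) {h : V N → ℂ}
    (hc : HasCompactSupport h) : ∀ᶠ k in atTop, ∀ x ∈ D.T s k, h (coact x (l k).1) = 0 := by
  by_contra hcon
  rw [not_eventually] at hcon
  obtain ⟨ψ, hψ, hψ'⟩ := extraction_of_frequently_atTop hcon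
  push Not at hψ'
  choose r hrT hr using hψ'
  obtain ⟨ξ, -, φ₀, hφ₀, hξ⟩ := hc.isCompact.tendsto_subseq
    (x := fun n => coact (r n) (l (ψ n)).1) fun n => subset_tsupport h (hr n)
  have hfar : ∀ i n, s (ψ n) * D.rho i (ψ n) < |r n - D.t i (ψ n)| := by
    intro i n
    have h1 := hrT n
    simp only [Data.T, Set.mem_compl_iff, Set.mem_iUnion, not_exists, Set.mem_Icc] at h1
    by_contra h2
    rw [not_lt, abs_le] at h2
    exact h1 i ⟨by linarith [h2.1], by linarith [h2.2]⟩
  by_cases hch : IsCharacter ξ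
  · obtain ⟨φ, hφ, i, hi, ⟨j, hj, y, hy⟩, -⟩ := hD.maximal_char (ψ ∘ φ₀) (hψ.comp hφ₀)
      (r ∘ φ₀) ξ hξ hch
    obtain ⟨R, hR⟩ := hD.ratio_mem i hi j hj
    have hsub : Tendsto (fun n => ψ (φ₀ (φ n))) atTop atTop :=
      (hψ.comp (hφ₀.comp hφ)).tendsto_atTop
    have h1 := hy.eventually (eventually_le_nhds (lt_add_one y))
    have h2 := hsub.eventually (hR.eventually (eventually_le_nhds (lt_add_one R)))
    have h3 := hsub.eventually (hD.rho_pos i)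
    have h4 := hsub.eventually ((hD.dist_tendsto i hi j).eventually_gt_atTop 0)
    have h5 := hsub.eventually
      (hs.tendsto_atTop.eventually_gt_atTop (max (y + 2) 0 * max (R + 1) 0))
    obtain ⟨n, h1, h2, h3, h4, h5⟩ := (h1.and (h2.and (h3.and (h4.and h5)))).exists
    have h6 := hfar i (φ₀ (φ n))
    simp only [Function.comp_apply] at h1
    rw [div_le_iff₀ h4] at h1
    rw [div_le_iff₀ h3] at h2
    set K := ψ (φ₀ (φ n))
    have h7 : |r (φ₀ (φ n)) - D.t i K| ≤ ‖(r (φ₀ (φ n)) : ℂ) - D.root j K‖ + D.dist i j K := by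
      rw [← Real.norm_eq_abs, ← Complex.norm_real]
      push_cast
      have := norm_sub_le ((r (φ₀ (φ n)) : ℂ) - D.root j K) (D.t i K - D.root j K)
      rwa [sub_sub_sub_cancel_right] at this
    have h8 : |r (φ₀ (φ n)) - D.t i K| ≤ max (y + 2) 0 * (max (R + 1) 0 * D.rho i K) := by
      calc _ ≤ (y + 1) * D.dist i j K + D.dist i j K := h7.trans (by gcongr)
        _ = (y + 2) * D.dist i j K := by ring
        _ ≤ max (y + 2) 0 * (max (R + 1) 0 * D.rho i K) := by
            refine mul_le_mul (le_max_left _ _) (h2.trans ?_) h4.le (le_max_right _ _)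
            gcongr
            exact le_max_left _ _
    have h9 := mul_lt_mul_of_pos_right h5 h3
    linarith
  · obtain ⟨φ, hφ, i, hi, R, hR⟩ := hD.maximal_gen (ψ ∘ φ₀) (hψ.comp hφ₀) (r ∘ φ₀) ξ hξ hch
    have hsub : Tendsto (fun n => ψ (φ₀ (φ n))) atTop atTop :=
      (hψ.comp (hφ₀.comp hφ)).tendsto_atTop
    obtain ⟨n, hn⟩ := (hsub.eventually (hs.tendsto_atTop.eventually_gt_atTop R)).exists
    have h1 := hfar i (φ₀ (φ n))
    have h2 := hR n
    rw [D.rho_of_not_mem hi, mul_one] at h1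
    simp only [Function.comp_apply] at h2
    linarith

end Data

end Orbits

/-! ### Plancherel's theorem -/

section Plancherel

variable {f : ℝ → ℂ}

/-- The Fourier transform is its own transpose. -/
theorem integral_fourier_mul_schwartz (hf : Integrable f volume) (G : 𝓢(ℝ, ℂ)) :
    ∫ x, 𝓕 (G : ℝ → ℂ) x • f x = ∫ x, G x • 𝓕 f x := by
  simpa using! VectorFourier.integral_fourierIntegral_smul_eq_flip (L := innerₗ ℝ)
    (f := (G : ℝ → ℂ)) (g := f) (μ := volume) (ν := volume)
    Real.continuous_fourierChar continuous_inner G.integrable hf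

theorem continuous_fourier (hf : Integrable f volume) : Continuous (𝓕 f) :=
  VectorFourier.fourierIntegral_continuous Real.continuous_fourierChar
    (by exact continuous_inner) hf

/-- The Fourier transform of `L²(ℝ)` is given by the integral on `L¹ ∩ L²`. -/
theorem coeFn_fourier_toLp (h1 : Integrable f volume) (h2 : MemLp f 2 volume) :
    ((𝓕 (h2.toLp f) : L2) : ℝ → ℂ) =ᵐ[volume] 𝓕 f := by
  refine ae_eq_of_integral_contDiff_smul_eq
    ((Lp.memLp (𝓕 (h2.toLp f) : L2)).locallyIntegrable one_le_two)
    (continuous_fourier h1).locallyIntegrable fun g hg hgc => ?_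
  have hGc : HasCompactSupport fun x => (g x : ℂ) := hgc.comp_left Complex.ofReal_zero
  have hGd : ContDiff ℝ ∞ fun x => (g x : ℂ) := Complex.ofRealCLM.contDiff.comp hg
  have h3 := DFunLike.congr_fun (Lp.fourier_toTemperedDistribution_eq (h2.toLp f))
    (hGc.toSchwartzMap hGd)
  rw [TemperedDistribution.fourier_apply, Lp.toTemperedDistribution_apply,
    Lp.toTemperedDistribution_apply] at h3
  have h4 : ∫ x, (𝓕 (hGc.toSchwartzMap hGd)) x • (h2.toLp f : ℝ → ℂ) x =
      ∫ x, 𝓕 (hGc.toSchwartzMap hGd : ℝ → ℂ) x • f x := by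
    refine integral_congr_ae ?_
    filter_upwards [h2.coeFn_toLp] with x hx
    rw [hx, SchwartzMap.fourier_coe]
  rw [h4, integral_fourier_mul_schwartz h1] at h3
  exact h3.symm

theorem eLpNorm_fourier (h1 : Integrable f volume) (h2 : MemLp f 2 volume) :
    eLpNorm (𝓕 f) 2 volume = eLpNorm f 2 volume := by
  have h3 := Lp.norm_fourier_eq (h2.toLp f)
  rw [← eLpNorm_congr_ae (coeFn_fourier_toLp h1 h2), ← eLpNorm_congr_ae h2.coeFn_toLp,
    ← Lp.enorm_def, ← Lp.enorm_def, ← ofReal_norm, ← ofReal_norm, h3]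

theorem sq_eLpNorm_two {α E : Type*} [MeasurableSpace α] [NormedAddCommGroup E] (μ : Measure α)
    (f : α → E) : eLpNorm f 2 μ ^ 2 = ∫⁻ x, ‖f x‖ₑ ^ 2 ∂μ := by
  have := eLpNorm_nnreal_pow_eq_lintegral (f := f) (μ := μ) (p := 2) two_ne_zero
  simpa using! this

theorem lintegral_sq_fourier (h1 : Integrable f volume) (h2 : MemLp f 2 volume) :
    ∫⁻ x, ‖𝓕 f x‖ₑ ^ 2 = ∫⁻ x, ‖f x‖ₑ ^ 2 := by
  rw [← sq_eLpNorm_two, ← sq_eLpNorm_two, eLpNorm_fourier h1 h2]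

end Plancherel

/-! ### The coefficients with respect to the waves -/

section Wave

variable {η : ℝ → ℂ} {s ρ : ℝ} {p : Polynomial ℝ}

/-- The amplitude `x ↦ η(s p(x / ρ) + s b)` of the waves with parameter `(a, b)`. -/
def amp (η : ℝ → ℂ) (s ρ : ℝ) (p : Polynomial ℝ) (b x : ℝ) : ℂ :=
  η (s * p.eval (x / ρ) + s * b)

theorem continuous_amp (hη : Continuous η) :
    Continuous fun q : ℝ × ℝ => amp η s ρ p q.1 q.2 := by
  unfold amp
  have : Continuous fun q : ℝ × ℝ => p.eval (q.2 / ρ) := p.continuous.comp (by fun_prop)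
  fun_prop

theorem continuous_amp_right (hη : Continuous η) (b : ℝ) : Continuous (amp η s ρ p b) := by
  exact (continuous_amp (s := s) (ρ := ρ) (p := p) hη).comp
    ((continuous_const (y := b)).prodMk continuous_id)

theorem hasCompactSupport_of_abs {g : ℝ → ℂ} {X : ℝ} (h : ∀ x, X ≤ |x| → g x = 0) :
    HasCompactSupport g := by
  refine HasCompactSupport.intro (isCompact_closedBall (0 : ℝ) X) fun x hx => h x ?_
  rw [mem_closedBall_zero_iff, not_le] at hx
  exact hx.le

/-- For `b` in a bounded set the amplitudes vanish outside of a common compact set. -/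
theorem exists_amp_eq_zero (hηc : HasCompactSupport η) (hs : 0 < s) (hρ : 0 < ρ)
    (hp : 0 < p.degree) (R : ℝ) :
    ∃ X, ∀ b x, |b| ≤ R → X ≤ |x| → amp η s ρ p b x = 0 := by
  obtain ⟨B, -, hB⟩ := hηc.exists_pos_le_norm
  obtain ⟨X, hX⟩ := exists_le_abs_eval hp (B / s + R)
  refine ⟨X * ρ, fun b x hb hx => hB _ ?_⟩
  have h1 : X ≤ |x / ρ| := by
    rwa [abs_div, abs_of_pos hρ, le_div_iff₀ hρ]
  have h2 := hX _ h1
  have h3 : |p.eval (x / ρ)| - |b| ≤ |p.eval (x / ρ) + b| := by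
    have := abs_sub_abs_le_abs_sub (p.eval (x / ρ)) (-b)
    rwa [abs_neg, sub_neg_eq_add] at this
  rw [← mul_add, Real.norm_eq_abs, abs_mul, abs_of_pos hs, ← div_le_iff₀' hs]
  linarith

theorem hasCompactSupport_amp (hηc : HasCompactSupport η) (hs : 0 < s) (hρ : 0 < ρ)
    (hp : 0 < p.degree) (b : ℝ) : HasCompactSupport (amp η s ρ p b) := by
  obtain ⟨X, hX⟩ := exists_amp_eq_zero hηc hs hρ hp |b|
  exact hasCompactSupport_of_abs fun x => hX b x le_rfl

theorem memLp_amp (hη : Continuous η) (hηc : HasCompactSupport η) (hs : 0 < s) (hρ : 0 < ρ)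
    (hp : 0 < p.degree) (b : ℝ) (q : ℝ≥0∞) : MemLp (amp η s ρ p b) q volume :=
  (continuous_amp_right hη b).memLp_of_hasCompactSupport (hasCompactSupport_amp hηc hs hρ hp b)

theorem wave_eq (u : ℝ × ℝ) (x : ℝ) : wave η s ρ p u x =
    amp η s ρ p u.2 x * Complex.exp ((2 * Real.pi * u.1 * x : ℝ) * Complex.I) := rfl

theorem memLp_wave (hη : Continuous η) (hηc : HasCompactSupport η) (hs : 0 < s) (hρ : 0 < ρ)
    (hp : 0 < p.degree) (u : ℝ × ℝ) : MemLp (wave η s ρ p u) 2 volume := by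
  refine Continuous.memLp_of_hasCompactSupport ?_
    ((hasCompactSupport_amp hηc hs hρ hp u.2).mul_right)
  exact (continuous_amp_right hη u.2).mul (by fun_prop)

/-- For fixed `b` the coefficients are the Fourier transform of `ξ` times the conjugate
amplitude. -/
theorem coef_wave (u : ℝ × ℝ) (ξ : L2) : coef (wave η s ρ p u) ξ =
    𝓕 (fun x => ξ x * starRingEnd ℂ (amp η s ρ p u.2 x)) u.1 := by
  rw [Real.fourier_real_eq_integral_exp_smul]
  unfold coef
  congr 1
  funext x
  rw [wave_eq, map_mul, ← Complex.exp_conj, map_mul, Complex.conj_I, Complex.conj_ofReal,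
    smul_eq_mul]
  rw [show (((2 * Real.pi * u.1 * x : ℝ) : ℂ) * -Complex.I) =
    ((-2 * Real.pi * x * u.1 : ℝ) : ℂ) * Complex.I by push_cast; ring]
  ring

theorem integrable_mul_conj_amp (hη : Continuous η) (hηc : HasCompactSupport η) (hs : 0 < s)
    (hρ : 0 < ρ) (hp : 0 < p.degree) (b : ℝ) (ξ : L2) :
    Integrable (fun x => ξ x * starRingEnd ℂ (amp η s ρ p b x)) volume := by
  have h1 : MemLp (fun x => starRingEnd ℂ (amp η s ρ p b x)) 2 volume :=
    (memLp_amp hη hηc hs hρ hp b 2).star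
  exact memLp_one_iff_integrable.1 (MemLp.smul (p := 2) (q := 2) (r := 1) h1 (Lp.memLp ξ))

theorem memLp_mul_conj_amp (hη : Continuous η) (hηc : HasCompactSupport η) (hs : 0 < s)
    (hρ : 0 < ρ) (hp : 0 < p.degree) (b : ℝ) (ξ : L2) :
    MemLp (fun x => ξ x * starRingEnd ℂ (amp η s ρ p b x)) 2 volume := by
  have h1 : MemLp (fun x => starRingEnd ℂ (amp η s ρ p b x)) ⊤ volume :=
    (memLp_amp hη hηc hs hρ hp b ⊤).star
  exact MemLp.smul (p := 2) (q := ⊤) (r := 2) h1 (Lp.memLp ξ)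

theorem stronglyMeasurable_coef_wave (hη : Continuous η) (ξ : L2) :
    StronglyMeasurable fun u : ℝ × ℝ => coef (wave η s ρ p u) ξ := by
  unfold coef
  refine StronglyMeasurable.integral_prod_right
    (f := fun (u : ℝ × ℝ) x => ξ x * starRingEnd ℂ (wave η s ρ p u x)) ?_
  have h1 : Continuous fun q : (ℝ × ℝ) × ℝ => starRingEnd ℂ (wave η s ρ p q.1 q.2) := by
    refine RCLike.continuous_conj.comp ?_
    have h2 : Continuous fun q : (ℝ × ℝ) × ℝ => amp η s ρ p q.1.2 q.2 := by
      simpa only [Function.comp_def] using (continuous_amp (s := s) (ρ := ρ) (p := p) hη).comp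
        ((continuous_snd.comp continuous_fst).prodMk (continuous_snd (X := ℝ × ℝ) (Y := ℝ)))
    simp_rw [wave_eq]
    fun_prop
  exact ((Lp.stronglyMeasurable ξ).comp_measurable measurable_snd).mul h1.stronglyMeasurable

theorem lintegral_comp_add_mul {f : ℝ → ℝ≥0∞} (hf : Measurable f) (hs : 0 < s) (c : ℝ) :
    ∫⁻ b, f (c + s * b) = ENNReal.ofReal s⁻¹ * ∫⁻ b, f b := by
  have h1 : ∫⁻ b, f (c + s * b) = ∫⁻ b, f (c + b) ∂(Measure.map (s * ·) volume) := by
    rw [lintegral_map (by fun_prop) (by fun_prop)]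
  rw [h1, Real.map_volume_mul_left hs.ne', lintegral_smul_measure, smul_eq_mul,
    abs_of_pos (inv_pos.2 hs), lintegral_add_left_eq_self f c]

/-- The waves form a continuous tight frame: `s ∫ |⟨ξ, η(u)⟩|² du = ‖ξ‖² ‖η‖²`. -/
theorem lintegral_sq_coef_wave (hη : Continuous η) (hηc : HasCompactSupport η) (hs : 0 < s)
    (hρ : 0 < ρ) (hp : 0 < p.degree) (ξ : L2) :
    ∫⁻ u : ℝ × ℝ, ‖coef (wave η s ρ p u) ξ‖ₑ ^ 2 =
      ENNReal.ofReal s⁻¹ * (∫⁻ x, ‖η x‖ₑ ^ 2) * ‖ξ‖ₑ ^ 2 := by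
  have hm := (stronglyMeasurable_coef_wave (s := s) (ρ := ρ) (p := p) hη ξ).enorm.pow_const 2
  rw [Measure.volume_eq_prod, lintegral_prod_symm _ hm.aemeasurable]
  have h1 : ∀ b, ∫⁻ a, ‖coef (wave η s ρ p (a, b)) ξ‖ₑ ^ 2 =
      ∫⁻ x, ‖ξ x‖ₑ ^ 2 * ‖amp η s ρ p b x‖ₑ ^ 2 := by
    intro b
    simp_rw [coef_wave]
    rw [lintegral_sq_fourier (integrable_mul_conj_amp hη hηc hs hρ hp b ξ)
      (memLp_mul_conj_amp hη hηc hs hρ hp b ξ)]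
    simp_rw [enorm_mul, mul_pow, RCLike.enorm_conj]
  simp_rw [h1]
  have hξ := (Lp.stronglyMeasurable ξ).measurable
  have hm2 : Measurable (Function.uncurry fun b x => ‖ξ x‖ₑ ^ 2 * ‖amp η s ρ p b x‖ₑ ^ 2) := by
    have h2 := (continuous_amp (s := s) (ρ := ρ) (p := p) hη).measurable
    exact ((hξ.comp measurable_snd).enorm.pow_const 2).mul (h2.enorm.pow_const 2)
  rw [lintegral_lintegral_swap hm2.aemeasurable]
  have hη2 : Measurable fun x => ‖η x‖ₑ ^ 2 := hη.measurable.enorm.pow_const 2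
  have h3 : ∀ x, ∫⁻ b, ‖ξ x‖ₑ ^ 2 * ‖amp η s ρ p b x‖ₑ ^ 2 =
      ‖ξ x‖ₑ ^ 2 * (ENNReal.ofReal s⁻¹ * ∫⁻ x, ‖η x‖ₑ ^ 2) := by
    intro x
    have h4 : Measurable fun b => ‖amp η s ρ p b x‖ₑ ^ 2 := by
      unfold amp
      exact hη2.comp (by fun_prop : Measurable fun b => s * p.eval (x / ρ) + s * b)
    rw [lintegral_const_mul _ h4, ← lintegral_comp_add_mul hη2 hs (s * p.eval (x / ρ))]
    rfl
  simp_rw [h3]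
  rw [lintegral_mul_const _ (hξ.enorm.pow_const 2), mul_comm, Lp.enorm_def, sq_eLpNorm_two]

theorem lintegral_sq_enorm (hη : Continuous η) (hηc : HasCompactSupport η)
    (hη1 : ∫ x, ‖η x‖ ^ 2 = 1) : ∫⁻ x, ‖η x‖ₑ ^ 2 = 1 := by
  have h1 : Integrable (fun x => ‖η x‖ ^ 2) volume :=
    (memLp_two_iff_integrable_sq_norm hη.aestronglyMeasurable).1
      (hη.memLp_of_hasCompactSupport hηc)
  have h2 := ofReal_integral_eq_lintegral_ofReal h1 (Eventually.of_forall fun x => by positivity)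
  rw [hη1, ENNReal.ofReal_one] at h2
  rw [h2]
  refine lintegral_congr fun x => ?_
  rw [ENNReal.ofReal_pow (norm_nonneg _), ofReal_norm]

end Wave

/-! ### The operators `ν(φ)` -/

section Nu

variable {η : ℝ → ℂ} {s ρ : ℝ} {p : Polynomial ℝ}

theorem memLp_coef_wave (hη : Continuous η) (hηc : HasCompactSupport η) (hη1 : ∫ x, ‖η x‖ ^ 2 = 1)
    (hs : 0 < s) (hρ : 0 < ρ) (hp : 0 < p.degree) (ξ : L2) :
    MemLp (fun u : ℝ × ℝ => coef (wave η s ρ p u) ξ) 2 volume := by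
  refine ⟨(stronglyMeasurable_coef_wave hη ξ).aestronglyMeasurable, ?_⟩
  have h1 := sq_eLpNorm_two volume fun u : ℝ × ℝ => coef (wave η s ρ p u) ξ
  rw [lintegral_sq_coef_wave hη hηc hs hρ hp, lintegral_sq_enorm hη hηc hη1, mul_one] at h1
  refine (ENNReal.pow_lt_top_iff (n := 2) |>.1 ?_).resolve_right two_ne_zero
  rw [h1]
  exact ENNReal.mul_lt_top ENNReal.ofReal_lt_top (ENNReal.pow_lt_top enorm_lt_top)

theorem integrable_coef {w : ℝ → ℂ} (hw : MemLp w 2 volume) (ξ : L2) :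
    Integrable (fun x => ξ x * starRingEnd ℂ (w x)) volume :=
  memLp_one_iff_integrable.1 (MemLp.smul (p := 2) (q := 2) (r := 1) hw.star (Lp.memLp ξ))

theorem coef_add {w : ℝ → ℂ} (hw : MemLp w 2 volume) (ξ ξ' : L2) :
    coef w (ξ + ξ') = coef w ξ + coef w ξ' := by
  unfold coef
  rw [← integral_add (integrable_coef hw ξ) (integrable_coef hw ξ')]
  refine integral_congr_ae ?_
  filter_upwards [Lp.coeFn_add ξ ξ'] with x hx
  rw [hx, Pi.add_apply, add_mul]

theorem coef_smul (w : ℝ → ℂ) (c : ℂ) (ξ : L2) : coef w (c • ξ) = c * coef w ξ := by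
  unfold coef
  rw [← integral_const_mul]
  refine integral_congr_ae ?_
  filter_upwards [Lp.coeFn_smul c ξ] with x hx
  rw [hx, Pi.smul_apply, smul_eq_mul, mul_assoc]

/-- The coefficients with respect to the waves depend on `ξ` as a multiple of an isometry. -/
theorem exists_analysis (hη : Continuous η) (hηc : HasCompactSupport η)
    (hη1 : ∫ x, ‖η x‖ ^ 2 = 1) (hs : 0 < s) (hρ : 0 < ρ) (hp : 0 < p.degree) :
    ∃ W : L2 →L[ℂ] Lp ℂ 2 (volume : Measure (ℝ × ℝ)), ‖W‖ ≤ √s⁻¹ ∧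
      ∀ ξ, (W ξ : ℝ × ℝ → ℂ) =ᵐ[volume] fun u => coef (wave η s ρ p u) ξ := by
  have hm := memLp_coef_wave (p := p) hη hηc hη1 hs hρ hp
  have hw := memLp_wave (p := p) hη hηc hs hρ hp
  let W : L2 →ₗ[ℂ] Lp ℂ 2 (volume : Measure (ℝ × ℝ)) :=
    { toFun := fun ξ => (hm ξ).toLp _
      map_add' := fun ξ ξ' => by
        rw [← MemLp.toLp_add, MemLp.toLp_eq_toLp_iff]
        exact Eventually.of_forall fun u => coef_add (hw u) ξ ξ'
      map_smul' := fun c ξ => by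
        rw [RingHom.id_apply, ← MemLp.toLp_const_smul, MemLp.toLp_eq_toLp_iff]
        exact Eventually.of_forall fun u => coef_smul _ c ξ }
  have hW : ∀ ξ, ‖W ξ‖ ≤ √s⁻¹ * ‖ξ‖ := by
    intro ξ
    have h1 : ‖W ξ‖ₑ ^ 2 = ENNReal.ofReal s⁻¹ * ‖ξ‖ₑ ^ 2 := by
      have h0 : (W ξ : ℝ × ℝ → ℂ) =ᵐ[volume] fun u => coef (wave η s ρ p u) ξ :=
        (hm ξ).coeFn_toLp
      rw [Lp.enorm_def, eLpNorm_congr_ae h0, sq_eLpNorm_two,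
        lintegral_sq_coef_wave hη hηc hs hρ hp, lintegral_sq_enorm hη hηc hη1, mul_one]
    have h2 := congrArg ENNReal.toReal h1
    rw [ENNReal.toReal_mul, ENNReal.toReal_pow, ENNReal.toReal_pow, toReal_enorm, toReal_enorm,
      ENNReal.toReal_ofReal (inv_pos.2 hs).le] at h2
    refine (sq_le_sq₀ (norm_nonneg _) (by positivity)).1 ?_
    rw [h2, mul_pow, Real.sq_sqrt (inv_pos.2 hs).le]
  exact ⟨W.mkContinuous _ hW, W.mkContinuous_norm_le (Real.sqrt_nonneg _) hW,
    fun ξ => (hm ξ).coeFn_toLp⟩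

theorem norm_apply_le (φ : CStarR2) (u : ℝ × ℝ) : ‖φ u‖ ≤ ‖φ‖ := by
  rw [← ZeroAtInftyContinuousMap.norm_toBCF_eq_norm]
  exact φ.toBCF.norm_coe_le_norm u

theorem memLp_reflect (φ : CStarR2) :
    MemLp (fun u : ℝ × ℝ => φ (u.1, -u.2)) ⊤ (volume : Measure (ℝ × ℝ)) :=
  memLp_top_of_bound (φ.continuous.comp (by fun_prop)).aestronglyMeasurable ‖φ‖
    (Eventually.of_forall fun u => norm_apply_le φ (u.1, -u.2))

theorem norm_toLp_reflect_le (φ : CStarR2) : ‖(memLp_reflect φ).toLp _‖ ≤ ‖φ‖ := by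
  rw [Lp.norm_toLp]
  refine ENNReal.toReal_le_of_le_ofReal (norm_nonneg φ) ?_
  rw [eLpNorm_exponent_top]
  exact eLpNormEssSup_le_of_ae_bound
    (Eventually.of_forall fun u => norm_apply_le φ (u.1, -u.2))

/-- `φ ∈ C₀(ℝ²)` as the essentially bounded function `(a, b) ↦ φ(a, -b)`. -/
def reflect : CStarR2 →L[ℂ] Lp ℂ ⊤ (volume : Measure (ℝ × ℝ)) :=
  LinearMap.mkContinuous
    { toFun := fun φ => (memLp_reflect φ).toLp _
      map_add' := fun φ ψ => by
        rw [← MemLp.toLp_add, MemLp.toLp_eq_toLp_iff]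
        exact Eventually.of_forall fun u => rfl
      map_smul' := fun c φ => by
        rw [RingHom.id_apply, ← MemLp.toLp_const_smul, MemLp.toLp_eq_toLp_iff]
        exact Eventually.of_forall fun u => rfl } 1 (fun φ => by
    rw [one_mul]
    exact norm_toLp_reflect_le φ)

theorem reflect_coe (φ : CStarR2) :
    (reflect φ : ℝ × ℝ → ℂ) =ᵐ[volume] fun u => φ (u.1, -u.2) :=
  (memLp_reflect φ).coeFn_toLp

theorem norm_reflect_le (φ : CStarR2) : ‖reflect φ‖ ≤ ‖φ‖ :=
  norm_toLp_reflect_le φ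

/-- The operators `ν(φ)` exist; they depend linearly on `φ`, with norm at most `1`. -/
theorem exists_isNu (hη : Continuous η) (hηc : HasCompactSupport η)
    (hη1 : ∫ x, ‖η x‖ ^ 2 = 1) (hs : 0 < s) (hρ : 0 < ρ) (hp : 0 < p.degree) :
    ∃ ν : CStarR2 →L[ℂ] BL2, ‖ν‖ ≤ 1 ∧ ∀ φ, IsNu η s ρ p φ (ν φ) := by
  obtain ⟨W, hWn, hW⟩ := exists_analysis (p := p) hη hηc hη1 hs hρ hp
  let B : CStarR2 →L[ℂ] Lp ℂ 2 (volume : Measure (ℝ × ℝ)) →L[ℂ] Lp ℂ 2 volume :=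
    ((ContinuousLinearMap.mul ℂ ℂ).holderL volume ⊤ 2 2).comp reflect
  have hB : ∀ φ F, (B φ F : ℝ × ℝ → ℂ) =ᵐ[volume] fun u => φ (u.1, -u.2) * F u := by
    intro φ F
    filter_upwards [(ContinuousLinearMap.mul ℂ ℂ).coeFn_holder (r := 2) (reflect φ) F,
      reflect_coe φ] with u h1 h2
    have h3 : (B φ F : ℝ × ℝ → ℂ) u =
      ((ContinuousLinearMap.mul ℂ ℂ).holder 2 (reflect φ) F : ℝ × ℝ → ℂ) u := rfl
    rw [h3, h1, h2]
    rfl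
  have hBn : ∀ φ F, ‖B φ F‖ ≤ ‖φ‖ * ‖F‖ := by
    intro φ F
    have h1 := (ContinuousLinearMap.mul ℂ ℂ).norm_holder_apply_apply_le (r := 2) (reflect φ) F
    have h2 : ‖ContinuousLinearMap.mul ℂ ℂ‖ = 1 := ContinuousLinearMap.opNorm_mul ℂ ℂ
    rw [h2, one_mul] at h1
    exact h1.trans (mul_le_mul_of_nonneg_right (norm_reflect_le φ) (norm_nonneg F))
  let ν : CStarR2 →ₗ[ℂ] BL2 :=
    { toFun := fun φ => (s : ℂ) • (ContinuousLinearMap.adjoint W ∘L B φ ∘L W)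
      map_add' := fun φ ψ => by
        rw [map_add, ContinuousLinearMap.add_comp, ContinuousLinearMap.comp_add, smul_add]
      map_smul' := fun c φ => by
        rw [map_smul, ContinuousLinearMap.smul_comp, ContinuousLinearMap.comp_smul,
          smul_comm, RingHom.id_apply] }
  have hν : ∀ φ, ‖ν φ‖ ≤ 1 * ‖φ‖ := by
    intro φ
    rw [one_mul]
    have hs' : (0 : ℝ) ≤ s⁻¹ := (inv_pos.2 hs).le
    calc ‖ν φ‖ = s * ‖ContinuousLinearMap.adjoint W ∘L B φ ∘L W‖ := by
          change ‖(s : ℂ) • (ContinuousLinearMap.adjoint W ∘L B φ ∘L W)‖ = _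
          rw [norm_smul, Complex.norm_real, Real.norm_of_nonneg hs.le]
      _ ≤ s * (√s⁻¹ * (‖φ‖ * √s⁻¹)) := by
          gcongr
          refine (ContinuousLinearMap.opNorm_comp_le _ _).trans ?_
          have h1 : ‖ContinuousLinearMap.adjoint W‖ ≤ √s⁻¹ := by
            rw [LinearIsometryEquiv.norm_map]
            exact hWn
          have h2 : ‖B φ ∘L W‖ ≤ ‖φ‖ * √s⁻¹ := by
            refine (ContinuousLinearMap.opNorm_comp_le _ _).trans ?_
            gcongr
            exact ContinuousLinearMap.opNorm_le_bound _ (norm_nonneg φ) (hBn φ)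
          gcongr
      _ = s * (√s⁻¹) ^ 2 * ‖φ‖ := by ring
      _ = ‖φ‖ := by rw [Real.sq_sqrt hs', mul_inv_cancel₀ hs.ne', one_mul]
  refine ⟨ν.mkContinuous 1 hν, ν.mkContinuous_norm_le zero_le_one hν,
    fun φ => ⟨memLp_wave hη hηc hs hρ hp, fun ξ ζ => ?_⟩⟩
  have hae : (fun u => inner ℂ (W ζ u) (B φ (W ξ) u)) =ᵐ[volume] fun u : ℝ × ℝ =>
      φ (u.1, -u.2) * (coef (wave η s ρ p u) ξ * starRingEnd ℂ (coef (wave η s ρ p u) ζ)) := by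
    filter_upwards [hB φ (W ξ), hW ξ, hW ζ] with u h1 h2 h3
    rw [h1, h2, h3, RCLike.inner_apply, mul_assoc]
  refine ⟨(L2.integrable_inner (W ζ) (B φ (W ξ))).congr hae, ?_⟩
  change inner ℂ ζ ((s : ℂ) • ContinuousLinearMap.adjoint W (B φ (W ξ))) = _
  rw [inner_smul_right, ContinuousLinearMap.adjoint_inner_right, L2.inner_def,
    integral_congr_ae hae]

end Nu

/-! ### The kernel of `ν(φ)` for a product `φ` -/

section NuKernel

variable {α η H : ℝ → ℂ} {s ρ : ℝ} {p : Polynomial ℝ}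

theorem integrable_fourier (hα : ContDiff ℝ ∞ α) (hαc : HasCompactSupport α) :
    Integrable (𝓕 α) volume := by
  have h1 := (𝓕 (hαc.toSchwartzMap hα)).integrable (μ := volume)
  rw [SchwartzMap.fourier_coe] at h1
  exact h1

/-- Fourier inversion. -/
theorem integral_fourier_mul_exp (hα : ContDiff ℝ ∞ α) (hαc : HasCompactSupport α) (t : ℝ) :
    ∫ a, 𝓕 α a * Complex.exp ((2 * Real.pi * a * t : ℝ) * Complex.I) = α t := by
  have h1 := congrFun (hα.continuous.fourierInv_fourier_eq
    (hα.continuous.integrable_of_hasCompactSupport hαc) (integrable_fourier hα hαc)) t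
  rw [Real.fourierInv_eq'] at h1
  rw [← h1]
  congr 1
  funext a
  rw [smul_eq_mul, mul_comm]
  congr 3
  simp
  ring

/-- The function `κ(x, t) = s ∫ H(-b) g_b(x) conj(g_b(x - t)) db`, where `g_b` are the amplitudes
of the waves. -/
def nuKernel (H η : ℝ → ℂ) (s ρ : ℝ) (p : Polynomial ℝ) (q : ℝ × ℝ) : ℂ :=
  s * ∫ b, H (-b) * (amp η s ρ p b q.1 * starRingEnd ℂ (amp η s ρ p b (q.1 - q.2)))

theorem continuous_amp_mul_conj (hη : Continuous η) :
    Continuous fun z : ℝ × (ℝ × ℝ) =>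
      amp η s ρ p z.1 z.2.1 * starRingEnd ℂ (amp η s ρ p z.1 z.2.2) := by
  have h := continuous_amp (s := s) (ρ := ρ) (p := p) hη
  have h1 : Continuous fun z : ℝ × (ℝ × ℝ) => amp η s ρ p z.1 z.2.1 :=
    h.comp (continuous_fst.prodMk (continuous_fst.comp continuous_snd))
  have h2 : Continuous fun z : ℝ × (ℝ × ℝ) => amp η s ρ p z.1 z.2.2 :=
    h.comp (continuous_fst.prodMk (continuous_snd.comp continuous_snd))
  exact h1.mul (RCLike.continuous_conj.comp h2)

theorem stronglyMeasurable_nuKernel (hη : Continuous η) (hH : Continuous H) :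
    StronglyMeasurable (nuKernel H η s ρ p) := by
  refine StronglyMeasurable.const_mul (StronglyMeasurable.integral_prod_left
    (f := fun b (q : ℝ × ℝ) => H (-b) *
      (amp η s ρ p b q.1 * starRingEnd ℂ (amp η s ρ p b (q.1 - q.2)))) ?_) _
  refine Continuous.stronglyMeasurable ?_
  have h1 : Continuous fun z : ℝ × (ℝ × ℝ) =>
      amp η s ρ p z.1 z.2.1 * starRingEnd ℂ (amp η s ρ p z.1 (z.2.1 - z.2.2)) :=
    (continuous_amp_mul_conj hη).comp (by fun_prop :
      Continuous fun z : ℝ × (ℝ × ℝ) => (z.1, (z.2.1, z.2.1 - z.2.2)))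
  exact (hH.comp (continuous_neg.comp continuous_fst)).mul h1

theorem exists_norm_nuKernel_le (hη : Continuous η) (hηc : HasCompactSupport η)
    (hH : Continuous H) (hHc : HasCompactSupport H) :
    ∃ B, ∀ q, ‖nuKernel H η s ρ p q‖ ≤ B := by
  obtain ⟨C, hC⟩ := hηc.exists_bound_of_continuous hη
  have hC0 : 0 ≤ C := (norm_nonneg _).trans (hC 0)
  have hi : Integrable (fun b => ‖H (-b)‖ * (C * C)) volume :=
    ((hH.integrable_of_hasCompactSupport hHc).comp_neg.norm).mul_const _
  refine ⟨‖(s : ℂ)‖ * ∫ b, ‖H (-b)‖ * (C * C), fun q => ?_⟩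
  unfold nuKernel
  rw [norm_mul]
  gcongr
  refine norm_integral_le_of_norm_le hi (Eventually.of_forall fun b => ?_)
  rw [norm_mul, norm_mul, RCLike.norm_conj]
  gcongr
  · exact hC _
  · exact hC _

theorem integral_comp_shear {f : ℝ × ℝ → ℂ} (hf : AEStronglyMeasurable f volume) :
    ∫ q : ℝ × ℝ, f (q.1, q.1 - q.2) = ∫ q, f q := by
  have h := measurePreserving_shear
  rw [← h.map_eq] at hf
  rw [← integral_map h.measurable.aemeasurable hf, h.map_eq]

/-- The product of two wave coefficients, as a double integral. -/
theorem coef_mul_conj_coef (u : ℝ × ℝ) (ξ ζ : L2) :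
    coef (wave η s ρ p u) ξ * starRingEnd ℂ (coef (wave η s ρ p u) ζ) =
      ∫ q : ℝ × ℝ, Complex.exp ((2 * Real.pi * u.1 * (q.1 - q.2) : ℝ) * Complex.I) *
        (amp η s ρ p u.2 q.1 * starRingEnd ℂ (amp η s ρ p u.2 q.2)) *
          (starRingEnd ℂ (ζ q.1) * ξ q.2) := by
  unfold coef
  rw [← integral_conj, mul_comm, ← integral_prod_mul, ← Measure.volume_eq_prod]
  congr 1
  funext q
  rw [wave_eq, wave_eq]
  simp only [map_mul, ← Complex.exp_conj, Complex.conj_I, Complex.conj_ofReal, Complex.conj_conj,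
    map_neg, neg_neg]
  rw [show ((2 * Real.pi * u.1 * (q.1 - q.2) : ℝ) : ℂ) * Complex.I =
    ((2 * Real.pi * u.1 * q.1 : ℝ) : ℂ) * Complex.I +
      ((2 * Real.pi * u.1 * q.2 : ℝ) : ℂ) * -Complex.I by push_cast; ring, Complex.exp_add]
  ring

theorem integrable_indicator (K : Set ℝ) (hK : IsCompact K) (ξ : L2) :
    Integrable (K.indicator fun x => ξ x) volume :=
  (integrable_indicator_iff hK.measurableSet).2
    (((Lp.memLp ξ).locallyIntegrable one_le_two).integrableOn_isCompact hK)

/-- The integrand is dominated by an integrable function because `H` confines `b` to a bounded set,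
and then the amplitudes confine both `x` and `y` to a compact set. -/
theorem integrable_wave_kernel (hα : ContDiff ℝ ∞ α) (hαc : HasCompactSupport α)
    (hη : Continuous η) (hηc : HasCompactSupport η) (hs : 0 < s) (hρ : 0 < ρ)
    (hp : 0 < p.degree) (hH : Continuous H) (hHc : HasCompactSupport H) (ξ ζ : L2) :
    Integrable (fun z : (ℝ × ℝ) × (ℝ × ℝ) => 𝓕 α z.1.1 * H (-z.1.2) *
      (Complex.exp ((2 * Real.pi * z.1.1 * (z.2.1 - z.2.2) : ℝ) * Complex.I) *
        (amp η s ρ p z.1.2 z.2.1 * starRingEnd ℂ (amp η s ρ p z.1.2 z.2.2)) *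
          (starRingEnd ℂ (ζ z.2.1) * ξ z.2.2)))
      ((volume : Measure (ℝ × ℝ)).prod volume) := by
  obtain ⟨R, -, hR⟩ := hHc.exists_pos_le_norm
  obtain ⟨X, hX⟩ := exists_amp_eq_zero hηc hs hρ hp R
  obtain ⟨C, hC⟩ := hηc.exists_bound_of_continuous hη
  have hC0 : 0 ≤ C := (norm_nonneg _).trans (hC 0)
  have hK := isCompact_closedBall (0 : ℝ) X
  have hαm := continuous_fourier (hα.continuous.integrable_of_hasCompactSupport hαc)
  have hu : Integrable (fun u : ℝ × ℝ => 𝓕 α u.1 * H (-u.2)) volume := by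
    rw [Measure.volume_eq_prod]
    exact (integrable_fourier hα hαc).mul_prod
      (hH.integrable_of_hasCompactSupport hHc).comp_neg
  have hq : Integrable (fun q : ℝ × ℝ => (Metric.closedBall 0 X).indicator (fun x => ζ x) q.1 *
      (Metric.closedBall 0 X).indicator (fun x => ξ x) q.2) volume := by
    rw [Measure.volume_eq_prod]
    exact (integrable_indicator _ hK ζ).mul_prod (integrable_indicator _ hK ξ)
  refine ((hu.mul_prod hq).norm.const_mul (C * C)).mono' ?_ (Eventually.of_forall fun z => ?_)
  · have hm1 : Continuous fun z : (ℝ × ℝ) × (ℝ × ℝ) =>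
        amp η s ρ p z.1.2 z.2.1 * starRingEnd ℂ (amp η s ρ p z.1.2 z.2.2) :=
      (continuous_amp_mul_conj hη).comp (by fun_prop :
        Continuous fun z : (ℝ × ℝ) × (ℝ × ℝ) => (z.1.2, z.2))
    have hm2 : Continuous fun z : (ℝ × ℝ) × (ℝ × ℝ) => 𝓕 α z.1.1 * H (-z.1.2) :=
      (hαm.comp (continuous_fst.comp continuous_fst)).mul (hH.comp (by fun_prop))
    have hm3 : Measurable fun z : (ℝ × ℝ) × (ℝ × ℝ) => starRingEnd ℂ (ζ z.2.1) * ξ z.2.2 := by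
      have h1 := (Lp.stronglyMeasurable ζ).measurable
      have h2 := (Lp.stronglyMeasurable ξ).measurable
      exact (RCLike.continuous_conj.measurable.comp (h1.comp (measurable_fst.comp
        measurable_snd))).mul (h2.comp (measurable_snd.comp measurable_snd))
    have hm4 : Continuous fun z : (ℝ × ℝ) × (ℝ × ℝ) =>
        Complex.exp ((2 * Real.pi * z.1.1 * (z.2.1 - z.2.2) : ℝ) * Complex.I) := by fun_prop
    exact (hm2.measurable.mul ((hm4.measurable.mul hm1.measurable).mul hm3)).aestronglyMeasurable
  · by_cases hb : R ≤ ‖-z.1.2‖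
    · rw [hR _ hb]
      simp
    rw [not_le, norm_neg, Real.norm_eq_abs] at hb
    by_cases h1 : X < |z.2.1|
    · rw [hX _ _ hb.le h1.le, zero_mul, mul_zero, zero_mul, mul_zero, norm_zero]
      positivity
    by_cases h2 : X < |z.2.2|
    · rw [hX _ z.2.2 hb.le h2.le, map_zero, mul_zero, mul_zero, zero_mul, mul_zero, norm_zero]
      positivity
    rw [Set.indicator_of_mem (by rw [mem_closedBall_zero_iff]; exact not_lt.1 h1),
      Set.indicator_of_mem (by rw [mem_closedBall_zero_iff]; exact not_lt.1 h2)]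
    simp only [norm_mul, RCLike.norm_conj, Complex.norm_exp_ofReal_mul_I]
    rw [one_mul]
    have h3 : ‖amp η s ρ p z.1.2 z.2.1‖ * ‖amp η s ρ p z.1.2 z.2.2‖ ≤ C * C :=
      mul_le_mul (hC _) (hC _) (norm_nonneg _) hC0
    calc _ = ‖amp η s ρ p z.1.2 z.2.1‖ * ‖amp η s ρ p z.1.2 z.2.2‖ *
          (‖𝓕 α z.1.1‖ * ‖H (-z.1.2)‖ * (‖ζ z.2.1‖ * ‖ξ z.2.2‖)) := by ring
      _ ≤ _ := mul_le_mul_of_nonneg_right h3 (by positivity)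

/-- Fubini's theorem and Fourier inversion in the variable `a`. -/
theorem hasKernel_of_isNu (hα : ContDiff ℝ ∞ α) (hαc : HasCompactSupport α)
    (hη : Continuous η) (hηc : HasCompactSupport η) (hs : 0 < s) (hρ : 0 < ρ)
    (hp : 0 < p.degree) (hH : Continuous H) (hHc : HasCompactSupport H) {φ : CStarR2}
    (hφ : ∀ a b, φ (a, b) = 𝓕 α a * H b) {S : BL2} (hS : IsNu η s ρ p φ S) :
    HasKernel S fun q => α q.2 * nuKernel H η s ρ p q := by
  have hmeas : AEStronglyMeasurable (fun q : ℝ × ℝ => α q.2 * nuKernel H η s ρ p q) volume :=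
    ((hα.continuous.comp continuous_snd).stronglyMeasurable.mul
      (stronglyMeasurable_nuKernel hη hH)).aestronglyMeasurable
  refine ⟨hmeas, ?_, fun ζ ξ => ?_⟩
  · obtain ⟨B, hB⟩ := exists_norm_nuKernel_le (s := s) (ρ := ρ) (p := p) hη hηc hH hHc
    refine ⟨fun t => ‖α t‖ * B,
      (hα.continuous.integrable_of_hasCompactSupport hαc).norm.mul_const B, fun q => ?_⟩
    rw [norm_mul]
    exact mul_le_mul_of_nonneg_left (hB q) (norm_nonneg _)
  have hint := integrable_wave_kernel hα hαc hη hηc hs hρ hp hH hHc ξ ζ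
  rw [(hS.2 ξ ζ).2, ← integral_comp_shear (f := fun q : ℝ × ℝ =>
    α q.2 * nuKernel H η s ρ p q * (starRingEnd ℂ (ζ q.1) * ξ (q.1 - q.2)))
    (hmeas.mul (measurable_shift ζ ξ).aestronglyMeasurable)]
  simp_rw [hφ, coef_mul_conj_coef, ← integral_const_mul]
  rw [integral_integral_swap (hint.const_mul (s : ℂ))]
  congr 1
  funext q
  have h1 : ∀ u : ℝ × ℝ, 𝓕 α u.1 * H (-u.2) *
      (Complex.exp ((2 * Real.pi * u.1 * (q.1 - q.2) : ℝ) * Complex.I) *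
        (amp η s ρ p u.2 q.1 * starRingEnd ℂ (amp η s ρ p u.2 q.2)) *
          (starRingEnd ℂ (ζ q.1) * ξ q.2)) =
      (𝓕 α u.1 * Complex.exp ((2 * Real.pi * u.1 * (q.1 - q.2) : ℝ) * Complex.I)) *
        (H (-u.2) * (amp η s ρ p u.2 q.1 * starRingEnd ℂ (amp η s ρ p u.2 q.2))) *
          (starRingEnd ℂ (ζ q.1) * ξ q.2) := fun u => by ring
  simp_rw [h1]
  rw [integral_const_mul, integral_mul_const, Measure.volume_eq_prod,
    integral_prod_mul (fun a => 𝓕 α a *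
      Complex.exp ((2 * Real.pi * a * (q.1 - q.2) : ℝ) * Complex.I))
      (fun b => H (-b) * (amp η s ρ p b q.1 * starRingEnd ℂ (amp η s ρ p b q.2))),
    integral_fourier_mul_exp hα hαc]
  simp only [nuKernel, sub_sub_cancel]
  ring

end NuKernel

/-! ### Asymptotics of the kernel of `ν(φ)` -/

section NuAsymptotics

variable {η H : ℝ → ℂ} {p : Polynomial ℝ}

/-- The average of `H(c - σv)` against `η(v + δ) conj(η(v))`. -/
def smear (H η : ℝ → ℂ) (σδ : ℝ × ℝ) (c : ℝ) : ℂ :=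
  ∫ v, H (c - σδ.1 * v) * (η (v + σδ.2) * starRingEnd ℂ (η v))

/-- The substitution `v = s (p((x - t) / ρ) + b)`. -/
theorem nuKernel_eq_smear {s : ℝ} (hs : 0 < s) (ρ : ℝ) (q : ℝ × ℝ) :
    nuKernel H η s ρ p q =
      smear H η (s⁻¹, s * (p.eval (q.1 / ρ) - p.eval ((q.1 - q.2) / ρ)))
        (p.eval ((q.1 - q.2) / ρ)) := by
  unfold nuKernel smear amp
  set P := p.eval (q.1 / ρ)
  set Q := p.eval ((q.1 - q.2) / ρ)
  have h1 := Measure.integral_comp_mul_left (fun v => H (Q - s⁻¹ * (v + s * Q)) *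
    (η (v + s * Q + s * (P - Q)) * starRingEnd ℂ (η (v + s * Q)))) s
  have h2 := integral_add_right_eq_self (μ := (volume : Measure ℝ)) (fun v => H (Q - s⁻¹ * v) *
    (η (v + s * (P - Q)) * starRingEnd ℂ (η v))) (s * Q)
  rw [h2, abs_of_pos (inv_pos.2 hs)] at h1
  have h3 : ∀ b : ℝ, H (-b) * (η (s * P + s * b) * starRingEnd ℂ (η (s * Q + s * b))) =
      H (Q - s⁻¹ * (s * b + s * Q)) * (η (s * b + s * Q + s * (P - Q)) *
        starRingEnd ℂ (η (s * b + s * Q))) := by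
    intro b
    rw [show Q - s⁻¹ * (s * b + s * Q) = -b by field_simp; ring,
      show s * b + s * Q + s * (P - Q) = s * P + s * b by ring, add_comm (s * b)]
  simp_rw [h3]
  rw [h1, Complex.real_smul, ← mul_assoc, ← Complex.ofReal_mul, mul_inv_cancel₀ hs.ne',
    Complex.ofReal_one, one_mul]

theorem continuous_smear (hη : Continuous η) (hηc : HasCompactSupport η) (hH : Continuous H)
    (hHc : HasCompactSupport H) : Continuous (smear H η).uncurry := by
  obtain ⟨C, hC⟩ := hηc.exists_bound_of_continuous hη
  obtain ⟨B, hB⟩ := hHc.exists_bound_of_continuous hH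
  have hC0 : 0 ≤ C := (norm_nonneg _).trans (hC 0)
  have hB0 : 0 ≤ B := (norm_nonneg _).trans (hB 0)
  have hconj := RCLike.continuous_conj (K := ℂ)
  refine continuous_of_dominated (bound := fun v => B * (C * ‖η v‖))
    (F := fun (z : (ℝ × ℝ) × ℝ) v =>
      H (z.2 - z.1.1 * v) * (η (v + z.1.2) * starRingEnd ℂ (η v)))
    (fun z => Continuous.aestronglyMeasurable (by fun_prop))
    (fun z => Eventually.of_forall fun v => ?_)
    (((hη.integrable_of_hasCompactSupport hηc).norm.const_mul C).const_mul B)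
    (Eventually.of_forall fun v => by fun_prop)
  rw [norm_mul, norm_mul, RCLike.norm_conj]
  exact mul_le_mul (hB _) (mul_le_mul_of_nonneg_right (hC _) (norm_nonneg _)) (by positivity) hB0

theorem smear_zero (hη1 : ∫ x, ‖η x‖ ^ 2 = 1) (c : ℝ) : smear H η (0, 0) c = H c := by
  have h1 : ∀ v, η v * starRingEnd ℂ (η v) = ((‖η v‖ ^ 2 : ℝ) : ℂ) := by
    intro v
    rw [RCLike.mul_conj]
    norm_cast
  simp only [smear, zero_mul, sub_zero, add_zero]
  simp_rw [h1]
  rw [integral_const_mul, integral_complex_ofReal, hη1, Complex.ofReal_one, mul_one]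

/-- `smear` is close to `H` if `σ` and `δ` are small, uniformly in `c`.  For `c` outside of a
compact set both functions vanish as soon as `|σ| ≤ 1`, whatever `δ` is. -/
theorem exists_norm_smear_sub_le (hη : Continuous η) (hηc : HasCompactSupport η)
    (hη1 : ∫ x, ‖η x‖ ^ 2 = 1) (hH : Continuous H) (hHc : HasCompactSupport H) {ε : ℝ}
    (hε : 0 < ε) : ∃ d > 0, ∃ C, ∀ σ δ c : ℝ, |σ| ≤ d → (|c| ≤ C → |δ| ≤ d) →
      ‖smear H η (σ, δ) c - H c‖ ≤ ε := by
  obtain ⟨R, hR0, hR⟩ := hHc.exists_pos_le_norm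
  obtain ⟨X, hX0, hX⟩ := hηc.exists_pos_le_norm
  obtain ⟨v, hv, hfv⟩ := (isCompact_closedBall (0 : ℝ) (R + X)).mem_uniformity_of_prod
    (s := Set.univ) (f := smear H η) (q := (0, 0))
    (continuous_smear hη hηc hH hHc).continuousOn (Set.mem_univ _) (Metric.dist_mem_uniformity hε)
  rw [nhdsWithin_univ] at hv
  obtain ⟨d, hd, hdv⟩ := Metric.mem_nhds_iff.1 hv
  refine ⟨min (d / 2) 1, by positivity, R + X, fun σ δ c hσ hδ => ?_⟩
  have hσ1 := hσ.trans (min_le_right _ _)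
  have hσd := hσ.trans (min_le_left _ _)
  by_cases hc : |c| ≤ R + X
  · have hδd := (hδ hc).trans (min_le_left _ _)
    have h1 : ((σ, δ) : ℝ × ℝ) ∈ v := by
      refine hdv ?_
      rw [Metric.mem_ball, Prod.dist_eq, Real.dist_eq, Real.dist_eq, sub_zero, sub_zero]
      exact max_lt (by linarith) (by linarith)
    have h2 := hfv _ h1 c (by rwa [mem_closedBall_zero_iff])
    rw [← smear_zero (H := H) hη1 c, ← dist_eq_norm]
    exact le_of_lt h2
  · rw [not_le] at hc
    have h1 : smear H η (σ, δ) c = 0 := by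
      unfold smear
      rw [← integral_zero ℝ ℂ]
      congr 1
      funext x
      by_cases hx : X ≤ ‖x‖
      · rw [hX x hx, map_zero, mul_zero, mul_zero]
      · rw [not_le, Real.norm_eq_abs] at hx
        have h2 : |σ * x| ≤ X := by
          rw [abs_mul]
          calc |σ| * |x| ≤ 1 * X := mul_le_mul hσ1 hx.le (abs_nonneg _) zero_le_one
            _ = X := one_mul X
        rw [hR _ (by
          rw [Real.norm_eq_abs]
          have := abs_sub_abs_le_abs_sub c (σ * x)
          linarith), zero_mul]
    rw [h1, hR c (by rw [Real.norm_eq_abs]; linarith), sub_zero, norm_zero]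
    exact hε.le

theorem exists_lipschitz_eval (p : Polynomial ℝ) (Y : ℝ) :
    ∃ L, 0 ≤ L ∧ ∀ y z : ℝ, |y| ≤ Y → |z| ≤ Y → |p.eval y - p.eval z| ≤ L * |y - z| := by
  obtain ⟨L, hL⟩ := (isCompact_closedBall (0 : ℝ) Y).exists_bound_of_continuousOn
    p.derivative.continuous.continuousOn
  refine ⟨|L|, abs_nonneg L, fun y z hy hz => ?_⟩
  have := (convex_closedBall (0 : ℝ) Y).norm_image_sub_le_of_norm_deriv_le
    (f := fun x => p.eval x) (C := |L|) (x := z) (y := y) (fun x _ => p.differentiable x)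
    (fun x hx => by
      rw [p.deriv]
      exact (hL x hx).trans (le_abs_self L))
    (by rwa [mem_closedBall_zero_iff]) (by rwa [mem_closedBall_zero_iff])
  exact this

/-- Translations by a bounded amount hardly change `p(x / ρ)` where this is bounded, even after
multiplication with `s`, if `s / ρ → 0`. -/
theorem eventually_mul_eval_sub_le (hp : 0 < p.degree) {s ρ : ℕ → ℝ}
    (hs : Tendsto s atTop atTop) (hρ : Tendsto ρ atTop atTop)
    (hsρ : Tendsto (fun k => s k / ρ k) atTop (𝓝 0)) (R C : ℝ) {d : ℝ} (hd : 0 < d) :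
    ∀ᶠ k in atTop, ∀ x t : ℝ, |t| ≤ R → |p.eval ((x - t) / ρ k)| ≤ C →
      |s k * (p.eval (x / ρ k) - p.eval ((x - t) / ρ k))| ≤ d := by
  obtain ⟨Y, hY⟩ := exists_le_abs_eval hp (C + 1)
  obtain ⟨L, hL0, hL⟩ := exists_lipschitz_eval p (Y + 1)
  have h1 : Tendsto (fun k => s k / ρ k * (L * R)) atTop (𝓝 0) := by
    simpa using hsρ.mul_const (L * R)
  filter_upwards [h1.eventually (eventually_le_nhds hd), hs.eventually_gt_atTop 0,
    hρ.eventually_gt_atTop 0, hρ.eventually_ge_atTop R] with k hk hsk hρk hρR x t ht hc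
  have h2 : |(x - t) / ρ k| < Y := by
    by_contra h
    have := hY _ (not_lt.1 h)
    linarith
  have h3 : x / ρ k - (x - t) / ρ k = t / ρ k := by ring
  have h4 : |t / ρ k| ≤ R / ρ k := by
    rw [abs_div, abs_of_pos hρk]
    gcongr
  have h5 : R / ρ k ≤ 1 := (div_le_one hρk).2 hρR
  have h6 : |x / ρ k| ≤ Y + 1 := by
    have := abs_sub_abs_le_abs_sub (x / ρ k) ((x - t) / ρ k)
    rw [h3] at this
    linarith
  have h7 := hL _ ((x - t) / ρ k) h6 (by linarith)
  rw [h3] at h7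
  rw [abs_mul, abs_of_pos hsk]
  calc s k * |p.eval (x / ρ k) - p.eval ((x - t) / ρ k)| ≤ s k * (L * (R / ρ k)) := by
        gcongr
        exact h7.trans (mul_le_mul_of_nonneg_left h4 hL0)
    _ = s k / ρ k * (L * R) := by ring
    _ ≤ d := hk

/-- The kernel of `ν(φ)` becomes `H(p((x - t) / ρ))` in the limit. -/
theorem eventually_nuKernel (hη : Continuous η) (hηc : HasCompactSupport η)
    (hη1 : ∫ x, ‖η x‖ ^ 2 = 1) (hH : Continuous H) (hHc : HasCompactSupport H)
    (hp : 0 < p.degree) {s ρ : ℕ → ℝ}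
    (hs : Tendsto s atTop atTop) (hρ : Tendsto ρ atTop atTop)
    (hsρ : Tendsto (fun k => s k / ρ k) atTop (𝓝 0)) (R : ℝ) {ε : ℝ} (hε : 0 < ε) :
    ∀ᶠ k in atTop, ∀ x t : ℝ, |t| ≤ R →
      ‖nuKernel H η (s k) (ρ k) p (x, t) - H (p.eval ((x - t) / ρ k))‖ ≤ ε := by
  obtain ⟨d, hd, C, hC⟩ := exists_norm_smear_sub_le hη hηc hη1 hH hHc hε
  filter_upwards [eventually_mul_eval_sub_le hp hs hρ hsρ R C hd, hs.eventually_gt_atTop 0,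
    hs.eventually_ge_atTop d⁻¹] with k hk hsk hsd x t ht
  rw [nuKernel_eq_smear hsk]
  refine hC _ _ _ ?_ (hk x t ht)
  rw [abs_of_pos (inv_pos.2 hsk)]
  exact inv_le_of_inv_le₀ hd hsd

end NuAsymptotics

/-! ### Reduction to test functions -/

section Reduction

variable {N : ℕ} [Fact (3 ≤ N)]

theorem norm_le_of_norm_ofL1_le {F : Type*} [NormedAddCommGroup F] [NormedSpace ℂ F]
    (g : CStar N →L[ℂ] F) (hg : ∀ f : L1 N, ‖g (ofL1 f)‖ ≤ ‖toL1C f‖) (a : CStar N) :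
    ‖g a‖ ≤ ‖a‖ := by
  induction a using UniformSpace.Completion.induction_on with
  | hp => exact isClosed_le g.continuous.norm continuous_norm
  | ih f =>
    rw [UniformSpace.Completion.norm_coe]
    exact hg (toL1C.symm f)

theorem norm_piStar_le (l : Sgen N) (a : CStar N) : ‖piStar l a‖ ≤ ‖a‖ := by
  refine norm_le_of_norm_ofL1_le _ (fun f => ?_) a
  rw [piStar_ofL1]
  exact repNorm_le_norm (toL1C f) (Sum.inl l)

theorem norm_rhoStar_le (a : CStar N) : ‖rhoStar a‖ ≤ ‖a‖ := by
  refine norm_le_of_norm_ofL1_le _ (fun f => ?_) a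
  rw [rhoStar_ofL1]
  exact norm_rhoL1_le (toL1C f)

theorem norm_U_le (r : ℝ) : ‖U r‖ ≤ 1 :=
  LinearIsometry.norm_toContinuousLinearMap_le _

theorem norm_M_le {A : Set ℝ} (hA : MeasurableSet A) : ‖M A hA‖ ≤ 1 := by
  refine ContinuousLinearMap.opNorm_le_bound _ zero_le_one fun f => ?_
  rw [one_mul]
  refine Lp.norm_le_norm_of_ae_le ?_
  filter_upwards [mulOp_coe _ (memLp_indicator_one hA) f] with x hx
  have hx' : (M A hA f : ℝ → ℂ) x = A.indicator (fun _ => (1 : ℂ)) x * f x := hx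
  rw [hx']
  by_cases h : x ∈ A <;> simp [h]

/-- The linear map `T ↦ T Q`. -/
def compRight (Q : BL2) : BL2 →ₗ[ℂ] BL2 where
  toFun T := T ∘L Q
  map_add' T T' := ContinuousLinearMap.add_comp T T' Q
  map_smul' c T := ContinuousLinearMap.smul_comp c T Q

/-- The linear map `T ↦ U(r) T U(-r) Q`. -/
def conjComp (r : ℝ) (Q : BL2) : BL2 →ₗ[ℂ] BL2 where
  toFun T := (U r ∘L T ∘L U (-r)) ∘L Q
  map_add' T T' := by
    ext1 ξ
    simp
  map_smul' c T := by
    ext1 ξ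
    simp

theorem norm_comp_le_of_le {T Q : BL2} (hQ : ‖Q‖ ≤ 1) : ‖T ∘L Q‖ ≤ ‖T‖ :=
  (ContinuousLinearMap.opNorm_comp_le _ _).trans
    (mul_le_of_le_one_right (norm_nonneg _) hQ)

theorem norm_conjComp_le (r : ℝ) {Q : BL2} (hQ : ‖Q‖ ≤ 1) (T : BL2) : ‖conjComp r Q T‖ ≤ ‖T‖ := by
  refine (norm_comp_le_of_le hQ).trans ((ContinuousLinearMap.opNorm_comp_le _ _).trans ?_)
  refine (mul_le_of_le_one_left (norm_nonneg _) (norm_U_le r)).trans ?_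
  exact norm_comp_le_of_le (norm_U_le (-r))

/-- A uniformly bounded sequence of linear maps on `C*(G_N)` tends to zero pointwise if, on the
elements `α ⊗ β`, it is given by kernels that are small relative to `α`. -/
theorem tendsto_norm_of_kernel {T : ℕ → CStar N →ₗ[ℂ] BL2} {C : ℝ}
    (hC : ∀ᶠ k in atTop, ∀ a, ‖T k a‖ ≤ C * ‖a‖)
    (h : ∀ (α : ℝ → ℂ) (β : V N → ℂ) (_ : ContDiff ℝ ∞ α) (_ : HasCompactSupport α)
      (hα : Integrable α volume) (hβ : Integrable β volume), HasCompactSupport (fourierV β) →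
      ∀ ε > 0, ∀ᶠ k in atTop, ∃ K, HasKernel (T k (ofL1 (tensor hα hβ))) K ∧
        ∀ q, ‖K q‖ ≤ ‖α q.2‖ * ε) (a : CStar N) :
    Tendsto (fun k => ‖T k a‖) atTop (𝓝 0) := by
  let W : Submodule ℂ (CStar N) :=
    { carrier := {a | Tendsto (fun k => T k a) atTop (𝓝 0)}
      zero_mem' := by simp
      add_mem' := fun {a b} ha hb => by
        change Tendsto (fun k => T k (a + b)) atTop (𝓝 0)
        change Tendsto (fun k => T k a) atTop (𝓝 0) at ha
        change Tendsto (fun k => T k b) atTop (𝓝 0) at hb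
        simp_rw [map_add]
        rw [← add_zero (0 : BL2)]
        exact ha.add hb
      smul_mem' := fun c a ha => by
        change Tendsto (fun k => T k (c • a)) atTop (𝓝 0)
        change Tendsto (fun k => T k a) atTop (𝓝 0) at ha
        simp_rw [map_smul]
        rw [← smul_zero c]
        exact ha.const_smul c }
  have hmem : ∀ a, a ∈ W ↔ ∀ ε > 0, ∀ᶠ k in atTop, ‖T k a‖ < ε := by
    intro a
    change Tendsto (fun k => T k a) atTop (𝓝 0) ↔ _
    simp [Metric.tendsto_nhds]
  have hW : IsClosed (W : Set (CStar N)) := by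
    refine isClosed_of_closure_subset fun a ha => ?_
    rw [SetLike.mem_coe, hmem]
    intro ε hε
    obtain ⟨b, hb, hab⟩ := Metric.mem_closure_iff.1 ha (ε / 2 / (|C| + 1)) (by positivity)
    rw [dist_eq_norm] at hab
    filter_upwards [hC, (hmem b).1 hb (ε / 2) (by positivity)] with k h1 h2
    have h3 : C * ‖a - b‖ ≤ ε / 2 := by
      rw [lt_div_iff₀ (by positivity)] at hab
      nlinarith [le_abs_self C, norm_nonneg (a - b)]
    calc ‖T k a‖ = ‖T k (a - b) + T k b‖ := by rw [← map_add, sub_add_cancel]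
      _ ≤ ‖T k (a - b)‖ + ‖T k b‖ := norm_add_le _ _
      _ < ε := by linarith [h1 (a - b)]
  have h0 : a ∈ W := by
    refine CStar.induction hW (fun α β hα1 hα2 hα hβ hβ1 => (hmem _).2 fun ε hε => ?_) a
    have hI : 0 ≤ ∫ t, ‖α t‖ := integral_nonneg fun t => norm_nonneg _
    filter_upwards [h α β hα1 hα2 hα hβ hβ1 (ε / ((∫ t, ‖α t‖) + 1)) (by positivity)]
      with k ⟨K, hK, hKα⟩
    refine (hK.norm_le (hα.norm.mul_const _) hKα).trans_lt ?_
    rw [integral_mul_const, ← mul_div_assoc, div_lt_iff₀ (by positivity)]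
    nlinarith
  exact tendsto_zero_iff_norm_tendsto_zero.1 h0

end Reduction

/-! ### The conditions for the Fourier transform -/

theorem hasKernel_conjComp {N : ℕ} (l : V N) {α : ℝ → ℂ} {β : V N → ℂ} (hα : Integrable α volume)
    (hβ : Integrable β volume) (r : ℝ) {A : Set ℝ} (hA : MeasurableSet A) :
    HasKernel (conjComp r (M A hA) (piL1 l (tensor hα hβ))) fun q =>
      α q.2 * fourierV β (coact (q.1 - q.2 + r) l) * A.indicator (fun _ => 1) (q.1 - q.2) := by
  refine (((hasKernel_piL1 l hα hβ).conj_U r).comp_M hA).congr fun q => ?_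
  change α q.2 * fourierV β (coact (q.1 + r - q.2) l) * _ = _
  rw [show q.1 + r - q.2 = q.1 - q.2 + r by ring]

section Conditions

variable {N : ℕ} [Fact (3 ≤ N)]

theorem isCompactOperator_piStar (l : Sgen N) (a : CStar N) : IsCompactOperator (piStar l a) := by
  let W : Submodule ℂ (CStar N) :=
    { carrier := {a | IsCompactOperator (piStar l a)}
      zero_mem' := by
        change IsCompactOperator (piStar l 0)
        rw [map_zero]
        exact isCompactOperator_zero
      add_mem' := fun {a b} ha hb => by
        change IsCompactOperator (piStar l (a + b))
        rw [map_add]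
        exact IsCompactOperator.add ha hb
      smul_mem' := fun c a ha => by
        change IsCompactOperator (piStar l (c • a))
        rw [map_smul]
        exact IsCompactOperator.smul ha c }
  have hW : IsClosed (W : Set (CStar N)) :=
    isClosed_setOfPred_isCompactOperator.preimage (piStar l).continuous
  refine CStar.induction (W := W) hW (fun α β hα1 hα2 hα hβ hβ1 => ?_) a
  change IsCompactOperator (piStar l _)
  rw [piStar_ofL1]
  have hc : Continuous fun x : ℝ => fourierV β (coact x l.1) :=
    (continuous_fourierV hβ).comp (continuous_coact.comp (by fun_prop :
      Continuous fun x : ℝ => (x, l.1)))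
  exact (hasKernel_piL1 l.1 hα hβ).isCompactOperator hα1.continuous hα2 hc
    (hasCompactSupport_comp_coact hβ1 (not_isCharacter_of_isGen l.2))

theorem norm_mul_indicator_sub_le {A : Set ℝ} {c z w : ℂ} {x ε : ℝ} (hε : 0 ≤ ε)
    (h : x ∈ A → ‖z - w‖ ≤ ε) :
    ‖c * z * A.indicator (fun _ => 1) x - c * w * A.indicator (fun _ => 1) x‖ ≤ ‖c‖ * ε := by
  by_cases hx : x ∈ A
  · rw [Set.indicator_of_mem hx, mul_one, mul_one, ← mul_sub, norm_mul]
    exact mul_le_mul_of_nonneg_left (h hx) (norm_nonneg c)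
  · rw [Set.indicator_of_notMem hx, mul_zero, mul_zero, sub_zero, norm_zero]
    positivity

theorem genericCondition_fourier (a : CStar N) : (fourier a).GenericCondition := by
  intro l D _ hD i hi s hs
  obtain ⟨r, l₀, hr⟩ := exists_coact_isGen (l := D.lim i) hi
  refine ⟨r, l₀, hr, ?_⟩
  let T : ℕ → CStar N →ₗ[ℂ] BL2 := fun k =>
    conjComp (D.t i k) (Mint (s k)) ∘ₗ (piStar (l k)).toLinearMap -
      conjComp r (Mint (s k)) ∘ₗ (piStar l₀).toLinearMap
  refine tendsto_norm_of_kernel (T := T) (C := 2) (Eventually.of_forall fun k b => ?_)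
    (fun α β hα1 hα2 hα hβ hβ1 ε hε => ?_) a
  · have h1 := norm_conjComp_le (D.t i k) (norm_M_le (measurableSet_Ioo (a := -s k) (b := s k)))
      (piStar (l k) b)
    have h2 := norm_conjComp_le r (norm_M_le (measurableSet_Ioo (a := -s k) (b := s k)))
      (piStar l₀ b)
    refine (norm_sub_le _ _).trans ?_
    rw [two_mul]
    exact add_le_add (h1.trans (norm_piStar_le _ b)) (h2.trans (norm_piStar_le _ b))
  · filter_upwards [hD.eventually_generic hs hi (continuous_fourierV hβ) hβ1 hε] with k hk
    have hK := (hasKernel_conjComp (l k).1 hα hβ (D.t i k)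
      (measurableSet_Ioo (a := -s k) (b := s k))).sub
      (hasKernel_conjComp l₀.1 hα hβ r (measurableSet_Ioo (a := -s k) (b := s k)))
    rw [← piStar_ofL1, ← piStar_ofL1] at hK
    refine ⟨_, hK, fun q => norm_mul_indicator_sub_le hε.le fun hq => ?_⟩
    have := hk (q.1 - q.2) (abs_lt.2 hq)
    rwa [← hr, coact_coact] at this

theorem characterCondition_fourier {η : ℝ → ℂ} (hη : Continuous η) (hηc : HasCompactSupport η)
    (hη1 : ∫ x, ‖η x‖ ^ 2 = 1) (a : CStar N) : (fourier a).CharacterCondition η := by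
  intro l D _ hD i hi s hs
  have hp := hD.degree_p_pos hi
  have hex : ∀ k, ∃ ν : CStarR2 →L[ℂ] BL2, ‖ν‖ ≤ 1 ∧ (0 < s k → 0 < D.rho i k →
      ∀ φ, IsNu η (s k) (D.rho i k) (D.p i) φ (ν φ)) := by
    intro k
    by_cases h : 0 < s k ∧ 0 < D.rho i k
    · obtain ⟨ν, h1, h2⟩ := exists_isNu hη hηc hη1 h.1 h.2 hp
      exact ⟨ν, h1, fun _ _ => h2⟩
    · exact ⟨0, ContinuousLinearMap.opNorm_zero.trans_le zero_le_one,
        fun h1 h2 => (h ⟨h1, h2⟩).elim⟩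
  choose ν hν1 hν using hex
  have hpos := (hs.tendsto_atTop.eventually_gt_atTop 0).and (hD.rho_pos i)
  refine ⟨fun k => ν k (rhoStar a), hpos.mono fun k hk => hν k hk.1 hk.2 _, ?_⟩
  let S : ℕ → ℝ := fun k => s k * D.rho i k
  -- `ν k` is a bounded linear map for all `k`, but describes `ν(φ)(i,k)` only for large `k`.
  let T : ℕ → CStar N →ₗ[ℂ] BL2 := fun k =>
    conjComp (D.t i k) (Mint (S k)) ∘ₗ (piStar (l k)).toLinearMap -
      compRight (Mint (S k)) ∘ₗ (ν k).toLinearMap ∘ₗ rhoStar.toLinearMap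
  refine tendsto_norm_of_kernel (T := T) (C := 2) (Eventually.of_forall fun k b => ?_)
    (fun α β hα1 hα2 hα hβ hβ1 ε hε => ?_) a
  · have h1 := norm_conjComp_le (D.t i k) (norm_M_le (measurableSet_Ioo (a := -S k) (b := S k)))
      (piStar (l k) b)
    have h2 : ‖ν k (rhoStar b) ∘L Mint (S k)‖ ≤ ‖ν k (rhoStar b)‖ :=
      norm_comp_le_of_le (norm_M_le _)
    have h3 := (ν k).le_of_opNorm_le (hν1 k) (rhoStar b)
    rw [one_mul] at h3
    refine (norm_sub_le _ _).trans ?_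
    rw [two_mul]
    exact add_le_add (h1.trans (norm_piStar_le _ b)) (h2.trans (h3.trans (norm_rhoStar_le b)))
  · have hcs : Continuous fun b : ℝ => (Pi.single (top N) b : V N) :=
      continuous_single (A := fun _ => ℝ) (top N)
    obtain ⟨H, hH⟩ : ∃ H : ℝ → ℂ, ∀ b, H b = fourierV β (Pi.single (top N) b) := ⟨_, fun _ => rfl⟩
    have hHc : Continuous H := by
      simp_rw [funext hH]
      exact (continuous_fourierV hβ).comp hcs
    have hHs : HasCompactSupport H := by
      obtain ⟨B, -, hB⟩ := exists_eq_zero_of_le_top hβ1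
      exact hasCompactSupport_of_abs (X := B) fun x hx => by
        rw [hH]
        exact hB _ (by simpa using hx)
    obtain ⟨X, -, hX⟩ := hα2.exists_pos_le_norm
    filter_upwards [hD.eventually_character hs hi (continuous_fourierV hβ) hβ1 (half_pos hε),
      eventually_nuKernel hη hηc hη1 hHc hHs hp hs.tendsto_atTop (hD.tendsto_rho hi)
        (hs.char' i hi) X (half_pos hε), hpos] with k h1 h2 h3
    have hφ : ∀ x b, rhoStar (ofL1 (tensor hα hβ)) (x, b) = FourierTransform.fourier α x * H b := by
      intro x b
      rw [rhoStar_ofL1, hH]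
      exact chiL1_tensor (x, b) hα hβ
    have hK := (hasKernel_conjComp (l k).1 hα hβ (D.t i k)
      (measurableSet_Ioo (a := -S k) (b := S k))).sub
      ((hasKernel_of_isNu hα1 hα2 hη hηc h3.1 h3.2 hp hHc hHs hφ (hν k h3.1 h3.2 _)).comp_M
        (measurableSet_Ioo (a := -S k) (b := S k)))
    rw [← piStar_ofL1] at hK
    refine ⟨_, hK, fun q => ?_⟩
    by_cases hq : X ≤ ‖q.2‖
    · simp [hX _ hq]
    refine norm_mul_indicator_sub_le hε.le fun hq2 => ?_
    have h4 := h1 (q.1 - q.2) (abs_lt.2 hq2)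
    have h5 := h2 q.1 q.2 (not_le.1 hq).le
    rw [hH] at h5
    rw [norm_sub_rev] at h5
    exact (norm_sub_le_norm_sub_add_norm_sub _ _ _).trans (by linarith)

theorem infinityCondition_fourier (a : CStar N) : (fourier a).InfinityCondition := by
  constructor
  · intro l D _ hD s hs
    let T : ℕ → CStar N →ₗ[ℂ] BL2 := fun k =>
      compRight (M (D.T s k) (D.measurableSet_T s k)) ∘ₗ (piStar (l k)).toLinearMap
    refine tendsto_norm_of_kernel (T := T) (C := 1) (Eventually.of_forall fun k b => ?_)
      (fun α β hα1 hα2 hα hβ hβ1 ε hε => ?_) a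
    · rw [one_mul]
      exact (norm_comp_le_of_le (norm_M_le _)).trans (norm_piStar_le _ b)
    · filter_upwards [hD.eventually_infinity hs hβ1] with k hk
      have hK := (hasKernel_piL1 (l k).1 hα hβ).comp_M (D.measurableSet_T s k)
      rw [← piStar_ofL1] at hK
      refine ⟨_, hK, fun q => ?_⟩
      by_cases hq : q.1 - q.2 ∈ D.T s k
      · rw [hk _ hq, mul_zero, zero_mul, norm_zero]
        positivity
      · rw [Set.indicator_of_notMem hq, mul_zero, norm_zero]
        positivity
  · intro l hl
    rw [tendsto_zero_iff_norm_tendsto_zero]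
    refine tendsto_norm_of_kernel (T := fun k => (piStar (l k)).toLinearMap) (C := 1)
      (Eventually.of_forall fun k b => ?_) (fun α β hα1 hα2 hα hβ hβ1 ε hε => ?_) a
    · rw [one_mul]
      exact norm_piStar_le _ b
    -- The orbits eventually avoid the support of `β̂` in `V`, that is, in `{0} × V`.
    · filter_upwards [hl ({0} ×ˢ tsupport (fourierV β)) (isCompact_singleton.prod hβ1)] with k hk
      have hK := hasKernel_piL1 (l k).1 hα hβ
      rw [← piStar_ofL1] at hK
      refine ⟨_, hK, fun q => ?_⟩
      have h0 : fourierV β (coact (q.1 - q.2) (l k).1) = 0 := by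
        by_contra h
        exact Set.disjoint_left.1 hk
          (show ((0 : ℝ), coact (q.1 - q.2) (l k).1) ∈ OpField.orbit (l k) from ⟨_, rfl⟩)
          ⟨rfl, subset_tsupport _ h⟩
      rw [h0, mul_zero, norm_zero]
      positivity

end Conditions

end ThreadLike

theorem theorem3 (N : ℕ) [Fact (3 ≤ N)] (η : ℝ → ℂ) (hη : ContDiff ℝ ∞ η)
    (hηc : HasCompactSupport η) (hη1 : ∫ x, ‖η x‖ ^ 2 = 1) (a : ThreadLike.CStar N) :
    (∀ l : ThreadLike.Sgen N, IsCompactOperator ((ThreadLike.fourier a).gen l)) ∧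
      (ThreadLike.fourier a).GenericCondition ∧
      (ThreadLike.fourier a).CharacterCondition η ∧
      (ThreadLike.fourier a).InfinityCondition :=
  ⟨fun l => ThreadLike.isCompactOperator_piStar l a, ThreadLike.genericCondition_fourier a,
    ThreadLike.characterCondition_fourier hη.continuous hηc hη1 a,
    ThreadLike.infinityCondition_fourier a⟩
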